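/- All spaces are complex. Let $\mathcal A$ be a unital Banach algebra (with contractive product and $\|1\|=1$) which is a dual Banach algebra with predual $\mathcal A_*$: that is, $\mathcal A_*$ is a Banach space, $\mathcal A=(\mathcal A_*)'$ isometrically, and the product of $\mathcal A$ is separately weak$^*$-continuous. Let $\mathcal B(\mathcal A,\mathcal A')=(\mathcal A\widehat\otimes\mathcal A)'$ via $\langle T,a\otimes b\rangle=\langle T(b),a\rangle$, with the $\mathcal A$-bimodule structure $\langle c\cdot T,a\otimes b\rangle=\langle T,a\otimes bc\rangle$, $\langle T\cdot c,a\otimes b\rangle=\langle T,ca\otimes b\rangle$, and let $\sigma WC(\mathcal B(\mathcal A,\mathcal A'))$ be the closed subspace of those $T$ for which $c\mapsto c\cdot T$ and $c\mapsto T\cdot c$ are continuous from $\mathcal A$ with its weak$^*$-topology $\sigma(\mathcal A,\mathcal A_*)$ to $\mathcal B(\mathcal A,\mathcal A')$ with its weak topology. For a bounded unital representation $\pi:\mathcal A\to\mathcal B(E)$ on a reflexive Banach space $E$, let $\mathcal A^c=\{c\in\mathcal B(E): c\,\pi(a)=\pi(a)c\ (a\in\mathcal A)\}$, let $X_\pi\subseteq\mathcal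 B(E)\widehat\otimes(E\widehat\otimes E')$ be the closed linear span of the elements $$cT\otimes x\otimes\mu-T\otimes x\otimes c'(\mu),\qquad Tc\otimes x\otimes\mu-T\otimes c(x)\otimes\mu\qquad(c\in\mathcal A^c,\ T\in\mathcal B(E),\ x\in E,\ \mu\in E'),$$ and let $\psi:\mathcal B(E)\widehat\otimes(E\widehat\otimes E')/X_\pi\to\mathcal B(\mathcal A,\mathcal A')$ be the bounded linear map determined by $$\langle\psi(T\otimes x\otimes\mu+X_\pi),a\otimes b\rangle=\langle\mu,\pi(a)T\pi(b)x\rangle\qquad(a,b\in\mathcal A).$$ Let ${}_{\mathcal A^c}\mathcal B_{\mathcal A^c}(\mathcal B(E))$ be the space of bounded $\mathcal A^c$-bimodule maps $\mathcal S:\mathcal B(E)\to\mathcal B(E)$, that is, those with $\mathcal S(cT)=c\,\mathcal S(T)$ and $\mathcal S(Tc)=\mathcal S(T)c$ for $c\in\mathcal A^c$, $T\in\mathcal B(E)$. Theorem. There are a reflexive Banach space $E$ and an isometric unital representation $\pi:\mathcal A\to\mathcal B(E)$, continuous from the weak$^*$-topology of $\mathcal A$ to the weak$^*$-topology of $\mathcal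 B(E)=(E'\widehat\otimes E)'$, such that: (1) $\psi$ maps into $\sigma WC(\mathcal B(\mathcal A,\mathcal A'))$ and is a bijection onto it; (2) the pairing $\langle\mathcal S,T\otimes x\otimes\mu+X_\pi\rangle=\langle\mu,\mathcal S(T)(x)\rangle$ gives an isometric isomorphism of ${}_{\mathcal A^c}\mathcal B_{\mathcal A^c}(\mathcal B(E))$ with the dual of $\mathcal B(E)\widehat\otimes(E\widehat\otimes E')/X_\pi$, and under this identification the adjoint $\psi'$ is a bijection from $\sigma WC(\mathcal B(\mathcal A,\mathcal A'))'$ onto ${}_{\mathcal A^c}\mathcal B_{\mathcal A^c}(\mathcal B(E))$. -/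

import Mathlib

open scoped TensorProduct Topology

universe u v

set_option maxSynthPendingDepth 3
set_option linter.unusedSectionVars false
set_option linter.style.haveILetI false

noncomputable section

/-! ### The projective tensor product of Banach spaces -/

section ProjectiveTensor

variable (E F : Type*) [NormedAddCommGroup E] [NormedSpace ℂ E]
  [NormedAddCommGroup F] [NormedSpace ℂ F]

/-- The algebraic tensor product `E ⊗ F`, to be given the projective norm. -/
def AlgProjTensor : Type _ := E ⊗[ℂ] F

instance : AddCommGroup (AlgProjTensor E F) := inferInstanceAs (AddCommGroup (E ⊗[ℂ] F))

instance : Module ℂ (AlgProjTensor E F) := inferInstanceAs (Module ℂ (E ⊗[ℂ] F))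

variable {E F}

/-- The elementary tensor `x ⊗ y` in the algebraic tensor product. -/
def AlgProjTensor.elem (x : E) (y : F) : AlgProjTensor E F := (x ⊗ₜ[ℂ] y : E ⊗[ℂ] F)

/-- The tensor `∑ xₖ ⊗ yₖ` represented by a finite list of pairs `(xₖ, yₖ)`. -/
def AlgProjTensor.ofList (l : List (E × F)) : AlgProjTensor E F :=
  (l.map fun p => AlgProjTensor.elem p.1 p.2).sum

/-- The cost `∑ ‖xₖ‖ ‖yₖ‖` of such a representation. -/
def AlgProjTensor.cost (l : List (E × F)) : ℝ :=
  (l.map fun p => ‖p.1‖ * ‖p.2‖).sum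

/-- The projective norm: the infimum of `∑ ‖xₖ‖ ‖yₖ‖` over all representations
`t = ∑ xₖ ⊗ yₖ`. -/
instance : Norm (AlgProjTensor E F) :=
  ⟨fun t => sInf (AlgProjTensor.cost '' {l : List (E × F) | AlgProjTensor.ofList l = t})⟩

namespace AlgProjTensor

theorem norm_def (t : AlgProjTensor E F) :
    ‖t‖ = sInf (cost '' {l : List (E × F) | ofList l = t}) := rfl

theorem cost_nonneg (l : List (E × F)) : 0 ≤ cost l :=
  List.sum_nonneg (by
    intro r hr
    obtain ⟨p, -, rfl⟩ := List.mem_map.1 hr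
    positivity)

theorem ofList_append (l m : List (E × F)) : ofList (l ++ m) = ofList l + ofList m := by
  induction l with
  | nil => exact (zero_add (ofList m)).symm
  | cons p l ih =>
    have h1 : ofList (p :: l ++ m) = elem p.1 p.2 + ofList (l ++ m) := rfl
    have h2 : ofList (p :: l) = elem p.1 p.2 + ofList l := rfl
    rw [h1, h2, ih, add_assoc]

theorem cost_append (l m : List (E × F)) : cost (l ++ m) = cost l + cost m := by
  simp [cost]

/-- Scaling a representation. -/
def smulList (c : ℂ) (l : List (E × F)) : List (E × F) := l.map fun p => (c • p.1, p.2)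

theorem ofList_smulList (c : ℂ) (l : List (E × F)) : ofList (smulList c l) = c • ofList l := by
  induction l with
  | nil =>
    have h : (ofList [] : AlgProjTensor E F) = 0 := rfl
    exact (h.trans (smul_zero c).symm).trans (congrArg (c • ·) h.symm)
  | cons p l ih =>
    have h1 : ofList (smulList c (p :: l))
        = c • elem p.1 p.2 + ofList (smulList c l) := rfl
    have h2 : ofList (p :: l) = elem p.1 p.2 + ofList l := rfl
    rw [h1, h2, ih, smul_add]

theorem cost_smulList (c : ℂ) (l : List (E × F)) : cost (smulList c l) = ‖c‖ * cost l := by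
  simp [cost, smulList, Function.comp_def, norm_smul, mul_assoc, List.sum_map_mul_left]

theorem exists_ofList (t : AlgProjTensor E F) : ∃ l : List (E × F), ofList l = t := by
  refine TensorProduct.induction_on (motive := fun t => ∃ l : List (E × F), ofList l = t) t
    ⟨[], rfl⟩ (fun x y => ⟨[(x, y)], add_zero (elem x y)⟩) ?_
  rintro _ _ ⟨l, rfl⟩ ⟨m, rfl⟩
  exact ⟨l ++ m, ofList_append l m⟩

theorem norm_ofList_le (l : List (E × F)) : ‖ofList l‖ ≤ cost l :=
  csInf_le ⟨0, by rintro _ ⟨m, -, rfl⟩; exact cost_nonneg m⟩ ⟨l, rfl, rfl⟩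

theorem le_norm {t : AlgProjTensor E F} {r : ℝ} (h : ∀ l, ofList l = t → r ≤ cost l) :
    r ≤ ‖t‖ := by
  obtain ⟨l, hl⟩ := exists_ofList t
  refine le_csInf ⟨_, l, hl, rfl⟩ ?_
  rintro _ ⟨m, hm, rfl⟩
  exact h m hm

theorem norm_smul_le' (c : ℂ) (t : AlgProjTensor E F) : ‖c • t‖ ≤ ‖c‖ * ‖t‖ := by
  rcases eq_or_ne c 0 with rfl | hc
  · have := norm_ofList_le ([] : List (E × F))
    simp only [zero_smul, norm_zero, zero_mul]
    exact this
  · have hpos : 0 < ‖c‖ := norm_pos_iff.2 hc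
    rw [← div_le_iff₀' hpos]
    refine le_norm fun l hl => ?_
    rw [div_le_iff₀' hpos, ← cost_smulList, ← hl, ← ofList_smulList]
    exact norm_ofList_le _

theorem core : SeminormedSpace.Core ℂ (AlgProjTensor E F) where
  norm_nonneg t := le_norm fun l _ => cost_nonneg l
  norm_smul c t := by
    refine le_antisymm (norm_smul_le' c t) ?_
    rcases eq_or_ne c 0 with rfl | hc
    · rw [norm_zero, zero_mul]
      exact le_norm fun l _ => cost_nonneg l
    · have h := norm_smul_le' c⁻¹ (c • t)
      rw [inv_smul_smul₀ hc, norm_inv] at h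
      rwa [← le_inv_mul_iff₀ (norm_pos_iff.2 hc)]
  norm_triangle s t := by
    rw [← sub_le_iff_le_add]
    refine le_norm fun l hl => ?_
    rw [sub_le_iff_le_add, ← sub_le_iff_le_add']
    refine le_norm fun m hm => ?_
    rw [sub_le_iff_le_add', ← hl, ← hm, ← ofList_append, ← cost_append]
    exact norm_ofList_le _

end AlgProjTensor

instance : SeminormedAddCommGroup (AlgProjTensor E F) :=
  SeminormedAddCommGroup.ofCore AlgProjTensor.core

instance : NormedSpace ℂ (AlgProjTensor E F) where
  norm_smul_le := AlgProjTensor.norm_smul_le'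

variable (E F) in
/-- The projective tensor product `E ⊗̂ F`: the completion of `E ⊗ F` in the projective norm. -/
abbrev ProjTensor : Type _ := UniformSpace.Completion (AlgProjTensor E F)

/-- The elementary tensor `x ⊗ y` in `E ⊗̂ F`. -/
def ProjTensor.tmul (x : E) (y : F) : ProjTensor E F :=
  ((AlgProjTensor.ofList [(x, y)] : AlgProjTensor E F) : ProjTensor E F)

variable {G : Type*} [NormedAddCommGroup G] [NormedSpace ℂ G] [CompleteSpace G]

/-- The linear map on `E ⊗ F` induced by a bounded bilinear map. -/
def AlgProjTensor.lift (B : E →L[ℂ] F →L[ℂ] G) : AlgProjTensor E F →ₗ[ℂ] G :=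
  TensorProduct.lift B.toLinearMap₁₂

theorem AlgProjTensor.lift_ofList (B : E →L[ℂ] F →L[ℂ] G) (l : List (E × F)) :
    AlgProjTensor.lift B (AlgProjTensor.ofList l) = (l.map fun p => B p.1 p.2).sum := by
  induction l with
  | nil => exact map_zero (AlgProjTensor.lift B)
  | cons p l ih =>
    have h2 : ofList (p :: l) = ofList [p] + ofList l := ofList_append [p] l
    have h3 : ofList [p] = elem p.1 p.2 := add_zero (elem p.1 p.2)
    rw [h2, map_add, ih, h3, List.map_cons, List.sum_cons]
    rfl

theorem AlgProjTensor.norm_lift_le (B : E →L[ℂ] F →L[ℂ] G) (t : AlgProjTensor E F) :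
    ‖AlgProjTensor.lift B t‖ ≤ ‖B‖ * ‖t‖ := by
  have key : ∀ l : List (E × F), ‖(l.map fun p => B p.1 p.2).sum‖ ≤ ‖B‖ * cost l := by
    intro l
    induction l with
    | nil => simp [cost]
    | cons p l ih =>
      have : cost (p :: l) = ‖p.1‖ * ‖p.2‖ + cost l := by simp [cost]
      rw [List.map_cons, List.sum_cons, this, mul_add, ← mul_assoc]
      exact (norm_add_le _ _).trans (add_le_add (B.le_opNorm₂ _ _) ih)
  rcases (norm_nonneg B).eq_or_lt with h0 | hpos
  · obtain ⟨l, rfl⟩ := exists_ofList t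
    rw [AlgProjTensor.lift_ofList]
    simpa [← h0] using key l
  · rw [← div_le_iff₀' hpos]
    refine le_norm fun l hl => ?_
    rw [div_le_iff₀' hpos, ← hl, AlgProjTensor.lift_ofList]
    exact key l

theorem ProjTensor.denseRange_coe :
    DenseRange (UniformSpace.Completion.toComplₗᵢ (𝕜 := ℂ) (E := AlgProjTensor E F)).toLinearMap :=
  UniformSpace.Completion.denseRange_coe

/-- The universal property: a bounded bilinear map `E × F → G` into a Banach space induces a
bounded linear map `E ⊗̂ F → G`. -/
def ProjTensor.lift : (E →L[ℂ] F →L[ℂ] G) →L[ℂ] (ProjTensor E F →L[ℂ] G) :=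
  LinearMap.mkContinuous
    { toFun := fun B => (AlgProjTensor.lift B).extendOfNorm
        (UniformSpace.Completion.toComplₗᵢ (𝕜 := ℂ) (E := AlgProjTensor E F)).toLinearMap
      map_add' := fun B C => by
        refine LinearMap.extendOfNorm_unique ProjTensor.denseRange_coe ‖B + C‖ ?_ _ ?_
        · intro t
          refine (AlgProjTensor.norm_lift_le (B + C) t).trans_eq ?_
          exact congrArg _ (UniformSpace.Completion.norm_coe t).symm
        · ext t
          obtain ⟨l, rfl⟩ := AlgProjTensor.exists_ofList t
          have hb : ∀ D : E →L[ℂ] F →L[ℂ] G, ∃ K : ℝ, ∀ t, ‖AlgProjTensor.lift D t‖ ≤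
              K * ‖(UniformSpace.Completion.toComplₗᵢ (𝕜 := ℂ)
                (E := AlgProjTensor E F)).toLinearMap t‖ := fun D => ⟨‖D‖, fun t =>
            (AlgProjTensor.norm_lift_le D t).trans_eq
              (congrArg _ (UniformSpace.Completion.norm_coe t).symm)⟩
          have h1 := LinearMap.extendOfNorm_eq ProjTensor.denseRange_coe (hb B)
            (AlgProjTensor.ofList l)
          have h2 := LinearMap.extendOfNorm_eq ProjTensor.denseRange_coe (hb C)
            (AlgProjTensor.ofList l)
          refine (congrArg₂ (· + ·) h1 h2).trans ?_
          simp only [AlgProjTensor.lift_ofList]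
          rw [← List.sum_map_add]
          rfl
      map_smul' := fun c B => by
        refine LinearMap.extendOfNorm_unique ProjTensor.denseRange_coe ‖c • B‖ ?_ _ ?_
        · intro t
          refine (AlgProjTensor.norm_lift_le (c • B) t).trans_eq ?_
          exact congrArg _ (UniformSpace.Completion.norm_coe t).symm
        · ext t
          obtain ⟨l, rfl⟩ := AlgProjTensor.exists_ofList t
          have h1 := LinearMap.extendOfNorm_eq (f := AlgProjTensor.lift B)
            ProjTensor.denseRange_coe ⟨‖B‖, fun t => (AlgProjTensor.norm_lift_le B t).trans_eq
              (congrArg _ (UniformSpace.Completion.norm_coe t).symm)⟩ (AlgProjTensor.ofList l)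
          refine (congrArg (c • ·) h1).trans ?_
          simp only [AlgProjTensor.lift_ofList, List.smul_sum, List.map_map]
          rfl }
    1 (fun B => by
      rw [one_mul]
      refine LinearMap.opNorm_extendOfNorm_le ProjTensor.denseRange_coe (norm_nonneg B) ?_
      intro t
      exact (AlgProjTensor.norm_lift_le B t).trans_eq
        (congrArg _ (UniformSpace.Completion.norm_coe t).symm))

@[simp]
theorem ProjTensor.lift_tmul (B : E →L[ℂ] F →L[ℂ] G) (x : E) (y : F) :
    ProjTensor.lift B (ProjTensor.tmul x y) = B x y := by
  have h1 := LinearMap.extendOfNorm_eq (f := AlgProjTensor.lift B)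
    ProjTensor.denseRange_coe ⟨‖B‖, fun t => (AlgProjTensor.norm_lift_le B t).trans_eq
      (congrArg _ (UniformSpace.Completion.norm_coe t).symm)⟩ (AlgProjTensor.ofList [(x, y)])
  refine h1.trans ?_
  rw [AlgProjTensor.lift_ofList]
  simp

end ProjectiveTensor

/-! ### Dual Banach algebras and `σWC` -/

/-- `E` is reflexive: the canonical map `E → E''` is onto. -/
def IsReflexiveSpace (E : Type*) [NormedAddCommGroup E] [NormedSpace ℂ E] : Prop :=
  Function.Surjective (NormedSpace.inclusionInDoubleDual ℂ E)

/-- The weak* topology `σ(V, P)` on a space `V` identified with the dual of `P` via `Φ`. -/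
@[reducible] def weakStarTopology {V P : Type*} [AddCommGroup P] [TopologicalSpace P] [Module ℂ P]
    (Φ : V → StrongDual ℂ P) : TopologicalSpace V :=
  TopologicalSpace.induced (fun a => StrongDual.toWeakDual (Φ a)) inferInstance

/-- With `A` identified with the dual of `P` via the isometric isomorphism `Φ`, the pair `(A, P)`
is a dual Banach algebra: the product is separately weak*-continuous. -/
structure IsDualBanachAlgebra {A : Type*} {P : Type*} [NormedRing A] [NormedAlgebra ℂ A]
    [NormedAddCommGroup P] [NormedSpace ℂ P] (Φ : A ≃ₗᵢ[ℂ] StrongDual ℂ P) : Prop where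
  continuous_mul_right : ∀ b : A,
    Continuous[weakStarTopology Φ, weakStarTopology Φ] (fun a => a * b)
  continuous_mul_left : ∀ b : A,
    Continuous[weakStarTopology Φ, weakStarTopology Φ] (fun a => b * a)

section Actions

variable (A : Type*) [NormedRing A] [NormedAlgebra ℂ A]

/-- The left action of `A` on `B(A, A') = (A ⊗̂ A)'`, where `⟨T, a ⊗ b⟩ = T(b)(a)`. -/
def leftAct : A →L[ℂ] (A →L[ℂ] StrongDual ℂ A) →L[ℂ] (A →L[ℂ] StrongDual ℂ A) :=
  (ContinuousLinearMap.compL ℂ A A (StrongDual ℂ A)).flip ∘L (ContinuousLinearMap.mul ℂ A).flip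

/-- The right action of `A` on `B(A, A') = (A ⊗̂ A)'`. -/
def rightAct : A →L[ℂ] (A →L[ℂ] StrongDual ℂ A) →L[ℂ] (A →L[ℂ] StrongDual ℂ A) :=
  ContinuousLinearMap.compL ℂ A (StrongDual ℂ A) (StrongDual ℂ A) ∘L
    (ContinuousLinearMap.compL ℂ A A ℂ).flip ∘L ContinuousLinearMap.mul ℂ A

variable {A}

/-- `⟨a · T, c ⊗ b⟩ = ⟨T, c ⊗ b a⟩`. -/
@[simp]
theorem leftAct_apply (a : A) (T : A →L[ℂ] StrongDual ℂ A) (b c : A) :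
    leftAct A a T b c = T (b * a) c := rfl

/-- `⟨T · a, c ⊗ b⟩ = ⟨T, a c ⊗ b⟩`. -/
@[simp]
theorem rightAct_apply (a : A) (T : A →L[ℂ] StrongDual ℂ A) (b c : A) :
    rightAct A a T b c = T b (a * c) := rfl

end Actions

/-- `σWC(M)` for a Banach `A`-bimodule `M` with left action `l` and right action `r`: all `x` such
that `a ↦ a · x` and `a ↦ x · a` are `σ(A, P)`-`σ(M, M')` continuous. -/
def sigmaWC {A P M : Type*} [NormedRing A] [NormedAlgebra ℂ A]
    [NormedAddCommGroup P] [NormedSpace ℂ P] [NormedAddCommGroup M] [NormedSpace ℂ M]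
    (Φ : A ≃ₗᵢ[ℂ] StrongDual ℂ P) (l r : A →L[ℂ] M →L[ℂ] M) : Submodule ℂ M where
  carrier := {x |
    Continuous[weakStarTopology Φ, inferInstance] (fun a => toWeakSpace ℂ M (l a x)) ∧
    Continuous[weakStarTopology Φ, inferInstance] (fun a => toWeakSpace ℂ M (r a x))}
  zero_mem' := by
    letI := weakStarTopology Φ
    constructor <;> simp only [map_zero] <;> exact continuous_const
  add_mem' := by
    letI := weakStarTopology Φ
    rintro x y ⟨hx, hx'⟩ ⟨hy, hy'⟩
    constructor <;> simp only [map_add]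
    · exact hx.add hy
    · exact hx'.add hy'
  smul_mem' := by
    letI := weakStarTopology Φ
    rintro c x ⟨hx, hx'⟩
    constructor <;> simp only [map_smul]
    · exact hx.const_smul c
    · exact hx'.const_smul c

/-- `σWC(B(A, A'))`. -/
abbrev sigmaWCBil {A P : Type*} [NormedRing A] [NormedAlgebra ℂ A]
    [NormedAddCommGroup P] [NormedSpace ℂ P] (Φ : A ≃ₗᵢ[ℂ] StrongDual ℂ P) :
    Submodule ℂ (A →L[ℂ] StrongDual ℂ A) :=
  sigmaWC Φ (leftAct A) (rightAct A)

/-! ### Operators on `E`, bimodule maps and the map `ψ` -/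

section Operators

variable (E : Type*) [NormedAddCommGroup E] [NormedSpace ℂ E]

/-- The canonical map `B(E) → (E' ⊗̂ E)'`, `⟨T, μ ⊗ x⟩ = μ(T x)`. For reflexive `E` it is an
isometric isomorphism, exhibiting `E' ⊗̂ E` as the canonical predual of `B(E)`. -/
def opPairing : (E →L[ℂ] E) →L[ℂ] StrongDual ℂ (ProjTensor (StrongDual ℂ E) E) :=
  ProjTensor.lift ∘L (ContinuousLinearMap.compL ℂ E E ℂ).flip

/-- The projective tensor product `B(E) ⊗̂ (E ⊗̂ E')`. -/
abbrev TripleTensor : Type _ :=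
  ProjTensor (E →L[ℂ] E) (ProjTensor E (StrongDual ℂ E))

variable {E}

@[simp]
theorem opPairing_tmul (T : E →L[ℂ] E) (μ : StrongDual ℂ E) (x : E) :
    opPairing E T (ProjTensor.tmul μ x) = μ (T x) :=
  ProjTensor.lift_tmul _ _ _

/-- The elementary tensor `T ⊗ x ⊗ μ`. -/
def triple (T : E →L[ℂ] E) (x : E) (μ : StrongDual ℂ E) : TripleTensor E :=
  ProjTensor.tmul T (ProjTensor.tmul x μ)

/-- For a set `C` of operators on `E`, the closed linear span `X` of the elements
`cT ⊗ x ⊗ μ - T ⊗ x ⊗ c'(μ)` and `Tc ⊗ x ⊗ μ - T ⊗ c(x) ⊗ μ` with `c ∈ C`. -/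
def relSpace (C : Set (E →L[ℂ] E)) : Submodule ℂ (TripleTensor E) :=
  (Submodule.span ℂ
    ({z | ∃ c ∈ C, ∃ (T : E →L[ℂ] E) (x : E) (μ : StrongDual ℂ E),
        z = triple (c ∘L T) x μ - triple T x (μ ∘L c)} ∪
     {z | ∃ c ∈ C, ∃ (T : E →L[ℂ] E) (x : E) (μ : StrongDual ℂ E),
        z = triple (T ∘L c) x μ - triple T (c x) μ})).topologicalClosure

/-- The bounded maps `S : B(E) → B(E)` with `S(cT) = c S(T)` and `S(Tc) = S(T) c` for `c ∈ C`. -/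
def bimoduleMaps (C : Set (E →L[ℂ] E)) : Submodule ℂ ((E →L[ℂ] E) →L[ℂ] (E →L[ℂ] E)) where
  carrier := {S | ∀ c ∈ C, ∀ T : E →L[ℂ] E, S (c ∘L T) = c ∘L S T ∧ S (T ∘L c) = S T ∘L c}
  zero_mem' := by intro c _ T; simp
  add_mem' := by
    intro S S' hS hS' c hc T
    simp [(hS c hc T).1, (hS c hc T).2, (hS' c hc T).1, (hS' c hc T).2]
  smul_mem' := by
    intro k S hS c hc T
    simp [(hS c hc T).1, (hS c hc T).2]

variable {A : Type*} [NormedRing A] [NormedAlgebra ℂ A]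

/-- The commutant `π(A)ᶜ` of the range of a representation. -/
def commutant (π : A →A[ℂ] (E →L[ℂ] E)) : Set (E →L[ℂ] E) :=
  {T | ∀ a : A, T ∘L π a = π a ∘L T}

/-- The trilinear map `(T, x, μ) ↦ (b ↦ (a ↦ μ(π(a) T π(b) x)))`. -/
def psiForm (π : A →L[ℂ] (E →L[ℂ] E)) :
    (E →L[ℂ] E) →L[ℂ] E →L[ℂ] StrongDual ℂ E →L[ℂ] (A →L[ℂ] StrongDual ℂ A) :=
  let L : E →L[ℂ] (A →L[ℂ] E) := π.flip
  let R : StrongDual ℂ E →L[ℂ] (E →L[ℂ] StrongDual ℂ A) :=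
    (ContinuousLinearMap.compL ℂ E (A →L[ℂ] E) (StrongDual ℂ A)).flip L ∘L
      ContinuousLinearMap.compL ℂ A E ℂ
  let Q : (A →L[ℂ] E) →L[ℂ] StrongDual ℂ E →L[ℂ] (A →L[ℂ] StrongDual ℂ A) :=
    ((ContinuousLinearMap.compL ℂ A E (StrongDual ℂ A)) ∘L R).flip
  (ContinuousLinearMap.compL ℂ E (A →L[ℂ] E) _ Q) ∘L
    (ContinuousLinearMap.compL ℂ E (A →L[ℂ] E) (A →L[ℂ] E)).flip L ∘L
      ContinuousLinearMap.compL ℂ A E E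

@[simp]
theorem psiForm_apply (π : A →L[ℂ] (E →L[ℂ] E)) (T : E →L[ℂ] E) (x : E) (μ : StrongDual ℂ E)
    (a b : A) : psiForm π T x μ b a = μ (π a (T (π b x))) := rfl

/-- `ψ` before passing to the quotient: the bounded linear map `B(E) ⊗̂ (E ⊗̂ E') → B(A, A')`. -/
def psiPre (π : A →A[ℂ] (E →L[ℂ] E)) : TripleTensor E →L[ℂ] (A →L[ℂ] StrongDual ℂ A) :=
  ProjTensor.lift (ProjTensor.lift ∘L psiForm π.toContinuousLinearMap)

theorem psiPre_triple (π : A →A[ℂ] (E →L[ℂ] E)) (T : E →L[ℂ] E) (x : E) (μ : StrongDual ℂ E)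
    (a b : A) : psiPre π (triple T x μ) b a = μ (π a (T (π b x))) := by
  simp [psiPre, triple]

theorem relSpace_le_ker (π : A →A[ℂ] (E →L[ℂ] E)) :
    relSpace (commutant π) ≤ (psiPre π).ker := by
  refine Submodule.topologicalClosure_minimal _ ?_ (psiPre π).isClosed_ker
  rw [Submodule.span_le]
  rintro z (⟨c, hc, T, x, μ, rfl⟩ | ⟨c, hc, T, x, μ, rfl⟩)
  · have h : ∀ (a : A) (y : E), c (π a y) = π a (c y) := fun a y => DFunLike.congr_fun (hc a) y
    simp only [SetLike.mem_coe, LinearMap.mem_ker, ContinuousLinearMap.coe_coe, map_sub]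
    ext b a
    simp [psiPre_triple, h]
  · have h : ∀ (a : A) (y : E), c (π a y) = π a (c y) := fun a y => DFunLike.congr_fun (hc a) y
    simp only [SetLike.mem_coe, LinearMap.mem_ker, ContinuousLinearMap.coe_coe, map_sub]
    ext b a
    simp [psiPre_triple, h]

/-- The space `(B(E) ⊗̂ (E ⊗̂ E')) / X`, where `X` is formed from the commutant of `π(A)`. -/
abbrev BimodulePredual (π : A →A[ℂ] (E →L[ℂ] E)) : Type _ :=
  TripleTensor E ⧸ relSpace (commutant π)

/-- The natural map `ψ : (B(E) ⊗̂ (E ⊗̂ E')) / X → B(A, A')`. -/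
def psi (π : A →A[ℂ] (E →L[ℂ] E)) : BimodulePredual π →L[ℂ] (A →L[ℂ] StrongDual ℂ A) :=
  (relSpace (commutant π)).liftQL (psiPre π) (relSpace_le_ker π)

/-- `⟨ψ(T ⊗ x ⊗ μ + X), a ⊗ b⟩ = μ(π(a) T π(b) x)`. -/
theorem psi_mk_triple (π : A →A[ℂ] (E →L[ℂ] E)) (T : E →L[ℂ] E) (x : E) (μ : StrongDual ℂ E)
    (a b : A) :
    psi π ((relSpace (commutant π)).mkQL (triple T x μ)) b a = μ (π a (T (π b x))) := by
  rw [← psiPre_triple π T x μ a b]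
  simp [psi]

end Operators

end

noncomputable section

/-! ### Hahn–Banach consequences and reflexivity -/

section Reflexive

variable {E : Type*} [NormedAddCommGroup E] [NormedSpace ℂ E]
  {Y : Type*} [NormedAddCommGroup Y] [NormedSpace ℂ Y]

/-! Call a seminorm on `A` admissible if it is bounded, its completion is reflexive, and every
functional bounded by it is weak*-continuous. The space `E` is the ℓ²-sum of all completions of `A`
in admissible left-module seminorms and of the duals of all completions in admissible right-module
seminorms. The sum is reflexive, its coefficients are weak*-continuous, and it contains each of
these cyclic and cocyclic modules as a contractively complemented submodule (`exists_isUniversal`).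

Surjectivity of ψ. For `T` in σWC the seminorms s(b) = ‖b·T‖ and r(a) = ‖T·a‖ are normal, so the
unit ball of `A` is relatively weakly compact in their completions. Since |T(b)(a)| is at most
s(b)‖a‖ and at most ‖b‖r(a), real interpolation of type (1/2, 2) of s and r with the norm, as in the
Davis–Figiel–Johnson–Pełczyński factorisation, gives seminorms p and q with reflexive completions
(`isReflexiveSpace_interpSeminorm`) for which the form `T` is still bounded
(`norm_le_interpSeminorm_mul`). Thus `T` is a bounded map from a cyclic to a cocyclic submodule of
`E`, that is, the image under ψ of one elementary tensor. That ψ takes values in σWC follows from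
normality of coefficients and reflexivity (`NormalRep.psiForm_mem`).

Injectivity of ψ. Let w = Σ Tₙ ⊗ xₙ ⊗ μₙ be in the kernel and let `G` be a functional vanishing on
the relations. After rescaling, the Tₙ have norm at most ε off a finite set while Σ‖xₙ‖² and Σ‖μₙ‖²
are bounded by a constant independent of ε. With p(a)² = Σ‖π(a)xₙ‖² and q(a)² = Σ‖μₙπ(a)‖², every
term becomes a form Dₙ(b, a) = μₙ(π(a)Tₙπ(b)xₙ) on one pair of completions, and the relations
identify `G` of the n-th term with a single bounded functional of Dₙ. As Σ Dₙ vanishes pointwise,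
its large partial sums are minus tails, of norm at most ε by Cauchy–Schwarz. So G(w) = 0, and
Hahn–Banach concludes (`NormalRep.IsUniversal.mem_relSpace`).

Isometry of π comes from interpolating b ↦ ‖g(· b)‖ for normal `g`. The duality in (2) holds for
every set of operators on a reflexive space (`exists_bimoduleMaps_equiv`), and the statement on ψ'
then follows from the open mapping theorem. -/

theorem exists_dual_eq_zero_of_notMem {S : Submodule ℂ Y} (hS : IsClosed (S : Set Y)) {y : Y}
    (hy : y ∉ S) : ∃ f : StrongDual ℂ Y, (∀ x ∈ S, f x = 0) ∧ f y ≠ 0 := by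
  haveI : IsClosed (S : Set Y) := hS
  have h0 : S.mkQL y ≠ 0 := fun h => hy ((Submodule.Quotient.mk_eq_zero S).1 h)
  obtain ⟨g, -, hg⟩ := exists_dual_vector ℂ (S.mkQL y) (norm_ne_zero_iff.2 h0)
  refine ⟨g ∘L S.mkQL, fun x hx => ?_, ?_⟩
  · have : S.mkQL x = 0 := (Submodule.Quotient.mk_eq_zero S).2 hx
    simp [this]
  · rw [ContinuousLinearMap.comp_apply, hg]
    exact RCLike.ofReal_ne_zero.2 (norm_ne_zero_iff.2 h0)

theorem exists_extension_of_isometry (J : E →ₗᵢ[ℂ] Y) (g : StrongDual ℂ E) :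
    ∃ f : StrongDual ℂ Y, f ∘L J.toContinuousLinearMap = g := by
  let e := J.equivRange
  obtain ⟨f, hf, -⟩ := exists_extension_norm_eq (LinearMap.range J.toLinearMap)
    (g ∘L (e.symm.toContinuousLinearEquiv : _ →L[ℂ] E))
  refine ⟨f, ?_⟩
  ext x
  have h := hf (e x)
  simpa [e] using h

/-- A complete space embedded isometrically in `Y` is reflexive as soon as every element of its
bidual is, as a functional on `Y'`, evaluation at a point of `Y`. -/
theorem isReflexiveSpace_of_isometry_of_bidual [CompleteSpace E] (J : E →ₗᵢ[ℂ] Y)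
    (h : ∀ F : StrongDual ℂ (StrongDual ℂ E), ∃ y : Y, ∀ f : StrongDual ℂ Y,
      F (f ∘L J.toContinuousLinearMap) = f y) : IsReflexiveSpace E := by
  intro F
  obtain ⟨y, hy⟩ := h F
  have hcl : IsClosed ((LinearMap.range J.toLinearMap : Submodule ℂ Y) : Set Y) := by
    exact J.isometry.isClosedEmbedding.isClosed_range
  have hmem : y ∈ LinearMap.range J.toLinearMap := by
    by_contra hn
    obtain ⟨f, hf, hfy⟩ := exists_dual_eq_zero_of_notMem hcl hn
    apply hfy
    rw [← hy f]
    have : f ∘L J.toContinuousLinearMap = 0 := by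
      ext x
      exact hf _ ⟨x, rfl⟩
    rw [this, map_zero]
  obtain ⟨x, rfl⟩ := hmem
  refine ⟨x, ?_⟩
  ext g
  obtain ⟨f, rfl⟩ := exists_extension_of_isometry J g
  rw [hy f]
  rfl

theorem IsReflexiveSpace.of_isometry [CompleteSpace E] (hY : IsReflexiveSpace Y)
    (J : E →ₗᵢ[ℂ] Y) : IsReflexiveSpace E := by
  refine isReflexiveSpace_of_isometry_of_bidual J fun F => ?_
  obtain ⟨y, hy⟩ := hY (F ∘L (ContinuousLinearMap.compL ℂ E Y ℂ).flip J.toContinuousLinearMap)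
  exact ⟨y, fun f => (DFunLike.congr_fun hy f).symm⟩

theorem IsReflexiveSpace.dual (hE : IsReflexiveSpace E) : IsReflexiveSpace (StrongDual ℂ E) := by
  intro F
  refine ⟨F ∘L NormedSpace.inclusionInDoubleDual ℂ E, ?_⟩
  ext ξ
  obtain ⟨x, rfl⟩ := hE ξ
  rfl

end Reflexive

/-! ### `ℓ²`-sums -/

section EllTwo

variable {ι : Type*} {Z : ι → Type*} [∀ i, NormedAddCommGroup (Z i)] [∀ i, NormedSpace ℂ (Z i)]

theorem lp_two_norm_sq (x : lp Z 2) : ‖x‖ ^ 2 = ∑' i, ‖x i‖ ^ 2 := by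
  have := lp.norm_rpow_eq_tsum (p := 2) (by norm_num) x
  simpa using this

theorem lp_two_summable (x : lp Z 2) : Summable fun i => ‖x i‖ ^ 2 := by
  have := (lp.memℓp x).summable (p := 2) (by norm_num)
  simpa using this

theorem lp_two_sum_le (x : lp Z 2) (s : Finset ι) : ∑ i ∈ s, ‖x i‖ ^ 2 ≤ ‖x‖ ^ 2 := by
  rw [lp_two_norm_sq]
  exact (lp_two_summable x).sum_le_tsum s fun i _ => by positivity

theorem memℓp_two_of_summable {x : ∀ i, Z i} (h : Summable fun i => ‖x i‖ ^ 2) :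
    Memℓp x 2 := memℓp_gen (by simpa using h)

variable [DecidableEq ι]

/-- The part of `x` carried by the finite set `s`. -/
def lpTruncate (s : Finset ι) : lp Z 2 →L[ℂ] lp Z 2 :=
  ∑ i ∈ s, lp.singleContinuousLinearMap ℂ Z 2 i ∘L lp.evalCLM ℂ Z 2 i

theorem lpTruncate_apply (s : Finset ι) (x : lp Z 2) :
    lpTruncate s x = ∑ i ∈ s, lp.single 2 i (x i) := by
  simp [lpTruncate]
  rfl

theorem lpTruncate_apply_coord (s : Finset ι) (x : lp Z 2) (i : ι) :
    lpTruncate s x i = if i ∈ s then x i else 0 := by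
  rw [lpTruncate_apply, lp.coeFn_sum, Finset.sum_apply]
  split_ifs with h
  · rw [Finset.sum_eq_single i]
    · simp
    · intro j _ hj
      exact lp.single_apply_ne _ _ _ hj.symm
    · intro h'; exact absurd h h'
  · refine Finset.sum_eq_zero fun j hj => ?_
    exact lp.single_apply_ne _ _ _ (fun hij => h (hij ▸ hj))

theorem norm_sub_lpTruncate_le (s : Finset ι) (x : lp Z 2) : ‖x - lpTruncate s x‖ ≤ ‖x‖ := by
  have := lp.norm_compl_sum_single (p := 2) (by norm_num) x s
  rw [← lpTruncate_apply] at this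
  have h2 : ‖x - lpTruncate s x‖ ^ 2 = ‖x‖ ^ 2 - ∑ i ∈ s, ‖x i‖ ^ 2 := by simpa using this
  have h3 : 0 ≤ ∑ i ∈ s, ‖x i‖ ^ 2 := Finset.sum_nonneg fun i _ => by positivity
  exact (sq_le_sq₀ (norm_nonneg _) (norm_nonneg _)).1 (by linarith)

/-- The two pieces have disjoint supports, so the squares of their norms add. -/
theorem norm_lpTruncate_add_sq (s : Finset ι) (x y : lp Z 2) :
    ‖lpTruncate s x + (y - lpTruncate s y)‖ ^ 2 ≤ ‖x‖ ^ 2 + ‖y‖ ^ 2 := by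
  rw [lp_two_norm_sq, lp_two_norm_sq x, lp_two_norm_sq y,
    ← (lp_two_summable x).tsum_add (lp_two_summable y)]
  refine (lp_two_summable _).tsum_le_tsum (fun i => ?_)
    ((lp_two_summable x).add (lp_two_summable y))
  rw [lp.coeFn_add, lp.coeFn_sub, Pi.add_apply, Pi.sub_apply, lpTruncate_apply_coord,
    lpTruncate_apply_coord]
  split_ifs <;> simp

theorem tendsto_lpTruncate (x : lp Z 2) :
    Filter.Tendsto (fun s => lpTruncate s x) Filter.atTop (𝓝 x) := by
  have := lp.hasSum_single (p := 2) (by norm_num) x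
  simpa only [HasSum, lpTruncate_apply, SummationFilter.unconditional_filter] using this

theorem exists_norm_eq_one_mul_eq_norm (z : ℂ) : ∃ c : ℂ, ‖c‖ = 1 ∧ c * z = ‖z‖ := by
  rcases eq_or_ne z 0 with rfl | hz
  · exact ⟨1, by simp⟩
  · have hz' : (‖z‖ : ℂ) ≠ 0 := by exact_mod_cast norm_ne_zero_iff.2 hz
    refine ⟨‖z‖ / z, ?_, by field_simp⟩
    rw [norm_div, Complex.norm_real, norm_norm, div_self (norm_ne_zero_iff.2 hz)]

/-- A functional on an `ℓ²`-sum is small off a suitable finite set. -/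
theorem exists_finset_norm_apply_sub_lpTruncate_le (f : StrongDual ℂ (lp Z 2)) {ε : ℝ}
    (hε : 0 < ε) : ∃ s : Finset ι, ∀ y : lp Z 2, ‖f (y - lpTruncate s y)‖ ≤ ε * ‖y‖ := by
  set N := ‖f‖ with hN
  have hN0 : 0 ≤ N := norm_nonneg f
  -- Perturb a nearly norming vector carried by `s` by `t` times a vector off `s`: the norm grows
  -- only by t²/2 while the value of `f` grows linearly in `t`. The choice of `t` gives N·t²/2 ≤
  -- tε/2, and the defect η = tε/2 uses up the other half of tε.
  set t := ε / (N + 1) with ht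
  have ht0 : 0 < t := by positivity
  have hNt : N * t ≤ ε := by
    rw [ht, mul_div_assoc', div_le_iff₀ (by positivity)]
    nlinarith
  set η := t * ε / 2 with hη
  have hη0 : 0 < η := by positivity
  obtain ⟨s, x, hx1, hx⟩ : ∃ (s : Finset ι) (x : lp Z 2), ‖x‖ ≤ 1 ∧
      N - η < ‖f (lpTruncate s x)‖ := by
    rcases lt_or_ge (N - η) 0 with h | h
    · exact ⟨∅, 0, by simp, h.trans_le (norm_nonneg _)⟩
    · obtain ⟨x, hx1, hx⟩ := f.exists_lt_apply_of_lt_opNorm (r := N - η) (by linarith)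
      have h1 : Filter.Tendsto (fun s => ‖f (lpTruncate s x)‖) Filter.atTop (𝓝 ‖f x‖) :=
        ((f.continuous.tendsto x).comp (tendsto_lpTruncate x)).norm
      obtain ⟨s, hs⟩ := (h1.eventually (lt_mem_nhds hx)).exists
      exact ⟨s, x, hx1.le, hs⟩
  refine ⟨s, ?_⟩
  have key : ∀ y : lp Z 2, ‖y‖ ≤ 1 → ‖f (y - lpTruncate s y)‖ ≤ ε := by
    intro y hy
    obtain ⟨c, hc, hcx⟩ := exists_norm_eq_one_mul_eq_norm (f (lpTruncate s x))
    obtain ⟨d, hd, hdy⟩ := exists_norm_eq_one_mul_eq_norm (f (y - lpTruncate s y))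
    -- The phases `c` and `d` make both contributions to `f u` nonnegative reals, so they cannot
    -- cancel.
    set u : lp Z 2 := lpTruncate s (c • x) +
      (((t : ℂ) * d) • y - lpTruncate s (((t : ℂ) * d) • y)) with hu
    have hfu : f u = ((‖f (lpTruncate s x)‖ + t * ‖f (y - lpTruncate s y)‖ : ℝ) : ℂ) := by
      rw [hu, map_smul (lpTruncate s), map_smul (lpTruncate s), ← smul_sub, map_add, map_smul,
        map_smul, smul_eq_mul, smul_eq_mul, hcx, mul_assoc, hdy]
      push_cast
      rfl
    have h1 : ‖f u‖ ≤ N * ‖u‖ := f.le_opNorm u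
    have h2 : ‖u‖ ^ 2 ≤ 1 + t ^ 2 := by
      refine (norm_lpTruncate_add_sq s _ _).trans ?_
      rw [norm_smul, norm_smul, norm_mul, hc, hd, Complex.norm_real, Real.norm_of_nonneg ht0.le]
      have := norm_nonneg x
      have := norm_nonneg y
      have h3 : ‖x‖ ^ 2 ≤ 1 := by nlinarith
      have h4 : ‖y‖ ^ 2 ≤ 1 := by nlinarith
      nlinarith [sq_nonneg t]
    have h3 : ‖u‖ ≤ 1 + t ^ 2 / 2 := by
      refine abs_le_of_sq_le_sq' ?_ (by positivity) |>.2
      nlinarith [sq_nonneg (t ^ 2)]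
    rw [hfu, Complex.norm_real, Real.norm_of_nonneg (by positivity)] at h1
    have h4 : t * ‖f (y - lpTruncate s y)‖ ≤ t * ε := by
      have h5 : N * ‖u‖ ≤ N * (1 + t ^ 2 / 2) := by gcongr
      have h6 : N * t * t ≤ ε * t := by gcongr
      nlinarith
    exact le_of_mul_le_mul_left h4 ht0
  intro y
  rcases eq_or_ne y 0 with rfl | hy
  · simp
  · have hy' : ‖y‖ ≠ 0 := norm_ne_zero_iff.2 hy
    have h := key (((‖y‖⁻¹ : ℝ) : ℂ) • y) (by
      rw [norm_smul, Complex.norm_real, norm_inv, norm_norm, inv_mul_cancel₀ hy'])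
    rw [map_smul, ← smul_sub, map_smul, norm_smul, Complex.norm_real, norm_inv, norm_norm,
      inv_mul_le_iff₀ (by positivity)] at h
    linarith

/-- A functional on an `ℓ²`-sum is the norm-convergent sum of its coordinates. -/
theorem hasSum_lp_dual (f : StrongDual ℂ (lp Z 2)) :
    HasSum (fun i => f ∘L lp.singleContinuousLinearMap ℂ Z 2 i ∘L lp.evalCLM ℂ Z 2 i) f := by
  rw [HasSum, SummationFilter.unconditional_filter, Metric.tendsto_atTop]
  intro ε hε
  obtain ⟨s, hs⟩ := exists_finset_norm_apply_sub_lpTruncate_le f (half_pos hε)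
  refine ⟨s, fun t hst => ?_⟩
  have h1 : ∑ i ∈ t, f ∘L lp.singleContinuousLinearMap ℂ Z 2 i ∘L lp.evalCLM ℂ Z 2 i =
      f ∘L lpTruncate t := by
    ext x
    simp [lpTruncate]
  rw [h1, dist_comm, dist_eq_norm]
  refine lt_of_le_of_lt (ContinuousLinearMap.opNorm_le_bound _ (half_pos hε).le fun y => ?_)
    (half_lt_self hε)
  set w := y - lpTruncate t y with hw
  -- As `s ⊆ t`, the tail `w` has no coordinates in `s`, and the estimate obtained for `s` applies
  -- to it unchanged.
  have h2 : w - lpTruncate s w = w := by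
    ext i
    rw [lp.coeFn_sub, Pi.sub_apply, lpTruncate_apply_coord]
    split_ifs with hi
    · rw [hw, lp.coeFn_sub, Pi.sub_apply, lpTruncate_apply_coord, if_pos (hst hi)]
      simp
    · simp
  have h3 := hs w
  rw [h2] at h3
  have h4 : (f - f ∘L lpTruncate t) y = f w := by simp [hw]
  rw [h4]
  refine h3.trans ?_
  gcongr
  exact norm_sub_lpTruncate_le t y

/-- Cauchy–Schwarz. This is the half of the duality of ℓ²-sums that bounds the candidate vector in
`isReflexiveSpace_of_isometry_lp`. -/
theorem norm_sum_dual_eval_le (s : Finset ι) (f : ∀ i, StrongDual ℂ (Z i)) :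
    ‖∑ i ∈ s, f i ∘L lp.evalCLM ℂ Z 2 i‖ ≤ √(∑ i ∈ s, ‖f i‖ ^ 2) := by
  refine ContinuousLinearMap.opNorm_le_bound _ (Real.sqrt_nonneg _) fun x => ?_
  have h1 : ‖(∑ i ∈ s, f i ∘L lp.evalCLM ℂ Z 2 i) x‖ ≤ ∑ i ∈ s, ‖f i‖ * ‖x i‖ := by
    rw [sum_apply]
    exact (norm_sum_le _ _).trans (Finset.sum_le_sum fun i _ => (f i).le_opNorm _)
  refine h1.trans ((Real.sum_mul_le_sqrt_mul_sqrt s _ _).trans ?_)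
  gcongr
  exact Real.sqrt_le_iff.2 ⟨norm_nonneg _, lp_two_sum_le x s⟩

/-- Testing `F` on finite sums of coordinate functionals shows that the vectors `z i` are square
summable. Functionals on an ℓ²-sum are norm-convergent sums of their coordinates, so `F` is
determined by its coordinates and is evaluation at `z`. -/
theorem isReflexiveSpace_of_isometry_lp {E : Type*} [NormedAddCommGroup E] [NormedSpace ℂ E]
    [CompleteSpace E] (J : E →ₗᵢ[ℂ] lp Z 2)
    (h : ∀ (F : StrongDual ℂ (StrongDual ℂ E)) (i : ι), ∃ z : Z i, ∀ f : StrongDual ℂ (Z i),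
      F (f ∘L lp.evalCLM ℂ Z 2 i ∘L J.toContinuousLinearMap) = f z) : IsReflexiveSpace E := by
  refine isReflexiveSpace_of_isometry_of_bidual J fun F => ?_
  choose z hz using h F
  let R : StrongDual ℂ (lp Z 2) →L[ℂ] StrongDual ℂ E :=
    (ContinuousLinearMap.compL ℂ E (lp Z 2) ℂ).flip J.toContinuousLinearMap
  have hR : ∀ f, ‖R f‖ ≤ ‖f‖ := fun f => by
    refine ContinuousLinearMap.opNorm_le_bound _ (norm_nonneg _) fun x => ?_
    exact (f.le_opNorm _).trans_eq (congrArg _ (J.norm_map x))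
  have hsum : ∀ s : Finset ι, ∑ i ∈ s, ‖z i‖ ^ 2 ≤ ‖F‖ ^ 2 := by
    intro s
    choose g hg1 hg using fun i => exists_dual_vector'' ℂ (z i)
    set S := ∑ i ∈ s, ‖z i‖ ^ 2 with hS
    have hS0 : 0 ≤ S := Finset.sum_nonneg fun i _ => by positivity
    -- Weighting the norming functional of `z i` by `‖z i‖` makes `F` return `S` on a functional of
    -- norm at most `√S`, whence `S ≤ ‖F‖ √S`.
    let k : ∀ i, StrongDual ℂ (Z i) := fun i => ((‖z i‖ : ℝ) : ℂ) • g i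
    have h1 : F (R (∑ i ∈ s, k i ∘L lp.evalCLM ℂ Z 2 i)) = (S : ℂ) := by
      rw [map_sum, map_sum, hS, Complex.ofReal_sum]
      refine Finset.sum_congr rfl fun i _ => (hz i (k i)).trans ?_
      simp [k, hg, sq]
    have h2 : √(∑ i ∈ s, ‖k i‖ ^ 2) ≤ √S := by
      refine Real.sqrt_le_sqrt (Finset.sum_le_sum fun i _ => ?_)
      rw [norm_smul, Complex.norm_real, norm_norm]
      gcongr
      exact mul_le_of_le_one_right (norm_nonneg _) (hg1 i)
    have h3 : S ≤ ‖F‖ * √S := by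
      have := F.le_opNorm (R (∑ i ∈ s, k i ∘L lp.evalCLM ℂ Z 2 i))
      rw [h1, Complex.norm_real, Real.norm_of_nonneg hS0] at this
      refine this.trans ?_
      gcongr
      exact (hR _).trans ((norm_sum_dual_eval_le s k).trans h2)
    rcases hS0.eq_or_lt with h0 | h0
    · rw [← h0]; positivity
    · have h4 : √S * √S = S := Real.mul_self_sqrt hS0
      have h5 : 0 < √S := Real.sqrt_pos.2 h0
      have h6 : √S ≤ ‖F‖ := by
        refine le_of_mul_le_mul_right ?_ h5
        rwa [h4]
      rw [← h4, sq]
      gcongr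
  have hsummable : Summable fun i => ‖z i‖ ^ 2 :=
    summable_of_sum_le (fun i => by positivity) hsum
  let y : lp Z 2 := ⟨z, memℓp_two_of_summable hsummable⟩
  refine ⟨y, fun f => ?_⟩
  have h1 := ((hasSum_lp_dual f).map (F ∘L R) (F ∘L R).continuous)
  have h2 := (lp.hasSum_single (p := 2) (by norm_num) y).map f f.continuous
  refine h1.unique ?_
  have h3 : (F ∘L R) ∘ (fun i => f ∘L lp.singleContinuousLinearMap ℂ Z 2 i ∘L
      lp.evalCLM ℂ Z 2 i) = f ∘ fun i => lp.single 2 i (y i) :=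
    funext fun i => hz i (f ∘L lp.singleContinuousLinearMap ℂ Z 2 i)
  rwa [h3]

theorem isReflexiveSpace_lp [∀ i, CompleteSpace (Z i)] (h : ∀ i, IsReflexiveSpace (Z i)) :
    IsReflexiveSpace (lp Z 2) := by
  refine isReflexiveSpace_of_isometry_lp LinearIsometry.id fun F i => ?_
  obtain ⟨z, hz⟩ := h i (F ∘L (ContinuousLinearMap.compL ℂ (lp Z 2) (Z i) ℂ).flip
    (lp.evalCLM ℂ Z 2 i))
  exact ⟨z, fun f => (DFunLike.congr_fun hz f).symm⟩

end EllTwo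

/-! ### Helly's lemma -/

section Helly

variable {E : Type*} [NormedAddCommGroup E] [NormedSpace ℂ E]

/-- If the values of `F` lay outside the closed image of the ball of radius `‖F‖`, Hahn–Banach
separation in a finite-dimensional space would give a combination `h` of the `g k` with `‖F‖ ‖h‖ ≤ r
< Re F(h)`, which is absurd. -/
theorem exists_norm_le_and_dual_apply_near {κ : Type*} [Fintype κ]
    (F : StrongDual ℂ (StrongDual ℂ E)) (g : κ → StrongDual ℂ E) {δ : ℝ} (hδ : 0 < δ) :
    ∃ x : E, ‖x‖ ≤ ‖F‖ ∧ ∀ k, ‖F (g k) - g k x‖ < δ := by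
  let L : E →L[ℂ] (κ → ℂ) := ContinuousLinearMap.pi g
  let y : κ → ℂ := fun k => F (g k)
  have hy : y ∈ closure (L '' Metric.closedBall 0 ‖F‖) := by
    by_contra hn
    have hconv : Convex ℝ (closure (L '' Metric.closedBall 0 ‖F‖)) := by
      refine Convex.closure ?_
      exact (convex_closedBall (0 : E) ‖F‖).is_linear_image
        (L.toLinearMap.restrictScalars ℝ).isLinear
    obtain ⟨Λ, r, hΛ, hr⟩ := RCLike.geometric_hahn_banach_closed_point (𝕜 := ℂ) hconv
      isClosed_closure hn
    let h : StrongDual ℂ E := Λ ∘L L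
    have hF : F h = Λ y := by
      classical
      have hΛ' : ∀ w, Λ w = ∑ k, w k * Λ (fun j => if k = j then 1 else 0) :=
        fun w => LinearMap.pi_apply_eq_sum_univ Λ.toLinearMap w
      have h1 : h = ∑ k, Λ (fun j => if k = j then 1 else 0) • g k := by
        ext x
        simp only [h, ContinuousLinearMap.comp_apply, sum_apply, smul_apply, smul_eq_mul]
        rw [hΛ' (L x)]
        exact Finset.sum_congr rfl fun k _ => mul_comm _ _
      rw [h1, map_sum, hΛ' y]
      refine Finset.sum_congr rfl fun k _ => ?_
      rw [map_smul, smul_eq_mul, mul_comm]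
    have hle : ‖((‖F‖ : ℝ) : ℂ) • h‖ ≤ r := by
      by_contra hlt
      obtain ⟨x, hx1, hx⟩ := ContinuousLinearMap.exists_lt_apply_of_lt_opNorm _ (not_le.1 hlt)
      obtain ⟨c, hc, hcx⟩ := exists_norm_eq_one_mul_eq_norm ((((‖F‖ : ℝ) : ℂ) • h) x)
      have h2 := hΛ (L ((c * (‖F‖ : ℝ)) • x)) (subset_closure ⟨_, by
        rw [mem_closedBall_zero_iff, norm_smul, norm_mul, hc, Complex.norm_real, norm_norm]
        nlinarith [norm_nonneg F], rfl⟩)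
      have h3 : Λ (L ((c * (‖F‖ : ℝ)) • x)) = c * (((‖F‖ : ℝ) : ℂ) • h) x := by
        rw [map_smul, map_smul, smul_eq_mul, smul_apply, smul_eq_mul, mul_assoc]
        rfl
      rw [h3, hcx] at h2
      have h4 : RCLike.re ((‖(((‖F‖ : ℝ) : ℂ) • h) x‖ : ℝ) : ℂ) = ‖(((‖F‖ : ℝ) : ℂ) • h) x‖ :=
        Complex.ofReal_re _
      linarith
    rw [norm_smul, Complex.norm_real, norm_norm] at hle
    rw [← hF] at hr
    have h5 : RCLike.re (F h) ≤ ‖F h‖ := RCLike.re_le_norm _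
    linarith [F.le_opNorm h]
  rw [Metric.mem_closure_iff] at hy
  obtain ⟨_, ⟨x, hx, rfl⟩, hxy⟩ := hy δ hδ
  refine ⟨x, by simpa using hx, fun k => ?_⟩
  rw [← dist_eq_norm]
  exact (dist_le_pi_dist y (L x) k).trans_lt hxy

end Helly

/-! ### The completion of a space with respect to a seminorm -/

section SeminormCompletion

variable {V : Type*} [AddCommGroup V] [Module ℂ V]

/-- The space `V` with the topology given by the seminorm `p`. -/
def SeminormSpace (_p : Seminorm ℂ V) : Type _ := V

instance (p : Seminorm ℂ V) : SeminormedAddCommGroup (SeminormSpace p) :=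
  p.toAddGroupSeminorm.toSeminormedAddCommGroup

instance (p : Seminorm ℂ V) : Module ℂ (SeminormSpace p) := inferInstanceAs (Module ℂ V)

instance (p : Seminorm ℂ V) : NormedSpace ℂ (SeminormSpace p) where
  norm_smul_le c x := (map_smul_eq_mul p c x).le

/-- The Banach space obtained by completing `V` with respect to the seminorm `p`. -/
def SeminormCompletion (p : Seminorm ℂ V) : Type _ :=
  UniformSpace.Completion (SeminormSpace p)

instance (p : Seminorm ℂ V) : NormedAddCommGroup (SeminormCompletion p) :=
  inferInstanceAs (NormedAddCommGroup (UniformSpace.Completion (SeminormSpace p)))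

instance (p : Seminorm ℂ V) : NormedSpace ℂ (SeminormCompletion p) :=
  inferInstanceAs (NormedSpace ℂ (UniformSpace.Completion (SeminormSpace p)))

instance (p : Seminorm ℂ V) : CompleteSpace (SeminormCompletion p) :=
  inferInstanceAs (CompleteSpace (UniformSpace.Completion (SeminormSpace p)))

/-- The canonical map from `V` to its completion with respect to `p`. -/
def toSeminormCompletion (p : Seminorm ℂ V) : V →ₗ[ℂ] SeminormCompletion p :=
  (UniformSpace.Completion.toComplₗᵢ (𝕜 := ℂ) (E := SeminormSpace p)).toLinearMap

variable (p : Seminorm ℂ V)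

@[simp]
theorem norm_toSeminormCompletion (x : V) : ‖toSeminormCompletion p x‖ = p x :=
  UniformSpace.Completion.norm_coe (E := SeminormSpace p) x

theorem denseRange_toSeminormCompletion : DenseRange (toSeminormCompletion p) :=
  UniformSpace.Completion.denseRange_coe (α := SeminormSpace p)

variable {Y : Type*} [NormedAddCommGroup Y] [NormedSpace ℂ Y]

variable {p} in
theorem SeminormCompletion.ext {f g : SeminormCompletion p →L[ℂ] Y}
    (h : ∀ x, f (toSeminormCompletion p x) = g (toSeminormCompletion p x)) : f = g :=
  ContinuousLinearMap.coeFn_injective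
    ((denseRange_toSeminormCompletion p).equalizer f.continuous g.continuous (funext h))

variable [CompleteSpace Y]

/-- The extension to the completion of a linear map bounded by a multiple of the seminorm. -/
def SeminormCompletion.lift (f : V →ₗ[ℂ] Y) : SeminormCompletion p →L[ℂ] Y :=
  f.extendOfNorm (toSeminormCompletion p)

variable {p}

theorem SeminormCompletion.lift_apply {f : V →ₗ[ℂ] Y} {C : ℝ} (h : ∀ x, ‖f x‖ ≤ C * p x) (x : V) :
    SeminormCompletion.lift p f (toSeminormCompletion p x) = f x :=
  LinearMap.extendOfNorm_eq (denseRange_toSeminormCompletion p)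
    ⟨C, fun x => by simpa using h x⟩ x

theorem SeminormCompletion.norm_lift_le {f : V →ₗ[ℂ] Y} {C : ℝ} (hC : 0 ≤ C)
    (h : ∀ x, ‖f x‖ ≤ C * p x) : ‖SeminormCompletion.lift p f‖ ≤ C :=
  LinearMap.opNorm_extendOfNorm_le (denseRange_toSeminormCompletion p) hC
    fun x => by simpa using h x

theorem exists_lift_isometry {f : V →ₗ[ℂ] Y} (h : ∀ x, ‖f x‖ = p x) :
    ∃ J : SeminormCompletion p →ₗᵢ[ℂ] Y, ∀ x, J (toSeminormCompletion p x) = f x := by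
  have h1 : ∀ x, ‖f x‖ ≤ 1 * p x := fun x => by rw [one_mul, h]
  refine ⟨⟨(SeminormCompletion.lift p f).toLinearMap, fun z => ?_⟩,
    SeminormCompletion.lift_apply h1⟩
  refine (denseRange_toSeminormCompletion p).induction_on
    (p := fun z => ‖SeminormCompletion.lift p f z‖ = ‖z‖) z ?_ fun x => ?_
  · exact isClosed_eq (SeminormCompletion.lift p f).continuous.norm continuous_norm
  · rw [SeminormCompletion.lift_apply h1, norm_toSeminormCompletion, h]

end SeminormCompletion

/-! ### Normal functionals -/

section Normal

variable {A P : Type*} [NormedAddCommGroup A] [NormedSpace ℂ A] [NormedAddCommGroup P]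
  [NormedSpace ℂ P] (Φ : A ≃ₗᵢ[ℂ] StrongDual ℂ P)

/-- The embedding of the predual `P` into `A'`. -/
def predualEmbedding : P →ₗᵢ[ℂ] StrongDual ℂ A where
  toLinearMap := ((ContinuousLinearMap.compL ℂ A (StrongDual ℂ P) ℂ).flip
    (Φ.toContinuousLinearEquiv : A →L[ℂ] StrongDual ℂ P) ∘L
      NormedSpace.inclusionInDoubleDual ℂ P).toLinearMap
  norm_map' φ := by
    have h := (NormedSpace.inclusionInDoubleDualLi (𝕜 := ℂ) (E := P)).norm_map φ
    rw [← h]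
    exact ContinuousLinearMap.opNorm_comp_linearIsometryEquiv _ Φ

/-- The weak*-continuous functionals on `A`. -/
def normalFunctionals : Submodule ℂ (StrongDual ℂ A) :=
  LinearMap.range (predualEmbedding Φ).toLinearMap

/-- Completeness of the predual enters here. Every later proof of normality verifies it on a dense
set or on partial sums and then passes to a norm limit. -/
theorem isClosed_normalFunctionals [CompleteSpace P] :
    IsClosed (normalFunctionals Φ : Set (StrongDual ℂ A)) :=
  (predualEmbedding Φ).isometry.isClosedEmbedding.isClosed_range

/-- The weak* topology is the initial topology of the functionals given by `P`. A linear functional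
continuous for an initial topology lies in the span of the defining family, and this family is
already a subspace. -/
theorem mem_normalFunctionals_iff (f : StrongDual ℂ A) :
    f ∈ normalFunctionals Φ ↔ Continuous[weakStarTopology Φ, inferInstance] f := by
  have htop : weakStarTopology Φ = ⨅ φ : P, TopologicalSpace.induced
      ((predualEmbedding Φ φ).toLinearMap) inferInstance := by
    have h1 : (inferInstance : TopologicalSpace (WeakDual ℂ P)) =
        TopologicalSpace.induced (fun ω φ => ω φ) Pi.topologicalSpace := rfl
    rw [weakStarTopology, h1, induced_compose, induced_to_pi]
    rfl
  have h := LinearMap.mem_span_iff_continuous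
    (f := fun φ : P => (predualEmbedding Φ φ).toLinearMap) f.toLinearMap
  rw [htop]
  refine Iff.trans ?_ h
  have hr : Submodule.span ℂ (Set.range fun φ : P => (predualEmbedding Φ φ).toLinearMap) =
      (normalFunctionals Φ).map (ContinuousLinearMap.coeLM ℂ) := by
    rw [normalFunctionals, ← LinearMap.range_comp, ← Submodule.span_eq (LinearMap.range _)]
    rfl
  rw [hr]
  constructor
  · intro hf
    exact ⟨f, hf, rfl⟩
  · rintro ⟨g, hg, hgf⟩
    rwa [← ContinuousLinearMap.coe_injective hgf]

/-- A seminorm all of whose bounded functionals are weak*-continuous. -/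
def IsNormalSeminorm (s : Seminorm ℂ A) : Prop :=
  ∀ (f : StrongDual ℂ A) (C : ℝ), (∀ a, ‖f a‖ ≤ C * s a) → f ∈ normalFunctionals Φ

end Normal

/-! ### `ℓ²`-combinations of seminorms -/

section EllTwoSeminorm

variable {V : Type*} [AddCommGroup V] [Module ℂ V] {ι : Type*}

/-- The map `x ↦ ([x]ᵢ)ᵢ` into the `ℓ²`-sum of the completions with respect to the `kᵢ`. -/
def ellTwoMap (k : ι → Seminorm ℂ V) (hk : ∀ x, Summable fun i => k i x ^ 2) :
    V →ₗ[ℂ] lp (fun i => SeminormCompletion (k i)) 2 where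
  toFun x := ⟨fun i => toSeminormCompletion (k i) x, memℓp_two_of_summable (by simpa using hk x)⟩
  map_add' x y := by ext i; exact map_add _ _ _
  map_smul' c x := by ext i; exact map_smul _ _ _

@[simp]
theorem ellTwoMap_apply (k : ι → Seminorm ℂ V) (hk : ∀ x, Summable fun i => k i x ^ 2) (x : V)
    (i : ι) : ellTwoMap k hk x i = toSeminormCompletion (k i) x := rfl

/-- The seminorm `(∑ kᵢ²)^(1/2)`. -/
def ellTwoSeminorm (k : ι → Seminorm ℂ V) (hk : ∀ x, Summable fun i => k i x ^ 2) :
    Seminorm ℂ V := (normSeminorm ℂ _).comp (ellTwoMap k hk)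

variable {k : ι → Seminorm ℂ V} {hk : ∀ x, Summable fun i => k i x ^ 2}

theorem norm_ellTwoMap (x : V) : ‖ellTwoMap k hk x‖ = ellTwoSeminorm k hk x := rfl

theorem ellTwoSeminorm_sq (x : V) : ellTwoSeminorm k hk x ^ 2 = ∑' i, k i x ^ 2 := by
  rw [← norm_ellTwoMap, lp_two_norm_sq]
  simp

theorem le_ellTwoSeminorm (i : ι) (x : V) : k i x ≤ ellTwoSeminorm k hk x := by
  have := lp.norm_apply_le_norm (by norm_num) (ellTwoMap k hk x) i
  simpa [norm_ellTwoMap] using this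

theorem ellTwoSeminorm_map_le {L : V →ₗ[ℂ] V} {C : ℝ} (hC : 0 ≤ C)
    (h : ∀ i x, k i (L x) ≤ C * k i x) (x : V) :
    ellTwoSeminorm k hk (L x) ≤ C * ellTwoSeminorm k hk x := by
  refine (sq_le_sq₀ (apply_nonneg _ _) (mul_nonneg hC (apply_nonneg _ _))).1 ?_
  rw [mul_pow, ellTwoSeminorm_sq, ellTwoSeminorm_sq, ← tsum_mul_left]
  refine (hk _).tsum_le_tsum (fun i => ?_) ((hk x).mul_left _)
  rw [← mul_pow]
  exact pow_le_pow_left₀ (apply_nonneg _ _) (h i x) 2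

variable (k hk) in
theorem exists_isometry_ellTwoSeminorm :
    ∃ J : SeminormCompletion (ellTwoSeminorm k hk) →ₗᵢ[ℂ]
      lp (fun i => SeminormCompletion (k i)) 2,
      ∀ x, J (toSeminormCompletion _ x) = ellTwoMap k hk x :=
  exists_lift_isometry norm_ellTwoMap

theorem isReflexiveSpace_ellTwoSeminorm (h : ∀ i, IsReflexiveSpace (SeminormCompletion (k i))) :
    IsReflexiveSpace (SeminormCompletion (ellTwoSeminorm k hk)) := by
  classical
  obtain ⟨J, -⟩ := exists_isometry_ellTwoSeminorm k hk
  exact (isReflexiveSpace_lp h).of_isometry J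

/-- Each `k i` is dominated by `s`, so the `i`-th coordinate map factors through the completion of
`s`. Control of `F` on functionals pulled back from there determines all its coordinates, although
the completions of the individual `k i` need not be reflexive. -/
theorem isReflexiveSpace_ellTwoSeminorm_of_bidual {s : Seminorm ℂ V}
    {pr : SeminormCompletion (ellTwoSeminorm k hk) →L[ℂ] SeminormCompletion s}
    (hpr : ∀ a, pr (toSeminormCompletion _ a) = toSeminormCompletion s a)
    (hks : ∀ i, ∃ C : ℝ, ∀ a, k i a ≤ C * s a)
    (h : ∀ F : StrongDual ℂ (StrongDual ℂ (SeminormCompletion (ellTwoSeminorm k hk))),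
      ∃ z : SeminormCompletion s, ∀ f : StrongDual ℂ (SeminormCompletion s),
        F (f ∘L pr) = f z) :
    IsReflexiveSpace (SeminormCompletion (ellTwoSeminorm k hk)) := by
  classical
  obtain ⟨J, hJ⟩ := exists_isometry_ellTwoSeminorm k hk
  refine isReflexiveSpace_of_isometry_lp J fun F n => ?_
  obtain ⟨C, hC⟩ := hks n
  let θ : SeminormCompletion s →L[ℂ] SeminormCompletion (k n) :=
    SeminormCompletion.lift _ (toSeminormCompletion _)
  have hθ : ∀ a, θ (toSeminormCompletion s a) = toSeminormCompletion _ a :=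
    SeminormCompletion.lift_apply (C := C) fun a => by
      rw [norm_toSeminormCompletion]
      exact hC a
  have hcomp : lp.evalCLM ℂ (fun i => SeminormCompletion (k i)) 2 n ∘L
      J.toContinuousLinearMap = θ ∘L pr := by
    refine SeminormCompletion.ext fun a => ?_
    have h1 : J (toSeminormCompletion _ a) n = toSeminormCompletion (k n) a := by
      rw [hJ, ellTwoMap_apply]
    refine h1.trans ?_
    rw [ContinuousLinearMap.comp_apply, hpr, hθ]
  obtain ⟨z, hz⟩ := h F
  refine ⟨θ z, fun f => ?_⟩
  rw [hcomp]
  have h2 := hz (f ∘L θ)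
  rwa [ContinuousLinearMap.comp_assoc] at h2

end EllTwoSeminorm

/-! ### Stability of normal seminorms under domination and ℓ²-combinations -/

section NormalEllTwo

variable {A P : Type*} [NormedAddCommGroup A] [NormedSpace ℂ A] [NormedAddCommGroup P]
  [NormedSpace ℂ P] {Φ : A ≃ₗᵢ[ℂ] StrongDual ℂ P}

theorem IsNormalSeminorm.mono {s t : Seminorm ℂ A} (hs : IsNormalSeminorm Φ s) {C : ℝ}
    (h : ∀ a, t a ≤ C * s a) : IsNormalSeminorm Φ t := by
  intro f D hf
  -- The constant `D` may be negative, so its absolute value is needed to multiply the comparison of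
  -- seminorms.
  refine hs f (|D| * C) fun a => (hf a).trans ?_
  rw [mul_assoc]
  exact (mul_le_mul_of_nonneg_right (le_abs_self D) (apply_nonneg _ _)).trans
    (mul_le_mul_of_nonneg_left (h a) (abs_nonneg D))

/-- A functional bounded by the ℓ²-seminorm extends by Hahn–Banach to the ℓ²-sum, where it is the
norm-convergent sum of its coordinates. Each coordinate is bounded by a multiple of some `k i`,
hence normal. The bound by the norm of `A` carries the convergence over to `A'`, where the normal
functionals are closed. -/
theorem IsNormalSeminorm.ellTwo [CompleteSpace P] {ι : Type*} {k : ι → Seminorm ℂ A}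
    {hk : ∀ x, Summable fun i => k i x ^ 2} (h : ∀ i, IsNormalSeminorm Φ (k i)) {C : ℝ}
    (hC : ∀ a, ellTwoSeminorm k hk a ≤ C * ‖a‖) :
    IsNormalSeminorm Φ (ellTwoSeminorm k hk) := by
  classical
  intro f D hf
  let f' : SeminormCompletion (ellTwoSeminorm k hk) →L[ℂ] ℂ :=
    SeminormCompletion.lift _ f.toLinearMap
  obtain ⟨J, hJ⟩ := exists_isometry_ellTwoSeminorm k hk
  obtain ⟨G, hG⟩ := exists_extension_of_isometry J f'
  have hfG : ∀ a, f a = G (ellTwoMap k hk a) := fun a => by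
    rw [← hJ]
    have h1 : f' (toSeminormCompletion _ a) = f a := SeminormCompletion.lift_apply hf a
    rw [← h1, ← hG]
    rfl
  let ι' : A →L[ℂ] lp (fun i => SeminormCompletion (k i)) 2 :=
    (ellTwoMap k hk).mkContinuous C hC
  have hsum := (hasSum_lp_dual G).map
    ((ContinuousLinearMap.compL ℂ A (lp (fun i => SeminormCompletion (k i)) 2) ℂ).flip ι')
    (ContinuousLinearMap.continuous _)
  have hf' : (ContinuousLinearMap.compL ℂ A _ ℂ).flip ι' G = f := by
    ext a
    exact (hfG a).symm
  rw [hf'] at hsum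
  refine (isClosed_normalFunctionals Φ).mem_of_tendsto hsum
    (Filter.Eventually.of_forall fun s => Submodule.sum_mem _ fun i _ => ?_)
  refine h i _ ‖G ∘L lp.singleContinuousLinearMap ℂ _ 2 i‖ fun a => ?_
  refine (ContinuousLinearMap.le_opNorm (G ∘L lp.singleContinuousLinearMap ℂ _ 2 i)
    (ellTwoMap k hk a i)).trans_eq ?_
  rw [ellTwoMap_apply, norm_toSeminormCompletion]

end NormalEllTwo

/-! ### Interpolation between a seminorm and the norm -/

section Interpolation

open scoped NNReal

variable {V : Type*} [NormedAddCommGroup V] [NormedSpace ℂ V]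

/-- The `K`-functional `inf {s(x - u) + 2⁻ⁿ ‖u‖}`. -/
def kFunctional (s : Seminorm ℂ V) (n : ℕ) : Seminorm ℂ V :=
  s ⊓ ((1 / 2 : ℝ≥0) ^ n • normSeminorm ℂ V)

variable {s : Seminorm ℂ V}

theorem kFunctional_le (n : ℕ) (x : V) : kFunctional s n x ≤ s x :=
  (inf_le_left : kFunctional s n ≤ s) x

theorem kFunctional_le_norm (n : ℕ) (x : V) : kFunctional s n x ≤ (1 / 2) ^ n * ‖x‖ := by
  have h : kFunctional s n x ≤ ((1 / 2 : ℝ≥0) ^ n • normSeminorm ℂ V) x :=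
    (inf_le_right : kFunctional s n ≤ _) x
  simpa [NNReal.smul_def] using h

theorem exists_of_kFunctional_lt {n : ℕ} {x : V} {r : ℝ} (h : kFunctional s n x < r) :
    ∃ u, s (x - u) + (1 / 2) ^ n * ‖u‖ < r := by
  rw [kFunctional, Seminorm.inf_apply] at h
  obtain ⟨w, hw⟩ := exists_lt_of_ciInf_lt h
  refine ⟨x - w, ?_⟩
  simpa [NNReal.smul_def] using hw

theorem kFunctional_le_add (n : ℕ) (x u : V) :
    kFunctional s n x ≤ s (x - u) + (1 / 2) ^ n * ‖u‖ := by
  have h := map_add_le_add (kFunctional s n) (x - u) u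
  rw [sub_add_cancel] at h
  exact h.trans (add_le_add (kFunctional_le _ _) (kFunctional_le_norm _ _))

theorem le_kFunctional {n : ℕ} {x : V} {r : ℝ} (h : ∀ u, r ≤ s (x - u) + (1 / 2) ^ n * ‖u‖) :
    r ≤ kFunctional s n x := by
  by_contra hlt
  obtain ⟨u, hu⟩ := exists_of_kFunctional_lt (not_le.1 hlt)
  exact absurd (h u) (not_le.2 hu)

/-- Split `x` as `(x - u) + u` and use `s u ≤ ‖u‖`. This lower bound makes the interpolation
seminorm dominate `s`, and makes all K-functionals of `x` positive when `s x` is. -/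
theorem pow_mul_le_kFunctional (hs : ∀ x, s x ≤ ‖x‖) (n : ℕ) (x : V) :
    (1 / 2) ^ n * s x ≤ kFunctional s n x := by
  refine le_kFunctional fun u => ?_
  have h1 : s x ≤ s (x - u) + s u := by simpa using map_add_le_add s (x - u) u
  have h2 : (1 / 2 : ℝ) ^ n ≤ 1 := pow_le_one₀ (by norm_num) (by norm_num)
  have h3 : (0 : ℝ) < (1 / 2) ^ n := by positivity
  nlinarith [hs u, apply_nonneg s (x - u), apply_nonneg s u]

/-- Halving the weight of `‖u‖` at most halves the infimum. This compares near-optimal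
decompositions at consecutive levels. -/
theorem kFunctional_le_two_mul_succ (n : ℕ) (x : V) :
    kFunctional s n x ≤ 2 * kFunctional s (n + 1) x := by
  have : kFunctional s n x / 2 ≤ kFunctional s (n + 1) x := by
    refine le_kFunctional fun u => ?_
    have := kFunctional_le_add (s := s) n x u
    rw [pow_succ]
    nlinarith [apply_nonneg s (x - u)]
  linarith

theorem kFunctional_map_le {L : V →ₗ[ℂ] V} {C : ℝ} (hC : 0 ≤ C) (h : ∀ x, s (L x) ≤ C * s x)
    (h' : ∀ x, ‖L x‖ ≤ C * ‖x‖) (n : ℕ) (x : V) :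
    kFunctional s n (L x) ≤ C * kFunctional s n x := by
  rcases hC.eq_or_lt with rfl | hC
  · have h1 : L x = 0 := norm_le_zero_iff.1 (by simpa using h' x)
    simp [h1]
  · rw [← div_le_iff₀' hC]
    refine le_kFunctional fun u => ?_
    rw [div_le_iff₀' hC]
    refine (kFunctional_le_add n (L x) (L u)).trans ?_
    rw [← map_sub]
    have h3 : (0 : ℝ) < (1 / 2) ^ n := by positivity
    nlinarith [h (x - u), h' u]

/-- The weighted `K`-functionals `(2ⁿ⁻¹)^(1/2) Kₙ`. -/
def weightedK (s : Seminorm ℂ V) (n : ℕ) : Seminorm ℂ V :=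
  NNReal.sqrt (2 ^ n / 2) • kFunctional s n

theorem weightedK_apply (n : ℕ) (x : V) :
    weightedK s n x = √(2 ^ n / 2) * kFunctional s n x := by
  simp [weightedK, NNReal.smul_def]

theorem weightedK_sq (n : ℕ) (x : V) : weightedK s n x ^ 2 = 2 ^ n / 2 * kFunctional s n x ^ 2 := by
  rw [weightedK_apply, mul_pow, Real.sq_sqrt (by positivity)]

/-- The weights 2ⁿ/2 are normalised so that Σ (2ⁿ/2)·4⁻ⁿ = 1. The interpolation seminorm then lies
between `s` and the norm with constant exactly one on both sides, as the isometry of the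
representation requires. -/
theorem hasSum_half_geometric (c : ℝ) :
    HasSum (fun n : ℕ => 2 ^ n / 2 * ((1 / 2) ^ n * c) ^ 2) (c ^ 2) := by
  have h := (hasSum_geometric_of_lt_one (r := (1 / 2 : ℝ)) (by norm_num) (by norm_num)).mul_left
    (c ^ 2 / 2)
  have h1 : c ^ 2 / 2 * (1 - 1 / 2 : ℝ)⁻¹ = c ^ 2 := by norm_num
  rw [h1] at h
  convert! h using 2 with n
  rw [mul_pow, ← pow_mul, mul_comm n 2, pow_mul]
  have : (2 : ℝ) ^ n * ((1 / 2) ^ 2) ^ n = (1 / 2) ^ n := by rw [← mul_pow]; norm_num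
  rw [← this]
  ring

theorem weightedK_sq_le (n : ℕ) (x : V) :
    weightedK s n x ^ 2 ≤ 2 ^ n / 2 * ((1 / 2) ^ n * ‖x‖) ^ 2 := by
  rw [weightedK_sq]
  gcongr
  exact kFunctional_le_norm n x

theorem summable_weightedK_sq (s : Seminorm ℂ V) (x : V) :
    Summable fun n => weightedK s n x ^ 2 :=
  (hasSum_half_geometric ‖x‖).summable.of_nonneg_of_le (fun n => by positivity)
    fun n => weightedK_sq_le n x

/-- The interpolation seminorm (of type `(1/2, 2)`) between `s` and the norm. -/
def interpSeminorm (s : Seminorm ℂ V) : Seminorm ℂ V :=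
  ellTwoSeminorm (weightedK s) (summable_weightedK_sq s)

theorem interpSeminorm_le_norm (x : V) : interpSeminorm s x ≤ ‖x‖ := by
  refine (sq_le_sq₀ (apply_nonneg _ _) (norm_nonneg _)).1 ?_
  rw [interpSeminorm, ellTwoSeminorm_sq, ← (hasSum_half_geometric ‖x‖).tsum_eq]
  exact (summable_weightedK_sq s x).tsum_le_tsum (fun n => weightedK_sq_le n x)
    (hasSum_half_geometric ‖x‖).summable

theorem le_interpSeminorm (hs : ∀ x, s x ≤ ‖x‖) (x : V) : s x ≤ interpSeminorm s x := by
  refine (sq_le_sq₀ (apply_nonneg _ _) (apply_nonneg _ _)).1 ?_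
  rw [interpSeminorm, ellTwoSeminorm_sq, ← (hasSum_half_geometric (s x)).tsum_eq]
  refine (hasSum_half_geometric (s x)).summable.tsum_le_tsum (fun n => ?_)
    (summable_weightedK_sq s x)
  rw [weightedK_sq]
  gcongr
  exact pow_mul_le_kFunctional hs n x

theorem interpSeminorm_map_le {L : V →ₗ[ℂ] V} {C : ℝ} (hC : 0 ≤ C) (h : ∀ x, s (L x) ≤ C * s x)
    (h' : ∀ x, ‖L x‖ ≤ C * ‖x‖) (x : V) : interpSeminorm s (L x) ≤ C * interpSeminorm s x := by
  refine ellTwoSeminorm_map_le hC (fun n x => ?_) x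
  rw [weightedK_apply, weightedK_apply, mul_left_comm]
  gcongr
  exact kFunctional_map_le hC h h' n x

/-- The bilinear interpolation estimate: a form that is bounded for the pairs `(s, ‖·‖)` and
`(‖·‖, r)` is bounded for the pair of interpolation seminorms. -/
theorem norm_le_interpSeminorm_mul {W : Type*} [NormedAddCommGroup W] [NormedSpace ℂ W]
    {r : Seminorm ℂ W} (β : V →L[ℂ] W →L[ℂ] ℂ) (hs : ∀ x, s x ≤ ‖x‖) (hr : ∀ y, r y ≤ ‖y‖)
    (h1 : ∀ x y, ‖β x y‖ ≤ s x * ‖y‖) (h2 : ∀ x y, ‖β x y‖ ≤ ‖x‖ * r y) (x : V) (y : W) :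
    ‖β x y‖ ≤ 48 * interpSeminorm s x * interpSeminorm r y := by
  -- If `s x` or `r y` vanishes, so does the form. Otherwise all K-functionals are positive, and
  -- decompositions optimal up to a factor 2 exist at every level.
  rcases (apply_nonneg s x).eq_or_lt with hsx | hsx
  · have h3 : ‖β x y‖ ≤ 0 := by simpa [← hsx] using h1 x y
    exact h3.trans (mul_nonneg (mul_nonneg (by norm_num) (apply_nonneg _ _)) (apply_nonneg _ _))
  rcases (apply_nonneg r y).eq_or_lt with hry | hry
  · have h3 : ‖β x y‖ ≤ 0 := by simpa [← hry] using h2 x y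
    exact h3.trans (mul_nonneg (mul_nonneg (by norm_num) (apply_nonneg _ _)) (apply_nonneg _ _))
  obtain ⟨K, hK⟩ : ∃ K : ℕ → ℝ, ∀ n, K n = kFunctional s n x := ⟨_, fun n => rfl⟩
  obtain ⟨L, hL⟩ : ∃ L : ℕ → ℝ, ∀ n, L n = kFunctional r n y := ⟨_, fun n => rfl⟩
  have hK0 : ∀ n, 0 < K n := fun n => by
    have := pow_mul_le_kFunctional hs n x
    rw [hK]
    exact lt_of_lt_of_le (by positivity) this
  have hL0 : ∀ n, 0 < L n := fun n => by
    have := pow_mul_le_kFunctional hr n y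
    rw [hL]
    exact lt_of_lt_of_le (by positivity) this
  choose u hu using fun n => exists_of_kFunctional_lt (s := s) (n := n) (x := x)
    (r := 2 * K n) (by linarith [hK0 n, hK n])
  choose v hv using fun n => exists_of_kFunctional_lt (s := r) (n := n) (x := y)
    (r := 2 * L n) (by linarith [hL0 n, hL n])
  have hpow : ∀ n : ℕ, (2 : ℝ) ^ n * (1 / 2) ^ n = 1 := fun n => by rw [← mul_pow]; norm_num
  have hun : ∀ n, ‖u n‖ ≤ 2 ^ n * (2 * K n) := fun n => by
    have h3 : (1 / 2 : ℝ) ^ n * ‖u n‖ ≤ 2 * K n := by linarith [hu n, apply_nonneg s (x - u n)]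
    have h4 : (2 : ℝ) ^ n * ((1 / 2) ^ n * ‖u n‖) ≤ 2 ^ n * (2 * K n) := by gcongr
    rwa [← mul_assoc, hpow, one_mul] at h4
  have hvn : ∀ n, ‖v n‖ ≤ 2 ^ n * (2 * L n) := fun n => by
    have h3 : (1 / 2 : ℝ) ^ n * ‖v n‖ ≤ 2 * L n := by linarith [hv n, apply_nonneg r (y - v n)]
    have h4 : (2 : ℝ) ^ n * ((1 / 2) ^ n * ‖v n‖) ≤ 2 ^ n * (2 * L n) := by gcongr
    rwa [← mul_assoc, hpow, one_mul] at h4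
  have hsu : ∀ n, s (x - u n) ≤ 2 * K n := fun n => by
    have : (0 : ℝ) ≤ (1 / 2) ^ n * ‖u n‖ := by positivity
    linarith [hu n]
  have hrv : ∀ n, r (y - v n) ≤ 2 * L n := fun n => by
    have : (0 : ℝ) ≤ (1 / 2) ^ n * ‖v n‖ := by positivity
    linarith [hv n]
  have hKs : ∀ n, K n ≤ 2 * K (n + 1) := fun n => by
    rw [hK, hK]; exact kFunctional_le_two_mul_succ n x
  have hLs : ∀ n, L n ≤ 2 * L (n + 1) := fun n => by
    rw [hL, hL]; exact kFunctional_le_two_mul_succ n y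
  -- Telescoping along the decompositions. The differences `u (N + 1) - u N` and `v (N + 1) - v N`
  -- are small for `s` and `r`, and the other factor is bounded in norm. Each of the two terms costs
  -- 12·2ᴺ⁺¹K(N+1)L(N+1), which gives the constant 24.
  have hpart : ∀ N, ‖β (u N) (v N)‖ ≤ 24 * ∑ n ∈ Finset.range (N + 1), 2 ^ n * (K n * L n) := by
    intro N
    induction N with
    | zero =>
      have h3 := (h1 (u 0) (v 0)).trans (mul_le_mul (hs (u 0)) le_rfl (norm_nonneg _)
        (norm_nonneg _))
      have h4 : ‖u 0‖ ≤ 2 * K 0 := by simpa using hun 0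
      have h5 : ‖v 0‖ ≤ 2 * L 0 := by simpa using hvn 0
      have h6 : ‖u 0‖ * ‖v 0‖ ≤ 2 * K 0 * (2 * L 0) := by
        gcongr
        linarith [hK0 0]
      simp only [zero_add, Finset.sum_range_one, pow_zero, one_mul]
      nlinarith [mul_pos (hK0 0) (hL0 0)]
    | succ N ih =>
      rw [Finset.sum_range_succ, mul_add]
      have h3 : β (u (N + 1)) (v (N + 1)) = β (u N) (v N) +
          (β (u (N + 1) - u N) (v (N + 1)) + β (u N) (v (N + 1) - v N)) := by
        simp only [map_sub, sub_apply]
        ring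
      have h4 : s (u (N + 1) - u N) ≤ 6 * K (N + 1) := by
        have h5 := map_sub_le_add s (x - u N) (x - u (N + 1))
        rw [sub_sub_sub_cancel_left] at h5
        linarith [hsu N, hsu (N + 1), hKs N]
      have h6 : r (v (N + 1) - v N) ≤ 6 * L (N + 1) := by
        have h5 := map_sub_le_add r (y - v N) (y - v (N + 1))
        rw [sub_sub_sub_cancel_left] at h5
        linarith [hrv N, hrv (N + 1), hLs N]
      have h7 : ‖β (u (N + 1) - u N) (v (N + 1))‖ ≤
          6 * K (N + 1) * (2 ^ (N + 1) * (2 * L (N + 1))) :=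
        (h1 _ _).trans (mul_le_mul h4 (hvn _) (norm_nonneg _) (by linarith [hK0 (N + 1)]))
      have h8 : ‖β (u N) (v (N + 1) - v N)‖ ≤ 2 ^ N * (4 * K (N + 1)) * (6 * L (N + 1)) := by
        refine (h2 _ _).trans (mul_le_mul ((hun N).trans ?_) h6 (apply_nonneg _ _) ?_)
        · have h9 : 2 * K N ≤ 4 * K (N + 1) := by linarith [hKs N]
          gcongr
        · have := hK0 (N + 1)
          positivity
      rw [h3]
      have h9 : 24 * (2 ^ (N + 1) * (K (N + 1) * L (N + 1))) =
          6 * K (N + 1) * (2 ^ (N + 1) * (2 * L (N + 1))) +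
            2 ^ N * (4 * K (N + 1)) * (6 * L (N + 1)) := by
        rw [pow_succ]; ring
      rw [h9]
      exact (norm_add_le _ _).trans (add_le_add ih
        ((norm_add_le _ _).trans (add_le_add h7 h8)))
  -- The term 2ⁿK(n)L(n) is twice the product of the weighted K-functionals, so Cauchy–Schwarz in n
  -- turns 24 into 48.
  have hsum : ∀ N, 24 * ∑ n ∈ Finset.range N, 2 ^ n * (K n * L n) ≤
      48 * interpSeminorm s x * interpSeminorm r y := by
    intro N
    have h3 : ∀ n, 2 ^ n * (K n * L n) = 2 * (weightedK s n x * weightedK r n y) := fun n => by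
      rw [weightedK_apply, weightedK_apply, ← hK, ← hL]
      have h4 : √((2 : ℝ) ^ n / 2) * √(2 ^ n / 2) = 2 ^ n / 2 := Real.mul_self_sqrt (by positivity)
      linear_combination (-2 * (K n * L n)) * h4
    simp only [h3]
    rw [← Finset.mul_sum]
    have h5 := Real.sum_mul_le_sqrt_mul_sqrt (Finset.range N) (fun n => weightedK s n x)
      (fun n => weightedK r n y)
    have h6 : √(∑ n ∈ Finset.range N, weightedK s n x ^ 2) ≤ interpSeminorm s x := by
      refine Real.sqrt_le_iff.2 ⟨apply_nonneg _ _, ?_⟩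
      rw [interpSeminorm, ellTwoSeminorm_sq]
      exact (summable_weightedK_sq s x).sum_le_tsum _ fun n _ => by positivity
    have h7 : √(∑ n ∈ Finset.range N, weightedK r n y ^ 2) ≤ interpSeminorm r y := by
      refine Real.sqrt_le_iff.2 ⟨apply_nonneg _ _, ?_⟩
      rw [interpSeminorm, ellTwoSeminorm_sq]
      exact (summable_weightedK_sq r y).sum_le_tsum _ fun n _ => by positivity
    have h8 := h5.trans (mul_le_mul h6 h7 (Real.sqrt_nonneg _) (apply_nonneg _ _))
    linarith
  -- Replacing `(x, y)` by `(u N, v N)` costs O(2⁻ᴺ), because the K-functionals are at most 2⁻ᴺ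
  -- times the norms.
  have hbound : ∀ N : ℕ, ‖β x y‖ ≤ 48 * interpSeminorm s x * interpSeminorm r y +
      6 * (‖x‖ * ‖y‖) * (1 / 2) ^ N := by
    intro N
    have h3 : β x y = β (u N) (v N) + (β (x - u N) y + β (u N) (y - v N)) := by
      simp only [map_sub, sub_apply]
      ring
    have hKN : K N ≤ (1 / 2) ^ N * ‖x‖ := by rw [hK]; exact kFunctional_le_norm N x
    have hLN : L N ≤ (1 / 2) ^ N * ‖y‖ := by rw [hL]; exact kFunctional_le_norm N y
    have h4 : ‖β (x - u N) y‖ ≤ 2 * ((1 / 2) ^ N * ‖x‖) * ‖y‖ := by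
      refine (h1 _ _).trans (mul_le_mul_of_nonneg_right ((hsu N).trans ?_) (norm_nonneg _))
      gcongr
    have h5 : ‖β (u N) (y - v N)‖ ≤ 2 * ‖x‖ * (2 * ((1 / 2) ^ N * ‖y‖)) := by
      refine (h2 _ _).trans (mul_le_mul ?_ ((hrv N).trans (by gcongr)) (apply_nonneg _ _)
        (by positivity))
      refine (hun N).trans ?_
      have h6 : (2 : ℝ) ^ N * (2 * K N) ≤ 2 ^ N * (2 * ((1 / 2) ^ N * ‖x‖)) := by gcongr
      refine h6.trans_eq ?_
      linear_combination (2 * ‖x‖) * hpow N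
    rw [h3]
    have h7 := norm_add_le (β (u N) (v N)) (β (x - u N) y + β (u N) (y - v N))
    have h8 := norm_add_le (β (x - u N) y) (β (u N) (y - v N))
    have h9 := (hpart N).trans (hsum (N + 1))
    linarith
  refine ge_of_tendsto' (x := Filter.atTop)
    ?_ hbound
  have h3 := (tendsto_pow_atTop_nhds_zero_of_lt_one (r := (1 / 2 : ℝ)) (by norm_num)
    (by norm_num)).const_mul (6 * (‖x‖ * ‖y‖))
  simpa using h3.const_add (48 * interpSeminorm s x * interpSeminorm r y)

section Normal

variable {P : Type*} [NormedAddCommGroup P] [NormedSpace ℂ P] {Φ : V ≃ₗᵢ[ℂ] StrongDual ℂ P}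

theorem IsNormalSeminorm.weightedK (hs : IsNormalSeminorm Φ s) (n : ℕ) :
    IsNormalSeminorm Φ (weightedK s n) := by
  refine hs.mono (C := √(2 ^ n / 2)) fun a => ?_
  rw [weightedK_apply]
  gcongr
  exact kFunctional_le n a

theorem IsNormalSeminorm.interp [CompleteSpace P] (hs : IsNormalSeminorm Φ s) :
    IsNormalSeminorm Φ (interpSeminorm s) :=
  IsNormalSeminorm.ellTwo hs.weightedK (C := 1) fun a => by
    rw [one_mul]; exact interpSeminorm_le_norm a

/-- Weak compactness: an element of the bidual of the completion with respect to a normal seminorm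
that is finitely approximated from a ball of `V` is approximated by one element of this ball. -/
theorem IsNormalSeminorm.exists_norm_sub_le (hs : IsNormalSeminorm Φ s)
    (hs1 : ∀ x, s x ≤ ‖x‖)
    (H : StrongDual ℂ (StrongDual ℂ (SeminormCompletion s))) {R ε : ℝ} (hε : 0 ≤ ε)
    (h : ∀ t : Finset (StrongDual ℂ (SeminormCompletion s)), ∃ a : V, ‖a‖ ≤ R ∧
      ∀ f ∈ t, ‖H f - f (toSeminormCompletion s a)‖ ≤ ε * ‖f‖) :
    ∃ a : V, ‖H - NormedSpace.inclusionInDoubleDual ℂ _ (toSeminormCompletion s a)‖ ≤ ε := by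
  have hcomp := WeakDual.isCompact_closedBall (𝕜 := ℂ) (0 : StrongDual ℂ P) R
  have hf : ∀ f : StrongDual ℂ (SeminormCompletion s), ∃ φ : P, ∀ a : V,
      f (toSeminormCompletion s a) = Φ a φ := fun f => by
    let g : StrongDual ℂ V := (f.toLinearMap ∘ₗ toSeminormCompletion s).mkContinuous ‖f‖ fun a => by
      refine (f.le_opNorm _).trans ?_
      rw [norm_toSeminormCompletion]
      gcongr
      exact hs1 a
    obtain ⟨φ, hφ⟩ := hs g ‖f‖ fun a => by
      refine (f.le_opNorm _).trans_eq ?_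
      rw [norm_toSeminormCompletion]
    exact ⟨φ, fun a => (DFunLike.congr_fun hφ a).symm⟩
  choose φ hφ using hf
  -- By normality every functional on the completion is given by an element of the predual, so the
  -- approximation conditions are weak*-closed. The hypothesis supplies the finite intersection
  -- property on a ball that is compact by Banach–Alaoglu.
  obtain ⟨ω, -, hω⟩ := hcomp.inter_iInter_nonempty
    (fun f : StrongDual ℂ (SeminormCompletion s) =>
      {ω : WeakDual ℂ P | ‖H f - ω (φ f)‖ ≤ ε * ‖f‖})
    (fun f => isClosed_le (by
      exact (continuous_const.sub (WeakDual.eval_continuous (φ f))).norm) continuous_const)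
    (fun t => by
      obtain ⟨a, ha, hat⟩ := h t
      refine ⟨StrongDual.toWeakDual (Φ a), ?_, ?_⟩
      · have : ‖Φ a‖ ≤ R := by rwa [Φ.norm_map]
        simpa using this
      · simp only [Set.mem_iInter, Set.mem_ofPred_eq]
        intro f hf
        have := hat f hf
        rwa [hφ] at this)
  refine ⟨Φ.symm (WeakDual.toStrongDual ω), ContinuousLinearMap.opNorm_le_bound _ hε fun f => ?_⟩
  have h1 : ‖H f - ω (φ f)‖ ≤ ε * ‖f‖ := Set.mem_iInter.1 hω f
  have h2 : f (toSeminormCompletion s (Φ.symm (WeakDual.toStrongDual ω))) = ω (φ f) := by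
    rw [hφ, Φ.apply_symm_apply]
    rfl
  rw [← h2] at h1
  exact h1

/-- The weak compactness step in the reflexivity of interpolation spaces. -/
theorem IsNormalSeminorm.exists_bidual_eq (hs : IsNormalSeminorm Φ s) (hs1 : ∀ x, s x ≤ ‖x‖)
    {X : Type*} [NormedAddCommGroup X] [NormedSpace ℂ X] {e : V →ₗ[ℂ] X} (he : DenseRange e)
    {pr : X →L[ℂ] SeminormCompletion s} (hpr : ∀ a, pr (e a) = toSeminormCompletion s a)
    (hpr1 : ‖pr‖ ≤ 1) (hK : ∀ (n : ℕ) a, √(2 ^ n / 2) * kFunctional s n a ≤ ‖e a‖)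
    (F : StrongDual ℂ (StrongDual ℂ X)) :
    ∃ z : SeminormCompletion s, ∀ f : StrongDual ℂ (SeminormCompletion s),
      F (f ∘L pr) = f z := by
  let H : StrongDual ℂ (StrongDual ℂ (SeminormCompletion s)) :=
    F ∘L (ContinuousLinearMap.compL ℂ _ (SeminormCompletion s) ℂ).flip pr
  suffices h : H ∈ Set.range (NormedSpace.inclusionInDoubleDual ℂ (SeminormCompletion s)) by
    obtain ⟨z, hz⟩ := h
    exact ⟨z, fun f => (DFunLike.congr_fun hz f).symm⟩
  have hcl : IsClosed (Set.range
      (NormedSpace.inclusionInDoubleDual ℂ (SeminormCompletion s))) :=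
    (NormedSpace.inclusionInDoubleDualLi (𝕜 := ℂ)
      (E := SeminormCompletion s)).isometry.isClosedEmbedding.isClosed_range
  rw [← hcl.closure_eq, Metric.mem_closure_iff]
  intro ε hε
  suffices h : ∃ a : V, ‖H - NormedSpace.inclusionInDoubleDual ℂ _
      (toSeminormCompletion s a)‖ ≤ ε / 2 by
    obtain ⟨a, ha⟩ := h
    refine ⟨_, ⟨toSeminormCompletion s a, rfl⟩, ?_⟩
    rw [dist_eq_norm]
    linarith
  -- For this `n` every `b` with `‖e b‖ ≤ ‖F‖ + 1` has K-functional below ε/6, hence lies within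
  -- ε/6, measured by `s`, of some `a` with `‖a‖ ≤ 2ⁿ · ε/6`. This radius does not depend on the
  -- finite set of functionals to be tested.
  obtain ⟨n, hn⟩ : ∃ n : ℕ, ‖F‖ + 1 < √(2 ^ n / 2) * (ε / 6) := by
    have h1 : Filter.Tendsto (fun n : ℕ => √((2 : ℝ) ^ n / 2) * (ε / 6)) Filter.atTop
        Filter.atTop := by
      refine Filter.Tendsto.atTop_mul_const (by positivity) (Real.tendsto_sqrt_atTop.comp ?_)
      exact (tendsto_pow_atTop_atTop_of_one_lt (by norm_num)).atTop_div_const (by norm_num)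
    exact (h1.eventually_gt_atTop _).exists
  refine hs.exists_norm_sub_le hs1 H (R := 2 ^ n * (ε / 6)) (by positivity) fun t => ?_
  -- Helly's lemma is applied to normalised functionals, so that its error is relative to `‖f‖`. For
  -- `f = 0` the inverse is zero, and that case is treated apart.
  obtain ⟨x, hx, hxt⟩ := exists_norm_le_and_dual_apply_near F
    (fun f : t => (((‖(f : StrongDual ℂ (SeminormCompletion s))‖⁻¹ : ℝ) : ℂ) •
      (f : StrongDual ℂ (SeminormCompletion s))) ∘L pr) (δ := ε / 6) (by positivity)
  obtain ⟨b, hb⟩ := he.exists_dist_lt x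
    (ε := min 1 (ε / 6)) (by positivity)
  rw [dist_eq_norm] at hb
  have hbp : ‖e b‖ ≤ ‖F‖ + 1 := by
    have h1 := norm_sub_norm_le (e b) x
    rw [norm_sub_rev] at h1
    linarith [hb.trans_le (min_le_left _ _)]
  have hbK : kFunctional s n b < ε / 6 := by
    have h1 := hK n b
    have h2 : √((2 : ℝ) ^ n / 2) * kFunctional s n b < √(2 ^ n / 2) * (ε / 6) :=
      (h1.trans hbp).trans_lt hn
    exact lt_of_mul_lt_mul_left h2 (Real.sqrt_nonneg _)
  obtain ⟨a, ha⟩ := exists_of_kFunctional_lt hbK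
  have hpow : (2 : ℝ) ^ n * (1 / 2) ^ n = 1 := by rw [← mul_pow]; norm_num
  refine ⟨a, ?_, fun f hf => ?_⟩
  · have h3 : (1 / 2 : ℝ) ^ n * ‖a‖ ≤ ε / 6 := by linarith [ha, apply_nonneg s (b - a)]
    have h4 : (2 : ℝ) ^ n * ((1 / 2) ^ n * ‖a‖) ≤ 2 ^ n * (ε / 6) := by gcongr
    rwa [← mul_assoc, hpow, one_mul] at h4
  · rcases eq_or_ne f 0 with rfl | hf0
    · simp
    have hfn : 0 < ‖f‖ := norm_pos_iff.2 hf0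
    have h1 : ‖H f - f (pr x)‖ ≤ ε / 6 * ‖f‖ := by
      have h2 := (hxt ⟨f, hf⟩).le
      have h3 : F ((((‖f‖⁻¹ : ℝ) : ℂ) • f) ∘L pr) - ((((‖f‖⁻¹ : ℝ) : ℂ) • f) ∘L pr) x =
          ((‖f‖⁻¹ : ℝ) : ℂ) * (H f - f (pr x)) := by
        rw [ContinuousLinearMap.smul_comp, map_smul, mul_sub]
        rfl
      rw [h3, norm_mul, Complex.norm_real, norm_inv, norm_norm, inv_mul_le_iff₀ hfn] at h2
      linarith
    have h4 : ‖f (pr x) - f (toSeminormCompletion s b)‖ ≤ ε / 6 * ‖f‖ := by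
      rw [← hpr, ← map_sub, ← map_sub]
      refine (f.le_opNorm _).trans ?_
      rw [mul_comm]
      gcongr
      refine (pr.le_opNorm _).trans ?_
      have h5 := hb.trans_le (min_le_right _ _)
      nlinarith [norm_nonneg (x - e b)]
    have h6 : ‖f (toSeminormCompletion s b) - f (toSeminormCompletion s a)‖ ≤ ε / 6 * ‖f‖ := by
      rw [← map_sub, ← map_sub]
      refine (f.le_opNorm _).trans ?_
      rw [mul_comm, norm_toSeminormCompletion]
      gcongr
      have : (0 : ℝ) ≤ (1 / 2) ^ n * ‖a‖ := by positivity
      linarith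
    have h7 : H f - f (toSeminormCompletion s a) = (H f - f (pr x)) +
        (f (pr x) - f (toSeminormCompletion s b)) +
        (f (toSeminormCompletion s b) - f (toSeminormCompletion s a)) := by ring
    rw [h7]
    refine norm_add₃_le.trans ?_
    linarith

/-- Normality makes the balls of `V` relatively weakly compact in the completion of `s`. A bounded
set of the interpolation space is, up to any error in `s`, contained in such a ball, so the bidual
of the interpolation space is mapped into the completion of `s` itself. The ℓ²-description of the
interpolation space then gives reflexivity. -/
theorem isReflexiveSpace_interpSeminorm (hs : IsNormalSeminorm Φ s) (hs1 : ∀ x, s x ≤ ‖x‖) :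
    IsReflexiveSpace (SeminormCompletion (interpSeminorm s)) := by
  have hpr_le : ∀ a, ‖toSeminormCompletion s a‖ ≤ 1 * interpSeminorm s a := fun a => by
    rw [norm_toSeminormCompletion, one_mul]
    exact le_interpSeminorm hs1 a
  refine isReflexiveSpace_ellTwoSeminorm_of_bidual (s := s)
    (pr := SeminormCompletion.lift _ (toSeminormCompletion s))
    (SeminormCompletion.lift_apply hpr_le)
    (fun n => ⟨√(2 ^ n / 2), fun a => ?_⟩) fun F =>
      hs.exists_bidual_eq hs1 (denseRange_toSeminormCompletion _)
        (SeminormCompletion.lift_apply hpr_le) (SeminormCompletion.norm_lift_le zero_le_one hpr_le)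
        (fun n a => ?_) F
  · rw [weightedK_apply]
    gcongr
    exact kFunctional_le n a
  · rw [norm_toSeminormCompletion, ← weightedK_apply]
    exact le_ellTwoSeminorm n a

end Normal

end Interpolation

/-! ### Normal representations on reflexive spaces -/

section Coefficients

variable {A E : Type*} [NormedRing A] [NormedAlgebra ℂ A] [NormedAddCommGroup E] [NormedSpace ℂ E]

/-- The representation determined by a contractive multiplicative linear map. -/
def contractiveRep (L : A →ₗ[ℂ] (E →L[ℂ] E)) (h1 : L 1 = 1) (hmul : ∀ a b, L (a * b) = L a * L b)
    (hL : ∀ a, ‖L a‖ ≤ ‖a‖) : A →A[ℂ] (E →L[ℂ] E) where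
  toAlgHom := AlgHom.ofLinearMap L h1 hmul
  cont := (L.mkContinuous 1 fun a => by rw [one_mul]; exact hL a).continuous

/-- The coefficient functionals `a ↦ μ(π(a) x)`, linear in `μ`. -/
def coefficient (π : A →A[ℂ] (E →L[ℂ] E)) (x : E) : StrongDual ℂ E →L[ℂ] StrongDual ℂ A :=
  (ContinuousLinearMap.compL ℂ A E ℂ).flip (π.toContinuousLinearMap.flip x)

@[simp]
theorem coefficient_apply (π : A →A[ℂ] (E →L[ℂ] E)) (x : E) (μ : StrongDual ℂ E) (a : A) :
    coefficient π x μ a = μ (π a x) := rfl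

/-- The coefficient functionals `a ↦ μ(π(a) x)`, linear in `x`. -/
def coefficientFlip (π : A →A[ℂ] (E →L[ℂ] E)) (μ : StrongDual ℂ E) : E →L[ℂ] StrongDual ℂ A :=
  ContinuousLinearMap.compL ℂ A E ℂ μ ∘L π.toContinuousLinearMap.flip

theorem coefficientFlip_apply (π : A →A[ℂ] (E →L[ℂ] E)) (x : E) (μ : StrongDual ℂ E) :
    coefficientFlip π μ x = coefficient π x μ := rfl

end Coefficients

/-- A contractive representation on a reflexive Banach space with weak*-continuous coefficients. -/
structure NormalRep {A : Type u} {P : Type v} [NormedRing A] [NormedAlgebra ℂ A]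
    [NormedAddCommGroup P] [NormedSpace ℂ P] (Φ : A ≃ₗᵢ[ℂ] StrongDual ℂ P) where
  /-- The underlying space. -/
  carrier : Type u
  [normedAddCommGroup : NormedAddCommGroup carrier]
  [normedSpace : NormedSpace ℂ carrier]
  [completeSpace : CompleteSpace carrier]
  /-- The representation. -/
  rep : A →A[ℂ] (carrier →L[ℂ] carrier)
  norm_rep_le : ∀ a, ‖rep a‖ ≤ ‖a‖
  reflexive : IsReflexiveSpace carrier
  normal : ∀ x μ, coefficient rep x μ ∈ normalFunctionals Φ

attribute [instance] NormalRep.normedAddCommGroup NormalRep.normedSpace NormalRep.completeSpace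

/-! ### Cyclic and cocyclic modules of admissible seminorms -/

section Admissible

variable {A : Type u} {P : Type v} [NormedRing A] [NormedAlgebra ℂ A] [NormedAddCommGroup P]
  [NormedSpace ℂ P] {Φ : A ≃ₗᵢ[ℂ] StrongDual ℂ P}

theorem normalFunctionals_comp_mul_right (hΦ : IsDualBanachAlgebra Φ) {f : StrongDual ℂ A}
    (hf : f ∈ normalFunctionals Φ) (b : A) :
    f ∘L (ContinuousLinearMap.mul ℂ A).flip b ∈ normalFunctionals Φ := by
  rw [mem_normalFunctionals_iff] at hf ⊢
  letI := weakStarTopology Φ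
  exact hf.comp (hΦ.continuous_mul_right b)

theorem normalFunctionals_comp_mul_left (hΦ : IsDualBanachAlgebra Φ) {f : StrongDual ℂ A}
    (hf : f ∈ normalFunctionals Φ) (b : A) :
    f ∘L ContinuousLinearMap.mul ℂ A b ∈ normalFunctionals Φ := by
  rw [mem_normalFunctionals_iff] at hf ⊢
  letI := weakStarTopology Φ
  exact hf.comp (hΦ.continuous_mul_left b)

/-- A bounded normal seminorm whose completion is reflexive. -/
structure IsAdmissible (Φ : A ≃ₗᵢ[ℂ] StrongDual ℂ P) (p : Seminorm ℂ A) : Prop where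
  bound : ∃ C : ℝ, ∀ a, p a ≤ C * ‖a‖
  reflexive : IsReflexiveSpace (SeminormCompletion p)
  normal : IsNormalSeminorm Φ p

theorem IsAdmissible.exists_normal {p : Seminorm ℂ A} (hp : IsAdmissible Φ p)
    (μ : StrongDual ℂ (SeminormCompletion p)) :
    ∃ f ∈ normalFunctionals Φ, ∀ a, f a = μ (toSeminormCompletion p a) := by
  obtain ⟨C, hC⟩ := hp.bound
  let f : StrongDual ℂ A := (μ.toLinearMap ∘ₗ toSeminormCompletion p).mkContinuous (‖μ‖ * C)
    fun a => by
      refine (μ.le_opNorm _).trans ?_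
      rw [norm_toSeminormCompletion, mul_assoc]
      gcongr
      exact hC a
  refine ⟨f, hp.normal f ‖μ‖ fun a => ?_, fun a => rfl⟩
  refine (μ.le_opNorm _).trans_eq ?_
  rw [norm_toSeminormCompletion]

variable (Φ) in
/-- The admissible left-module seminorms. -/
abbrev LeftSeminorm : Type u :=
  {p : Seminorm ℂ A // IsAdmissible Φ p ∧ ∀ a b, p (a * b) ≤ ‖a‖ * p b}

variable (Φ) in
/-- The admissible right-module seminorms. -/
abbrev RightSeminorm : Type u :=
  {q : Seminorm ℂ A // IsAdmissible Φ q ∧ ∀ a b, q (a * b) ≤ ‖b‖ * q a}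

/-- Left multiplication by `a` on the completion. -/
def leftMulCompletion (p : LeftSeminorm Φ) : A →ₗ[ℂ]
    (SeminormCompletion p.1 →L[ℂ] SeminormCompletion p.1) where
  toFun a := SeminormCompletion.lift p.1 (toSeminormCompletion p.1 ∘ₗ LinearMap.mulLeft ℂ a)
  map_add' a b := SeminormCompletion.ext fun x => by
    have h : ∀ a, SeminormCompletion.lift p.1 (toSeminormCompletion p.1 ∘ₗ LinearMap.mulLeft ℂ a)
        (toSeminormCompletion p.1 x) = toSeminormCompletion p.1 (a * x) := fun a =>
      SeminormCompletion.lift_apply (C := ‖a‖) (fun x => by simpa using p.2.2 a x) x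
    rw [add_apply, h, h, h, add_mul, map_add]
  map_smul' c a := SeminormCompletion.ext fun x => by
    have h : ∀ a, SeminormCompletion.lift p.1 (toSeminormCompletion p.1 ∘ₗ LinearMap.mulLeft ℂ a)
        (toSeminormCompletion p.1 x) = toSeminormCompletion p.1 (a * x) := fun a =>
      SeminormCompletion.lift_apply (C := ‖a‖) (fun x => by simpa using p.2.2 a x) x
    rw [RingHom.id_apply, smul_apply, h, h, smul_mul_assoc, map_smul]

theorem leftMulCompletion_apply (p : LeftSeminorm Φ) (a b : A) :
    leftMulCompletion p a (toSeminormCompletion p.1 b) = toSeminormCompletion p.1 (a * b) :=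
  SeminormCompletion.lift_apply (C := ‖a‖) (fun x => by simpa using p.2.2 a x) b

/-- Right multiplication by `a` on the completion. -/
def rightMulCompletion (q : RightSeminorm Φ) : A →ₗ[ℂ]
    (SeminormCompletion q.1 →L[ℂ] SeminormCompletion q.1) where
  toFun a := SeminormCompletion.lift q.1 (toSeminormCompletion q.1 ∘ₗ LinearMap.mulRight ℂ a)
  map_add' a b := SeminormCompletion.ext fun x => by
    have h : ∀ a, SeminormCompletion.lift q.1 (toSeminormCompletion q.1 ∘ₗ LinearMap.mulRight ℂ a)
        (toSeminormCompletion q.1 x) = toSeminormCompletion q.1 (x * a) := fun a =>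
      SeminormCompletion.lift_apply (C := ‖a‖) (fun x => by simpa using q.2.2 x a) x
    rw [add_apply, h, h, h, mul_add, map_add]
  map_smul' c a := SeminormCompletion.ext fun x => by
    have h : ∀ a, SeminormCompletion.lift q.1 (toSeminormCompletion q.1 ∘ₗ LinearMap.mulRight ℂ a)
        (toSeminormCompletion q.1 x) = toSeminormCompletion q.1 (x * a) := fun a =>
      SeminormCompletion.lift_apply (C := ‖a‖) (fun x => by simpa using q.2.2 x a) x
    rw [RingHom.id_apply, smul_apply, h, h, mul_smul_comm, map_smul]

theorem rightMulCompletion_apply (q : RightSeminorm Φ) (a b : A) :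
    rightMulCompletion q a (toSeminormCompletion q.1 b) = toSeminormCompletion q.1 (b * a) :=
  SeminormCompletion.lift_apply (C := ‖a‖) (fun x => by simpa using q.2.2 x a) b

variable [CompleteSpace P]

theorem norm_leftMulCompletion_le (p : LeftSeminorm Φ) (a : A) :
    ‖leftMulCompletion p a‖ ≤ ‖a‖ :=
  SeminormCompletion.norm_lift_le (norm_nonneg a) fun x => by simpa using p.2.2 a x

/-- The action of `A` on the completion with respect to a left-module seminorm. -/
def leftHom (p : LeftSeminorm Φ) :
    A →A[ℂ] (SeminormCompletion p.1 →L[ℂ] SeminormCompletion p.1) :=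
  contractiveRep (leftMulCompletion p)
    (SeminormCompletion.ext fun x => by
      rw [leftMulCompletion_apply, one_mul, one_apply_eq_self])
    (fun a b => SeminormCompletion.ext fun x => by
      rw [leftMulCompletion_apply, mul_apply_eq_comp, leftMulCompletion_apply,
        leftMulCompletion_apply, mul_assoc])
    (norm_leftMulCompletion_le p)

theorem leftHom_apply (p : LeftSeminorm Φ) (a b : A) :
    leftHom p a (toSeminormCompletion p.1 b) = toSeminormCompletion p.1 (a * b) :=
  leftMulCompletion_apply p a b

/-- For `x` in the dense image of `A` the coefficient is a translate of a normal functional, and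
translates are normal because the product is separately weak*-continuous. -/
theorem coefficient_leftHom_mem (hΦ : IsDualBanachAlgebra Φ) (p : LeftSeminorm Φ)
    (x : SeminormCompletion p.1) (μ : StrongDual ℂ (SeminormCompletion p.1)) :
    coefficient (leftHom p) x μ ∈ normalFunctionals Φ := by
  rw [← coefficientFlip_apply]
  refine (denseRange_toSeminormCompletion p.1).induction_on
    (p := fun x => coefficientFlip (leftHom p) μ x ∈ normalFunctionals Φ) x ?_ fun b => ?_
  · exact (isClosed_normalFunctionals Φ).preimage (ContinuousLinearMap.continuous _)
  · obtain ⟨f, hf, hfμ⟩ := p.2.1.exists_normal μ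
    have h : coefficientFlip (leftHom p) μ (toSeminormCompletion p.1 b) =
        f ∘L (ContinuousLinearMap.mul ℂ A).flip b := by
      ext a
      rw [coefficientFlip_apply, coefficient_apply, leftHom_apply, ← hfμ]
      rfl
    rw [h]
    exact normalFunctionals_comp_mul_right hΦ hf b

/-- The cyclic representation on the completion with respect to a left-module seminorm. -/
def leftRep (hΦ : IsDualBanachAlgebra Φ) (p : LeftSeminorm Φ) : NormalRep Φ where
  carrier := SeminormCompletion p.1
  rep := leftHom p
  norm_rep_le := norm_leftMulCompletion_le p
  reflexive := p.2.1.reflexive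
  normal := coefficient_leftHom_mem hΦ p

theorem norm_rightMulCompletion_le (q : RightSeminorm Φ) (a : A) :
    ‖rightMulCompletion q a‖ ≤ ‖a‖ :=
  SeminormCompletion.norm_lift_le (norm_nonneg a) fun x => by simpa using q.2.2 x a

/-- The action of `A` on the dual of the completion with respect to a right-module seminorm. -/
def dualMulCompletion (q : RightSeminorm Φ) : A →ₗ[ℂ]
    (StrongDual ℂ (SeminormCompletion q.1) →L[ℂ] StrongDual ℂ (SeminormCompletion q.1)) :=
  (ContinuousLinearMap.compL ℂ (SeminormCompletion q.1) (SeminormCompletion q.1) ℂ).flip.toLinearMap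
    ∘ₗ rightMulCompletion q

theorem dualMulCompletion_apply (q : RightSeminorm Φ) (a b : A)
    (f : StrongDual ℂ (SeminormCompletion q.1)) :
    dualMulCompletion q a f (toSeminormCompletion q.1 b) = f (toSeminormCompletion q.1 (b * a)) :=
  congrArg f (rightMulCompletion_apply q a b)

theorem norm_dualMulCompletion_le (q : RightSeminorm Φ) (a : A) :
    ‖dualMulCompletion q a‖ ≤ ‖a‖ := by
  refine ContinuousLinearMap.opNorm_le_bound _ (norm_nonneg a) fun f => ?_
  refine (f.opNorm_comp_le (rightMulCompletion q a)).trans ?_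
  rw [mul_comm]
  gcongr
  exact norm_rightMulCompletion_le q a

/-- The action of `A` on the dual of the completion with respect to a right-module seminorm. -/
def rightHom (q : RightSeminorm Φ) : A →A[ℂ]
    (StrongDual ℂ (SeminormCompletion q.1) →L[ℂ] StrongDual ℂ (SeminormCompletion q.1)) :=
  contractiveRep (dualMulCompletion q)
    (by
      ext1 f
      refine SeminormCompletion.ext fun x => ?_
      rw [dualMulCompletion_apply, mul_one, one_apply_eq_self])
    (fun a b => by
      ext1 f
      refine SeminormCompletion.ext fun x => ?_
      rw [dualMulCompletion_apply, mul_apply_eq_comp, dualMulCompletion_apply,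
        dualMulCompletion_apply, mul_assoc])
    (norm_dualMulCompletion_le q)

theorem rightHom_apply (q : RightSeminorm Φ) (a b : A)
    (f : StrongDual ℂ (SeminormCompletion q.1)) :
    rightHom q a f (toSeminormCompletion q.1 b) = f (toSeminormCompletion q.1 (b * a)) :=
  dualMulCompletion_apply q a b f

/-- Reflexivity turns `ξ` into evaluation at a point of the completion. For points in the image of
`A` the coefficient is a translate of a normal functional. -/
theorem coefficient_rightHom_mem (hΦ : IsDualBanachAlgebra Φ) (q : RightSeminorm Φ)
    (f : StrongDual ℂ (SeminormCompletion q.1))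
    (ξ : StrongDual ℂ (StrongDual ℂ (SeminormCompletion q.1))) :
    coefficient (rightHom q) f ξ ∈ normalFunctionals Φ := by
  obtain ⟨x, rfl⟩ := q.2.1.reflexive ξ
  refine (denseRange_toSeminormCompletion q.1).induction_on
    (p := fun x => coefficient (rightHom q) f (NormedSpace.inclusionInDoubleDual ℂ _ x) ∈
      normalFunctionals Φ) x ?_ fun b => ?_
  · exact (isClosed_normalFunctionals Φ).preimage
      ((ContinuousLinearMap.continuous _).comp (ContinuousLinearMap.continuous _))
  · obtain ⟨g, hg, hgf⟩ := q.2.1.exists_normal f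
    have h : coefficient (rightHom q) f
        (NormedSpace.inclusionInDoubleDual ℂ _ (toSeminormCompletion q.1 b)) =
        g ∘L ContinuousLinearMap.mul ℂ A b := by
      ext a
      rw [coefficient_apply, NormedSpace.dual_def, rightHom_apply, ← hgf]
      rfl
    rw [h]
    exact normalFunctionals_comp_mul_left hΦ hg b

/-- The cocyclic representation on the dual of the completion with respect to a right-module
seminorm. -/
def rightRep (hΦ : IsDualBanachAlgebra Φ) (q : RightSeminorm Φ) : NormalRep Φ where
  carrier := StrongDual ℂ (SeminormCompletion q.1)
  rep := rightHom q
  norm_rep_le := norm_dualMulCompletion_le q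
  reflexive := q.2.1.reflexive.dual
  normal := coefficient_rightHom_mem hΦ q

end Admissible

/-! ### ℓ²-direct sums of normal representations -/

section DirectSum

variable {A : Type u} {P : Type v} [NormedRing A] [NormedAlgebra ℂ A] [NormedAddCommGroup P]
  [NormedSpace ℂ P] {Φ : A ≃ₗᵢ[ℂ] StrongDual ℂ P} {ι : Type u} (R : ι → NormalRep Φ)

theorem summable_norm_rep_sq (a : A) (x : lp (fun i => (R i).carrier) 2) :
    Summable fun i => ‖(R i).rep a (x i)‖ ^ 2 := by
  refine ((lp_two_summable x).mul_left (‖a‖ ^ 2)).of_nonneg_of_le (fun i => by positivity)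
    fun i => ?_
  rw [← mul_pow]
  exact pow_le_pow_left₀ (norm_nonneg _)
    (((R i).rep a).le_of_opNorm_le ((R i).norm_rep_le a) (x i)) 2

/-- The diagonal operator of the direct sum of representations. -/
def diagonalRep (a : A) (x : lp (fun i => (R i).carrier) 2) : lp (fun i => (R i).carrier) 2 :=
  ⟨fun i => (R i).rep a (x i), memℓp_two_of_summable (summable_norm_rep_sq R a x)⟩

theorem norm_diagonalRep_le (a : A) (x : lp (fun i => (R i).carrier) 2) :
    ‖diagonalRep R a x‖ ≤ ‖a‖ * ‖x‖ := by
  refine (sq_le_sq₀ (norm_nonneg _) (by positivity)).1 ?_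
  rw [mul_pow, lp_two_norm_sq, lp_two_norm_sq, ← tsum_mul_left]
  refine (summable_norm_rep_sq R a x).tsum_le_tsum (fun i => ?_) ((lp_two_summable x).mul_left _)
  rw [← mul_pow]
  exact pow_le_pow_left₀ (norm_nonneg _)
    (((R i).rep a).le_of_opNorm_le ((R i).norm_rep_le a) (x i)) 2

/-- The diagonal operator of the direct sum of representations, as a bounded operator. -/
def diagonalRepCLM (a : A) :
    lp (fun i => (R i).carrier) 2 →L[ℂ] lp (fun i => (R i).carrier) 2 :=
  LinearMap.mkContinuous
    { toFun := diagonalRep R a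
      map_add' := fun x y => by
        ext i
        exact map_add ((R i).rep a) (x i) (y i)
      map_smul' := fun c x => by
        ext i
        exact map_smul ((R i).rep a) c (x i) } ‖a‖ (norm_diagonalRep_le R a)

/-- The action of `A` on the `ℓ²`-sum of representations. -/
def diagonalRepL : A →ₗ[ℂ]
    (lp (fun i => (R i).carrier) 2 →L[ℂ] lp (fun i => (R i).carrier) 2) where
  toFun a := diagonalRepCLM R a
  map_add' a b := by
    ext x i
    exact DFunLike.congr_fun (map_add (R i).rep a b) (x i)
  map_smul' c a := by
    ext x i
    exact DFunLike.congr_fun (map_smul (R i).rep c a) (x i)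

theorem diagonalRepL_apply (a : A) (x : lp (fun i => (R i).carrier) 2) (i : ι) :
    diagonalRepL R a x i = (R i).rep a (x i) := rfl

theorem norm_diagonalRepL_le (a : A) : ‖diagonalRepL R a‖ ≤ ‖a‖ :=
  LinearMap.mkContinuous_norm_le _ (norm_nonneg a) (norm_diagonalRep_le R a)

variable [CompleteSpace P]

/-- The direct sum of representations as a homomorphism. -/
def diagonalHom : A →A[ℂ]
    (lp (fun i => (R i).carrier) 2 →L[ℂ] lp (fun i => (R i).carrier) 2) :=
  contractiveRep (diagonalRepL R)
    (by
      ext x i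
      rw [diagonalRepL_apply, map_one]
      rfl)
    (fun a b => by
      ext x i
      rw [diagonalRepL_apply, map_mul]
      rfl)
    (norm_diagonalRepL_le R)

/-- The functional `G` is the norm-convergent sum of its coordinates, so the coefficient is a norm
limit of finite sums of coefficients of the summands. -/
theorem coefficient_diagonalHom_mem (x : lp (fun i => (R i).carrier) 2)
    (G : StrongDual ℂ (lp (fun i => (R i).carrier) 2)) :
    coefficient (diagonalHom R) x G ∈ normalFunctionals Φ := by
  classical
  have hsum := (hasSum_lp_dual G).map (coefficient (diagonalHom R) x)
    (ContinuousLinearMap.continuous _)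
  refine (isClosed_normalFunctionals Φ).mem_of_tendsto hsum
    (Filter.Eventually.of_forall fun s => Submodule.sum_mem _ fun i _ => ?_)
  exact (R i).normal (x i) (G ∘L lp.singleContinuousLinearMap ℂ (fun i => (R i).carrier) 2 i)

/-- The `ℓ²`-direct sum of normal representations. -/
def NormalRep.directSum : NormalRep Φ where
  carrier := lp (fun i => (R i).carrier) 2
  rep := diagonalHom R
  norm_rep_le := norm_diagonalRepL_le R
  reflexive := by
    classical
    exact isReflexiveSpace_lp fun i => (R i).reflexive
  normal := coefficient_diagonalHom_mem R

/-- Each summand is complemented, by contractive module maps. -/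
theorem NormalRep.exists_inclusion_projection (i : ι) :
    ∃ (j : (R i).carrier →L[ℂ] (NormalRep.directSum R).carrier)
      (r : (NormalRep.directSum R).carrier →L[ℂ] (R i).carrier),
      (∀ x, r (j x) = x) ∧ (∀ x, ‖j x‖ ≤ ‖x‖) ∧ (∀ x, ‖r x‖ ≤ ‖x‖) ∧
      (∀ a x, j ((R i).rep a x) = (NormalRep.directSum R).rep a (j x)) ∧
      (∀ a x, r ((NormalRep.directSum R).rep a x) = (R i).rep a (r x)) := by
  classical
  refine ⟨lp.singleContinuousLinearMap ℂ (fun i => (R i).carrier) 2 i,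
    lp.evalCLM ℂ (fun i => (R i).carrier) 2 i, fun x => ?_, fun x => ?_, fun x => ?_,
    fun a x => ?_, fun a x => rfl⟩
  · exact lp.single_apply_self (E := fun i => (R i).carrier) 2 i x
  · exact (lp.norm_single (E := fun i => (R i).carrier) (p := 2) (by norm_num) i x).le
  · exact lp.norm_apply_le_norm (by norm_num) x i
  · refine lp.ext (funext fun k => ?_)
    refine Eq.trans ?_ (diagonalRepL_apply R a (lp.single (E := fun i => (R i).carrier) 2 i x) k).symm
    change lp.single (E := fun i => (R i).carrier) 2 i ((R i).rep a x) k = _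
    rcases eq_or_ne k i with rfl | hk
    · rw [lp.single_apply_self, lp.single_apply_self]
    · rw [lp.single_apply_ne _ _ _ hk, lp.single_apply_ne _ _ _ hk, map_zero]

end DirectSum

/-! ### Series in projective tensor products -/

section ProjSeries

variable {E F : Type*} [NormedAddCommGroup E] [NormedSpace ℂ E]
  [NormedAddCommGroup F] [NormedSpace ℂ F]

theorem ProjTensor.norm_tmul_le (x : E) (y : F) : ‖ProjTensor.tmul x y‖ ≤ ‖x‖ * ‖y‖ := by
  refine (UniformSpace.Completion.norm_coe _).trans_le ((AlgProjTensor.norm_ofList_le _).trans ?_)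
  simp [AlgProjTensor.cost]

theorem AlgProjTensor.ofList_singleton (x : E) (y : F) :
    (AlgProjTensor.ofList [(x, y)] : AlgProjTensor E F) = (x ⊗ₜ[ℂ] y : E ⊗[ℂ] F) :=
  add_zero (AlgProjTensor.elem x y)

/-- The canonical bilinear map `E × F → E ⊗̂ F`. -/
def ProjTensor.tmulL : E →L[ℂ] F →L[ℂ] ProjTensor E F :=
  LinearMap.mkContinuous₂
    ((TensorProduct.mk ℂ E F).compr₂
      (UniformSpace.Completion.toComplₗᵢ (𝕜 := ℂ) (E := AlgProjTensor E F)).toLinearMap) 1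
    fun x y => by
      rw [one_mul]
      refine le_trans (le_of_eq ?_) (ProjTensor.norm_tmul_le x y)
      rw [ProjTensor.tmul, AlgProjTensor.ofList_singleton]
      rfl

theorem ProjTensor.tmulL_apply (x : E) (y : F) :
    ProjTensor.tmulL x y = ProjTensor.tmul x y := by
  rw [ProjTensor.tmul, AlgProjTensor.ofList_singleton]
  rfl

theorem ProjTensor.coe_ofList (l : List (E × F)) :
    ((AlgProjTensor.ofList l : AlgProjTensor E F) : ProjTensor E F) =
      ∑ i : Fin l.length, ProjTensor.tmul (l[i.1]).1 (l[i.1]).2 := by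
  rw [Fin.sum_univ_fun_getElem l fun p => ProjTensor.tmul p.1 p.2]
  induction l with
  | nil => exact UniformSpace.Completion.coe_zero
  | cons p l ih =>
    rw [List.map_cons, List.sum_cons, ← ih]
    have h : (AlgProjTensor.ofList (p :: l) : AlgProjTensor E F) =
      AlgProjTensor.ofList [p] + AlgProjTensor.ofList l := AlgProjTensor.ofList_append [p] l
    rw [h, UniformSpace.Completion.coe_add]
    rfl

theorem AlgProjTensor.exists_cost_lt (t : AlgProjTensor E F) {ε : ℝ} (hε : 0 < ε) :
    ∃ l : List (E × F), ofList l = t ∧ cost l < ‖t‖ + ε := by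
  by_contra! h
  have := AlgProjTensor.le_norm (t := t) (r := ‖t‖ + ε) h
  linarith

/-- Every element of `E ⊗̂ F` is the sum of an absolutely convergent series of elementary
tensors. -/
theorem ProjTensor.exists_hasSum_of_pos (z : ProjTensor E F) {ε : ℝ} (hε : 0 < ε) :
    ∃ (ι : Type) (x : ι → E) (y : ι → F), Summable (fun i => ‖x i‖ * ‖y i‖) ∧
      ∑' i, ‖x i‖ * ‖y i‖ ≤ ‖z‖ + ε ∧ HasSum (fun i => ProjTensor.tmul (x i) (y i)) z := by
  let s : AddSubgroup (ProjTensor E F) :=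
    (LinearMap.range (UniformSpace.Completion.toComplₗᵢ (𝕜 := ℂ)
      (E := AlgProjTensor E F)).toLinearMap).toAddSubgroup
  have hz : z ∈ closure (s : Set (ProjTensor E F)) := by
    have := (UniformSpace.Completion.denseRange_coe (α := AlgProjTensor E F)) z
    exact this
  obtain ⟨v, hv, hvs, hv0, hvn⟩ := controlled_sum_of_mem_closure hz
    (b := fun n => ε / 4 * (1 / 2) ^ n) (fun n => by positivity)
  choose w hw using hvs
  choose l hl hlc using fun n => AlgProjTensor.exists_cost_lt (w n)
    (ε := ε / 4 * (1 / 2) ^ n) (by positivity)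
  have hvw : ∀ n, v n = ((AlgProjTensor.ofList (l n) : AlgProjTensor E F) : ProjTensor E F) :=
    fun n => by rw [hl]; exact (hw n).symm
  have hnw : ∀ n, ‖w n‖ = ‖v n‖ := fun n => by
    rw [hvw, hl]; exact (UniformSpace.Completion.norm_coe _).symm
  -- For n > 0 the norm of `v n` is below (ε/4)·2⁻ⁿ, for n = 0 it is below ‖z‖ + ε/4, and the chosen
  -- representation exceeds the norm by less than (ε/4)·2⁻ⁿ. Hence `c n` majorises the cost, and the
  -- extra terms sum to ε.
  let c : ℕ → ℝ := fun n => (if n = 0 then ‖z‖ else 0) + ε / 2 * (1 / 2) ^ n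
  have hc : HasSum c (‖z‖ + ε) := by
    have h1 := (hasSum_geometric_of_lt_one (r := (1 / 2 : ℝ)) (by norm_num)
      (by norm_num)).mul_left (ε / 2)
    have h2 := (hasSum_ite_eq (0 : ℕ) ‖z‖).add h1
    convert! h2 using 2
    norm_num
  have hcost : ∀ n, AlgProjTensor.cost (l n) ≤ c n := by
    intro n
    have h1 := hlc n
    rw [hnw] at h1
    rcases Nat.eq_zero_or_pos n with rfl | hn
    · have h2 := norm_sub_norm_le (v 0) z
      have h3 : ‖-v 0 + z‖ = ‖v 0 - z‖ := by rw [← norm_neg]; congr 1; abel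
      rw [h3] at hv0
      simp only [c, if_true, pow_zero, mul_one] at h1 hv0 ⊢
      linarith
    · have h2 := hvn n hn
      simp only [c, hn.ne', if_false]
      linarith
  have hinner : ∀ n, ∑' i : Fin (l n).length, ‖((l n)[i.1]).1‖ * ‖((l n)[i.1]).2‖ =
      AlgProjTensor.cost (l n) := fun n => by
    rw [tsum_fintype, Fin.sum_univ_fun_getElem (l n) fun p => ‖p.1‖ * ‖p.2‖]
    rfl
  have hsum : Summable fun i : Σ n, Fin (l n).length =>
      ‖((l i.1)[i.2.1]).1‖ * ‖((l i.1)[i.2.1]).2‖ := by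
    rw [summable_sigma_of_nonneg fun i => by positivity]
    refine ⟨fun n => (hasSum_fintype _).summable, ?_⟩
    simp only [hinner]
    exact hc.summable.of_nonneg_of_le (fun n => AlgProjTensor.cost_nonneg _) hcost
  refine ⟨Σ n, Fin (l n).length, fun i => ((l i.1)[i.2.1]).1, fun i => ((l i.1)[i.2.1]).2,
    hsum, ?_, ?_⟩
  · rw [hsum.tsum_sigma]
    simp only [hinner]
    rw [← hc.tsum_eq]
    exact (hc.summable.of_nonneg_of_le (fun n => AlgProjTensor.cost_nonneg _)
      hcost).tsum_le_tsum hcost hc.summable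
  · have hS : Summable fun i : Σ n, Fin (l n).length =>
        ProjTensor.tmul ((l i.1)[i.2.1]).1 ((l i.1)[i.2.1]).2 :=
      hsum.of_norm_bounded fun i => ProjTensor.norm_tmul_le _ _
    have h1 := hS.hasSum.sigma fun n => hasSum_fintype _
    simp only [← ProjTensor.coe_ofList, ← hvw] at h1
    have h2 := (h1.tendsto_sum_nat.comp (Filter.tendsto_add_atTop_nat 1))
    rw [tendsto_nhds_unique hv h2]
    exact hS.hasSum

theorem ProjTensor.exists_hasSum (z : ProjTensor E F) :
    ∃ (ι : Type) (x : ι → E) (y : ι → F), Summable (fun i => ‖x i‖ * ‖y i‖) ∧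
      ∑' i, ‖x i‖ * ‖y i‖ ≤ 2 * ‖z‖ ∧ HasSum (fun i => ProjTensor.tmul (x i) (y i)) z := by
  rcases eq_or_ne z 0 with rfl | hz
  · exact ⟨Empty, Empty.elim, Empty.elim, summable_empty, by simp, hasSum_empty⟩
  · obtain ⟨ι, x, y, h1, h2, h3⟩ := ProjTensor.exists_hasSum_of_pos z (norm_pos_iff.2 hz)
    exact ⟨ι, x, y, h1, by linarith, h3⟩

end ProjSeries

/-! ### Series of elementary tensors in B(E) ⊗̂ (E ⊗̂ E') -/

section TripleSeries

/-- Composition of two bounded bilinear maps to a trilinear one. -/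
def trilinearOfBilinear {X Y V W Z : Type*} [NormedAddCommGroup X] [NormedSpace ℂ X]
    [NormedAddCommGroup Y] [NormedSpace ℂ Y] [NormedAddCommGroup V] [NormedSpace ℂ V]
    [NormedAddCommGroup W] [NormedSpace ℂ W] [NormedAddCommGroup Z] [NormedSpace ℂ Z]
    (B : X →L[ℂ] W →L[ℂ] Z) (C : Y →L[ℂ] V →L[ℂ] W) : X →L[ℂ] Y →L[ℂ] V →L[ℂ] Z :=
  (ContinuousLinearMap.compL ℂ Y (V →L[ℂ] W) (V →L[ℂ] Z)).flip C ∘L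
    ContinuousLinearMap.compL ℂ V W Z ∘L B

theorem trilinearOfBilinear_apply {X Y V W Z : Type*} [NormedAddCommGroup X] [NormedSpace ℂ X]
    [NormedAddCommGroup Y] [NormedSpace ℂ Y] [NormedAddCommGroup V] [NormedSpace ℂ V]
    [NormedAddCommGroup W] [NormedSpace ℂ W] [NormedAddCommGroup Z] [NormedSpace ℂ Z]
    (B : X →L[ℂ] W →L[ℂ] Z) (C : Y →L[ℂ] V →L[ℂ] W) (x : X) (y : Y) (v : V) :
    trilinearOfBilinear B C x y v = B x (C y v) := rfl

theorem trilinear_map_smul {X Y V Z : Type*} [NormedAddCommGroup X] [NormedSpace ℂ X]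
    [NormedAddCommGroup Y] [NormedSpace ℂ Y] [NormedAddCommGroup V] [NormedSpace ℂ V]
    [NormedAddCommGroup Z] [NormedSpace ℂ Z] (B : X →L[ℂ] Y →L[ℂ] V →L[ℂ] Z) (a b c : ℂ)
    (x : X) (y : Y) (v : V) : B (a • x) (b • y) (c • v) = (a * b * c) • B x y v := by
  simp only [map_smul, smul_apply, smul_smul]
  congr 1
  ring

theorem summable_sigma_mul_of_le {ι : Type*} {κ : ι → Type*} {a c : ι → ℝ} {b : ∀ i, κ i → ℝ}
    (ha : ∀ i, 0 ≤ a i) (hb : ∀ i j, 0 ≤ b i j) (hs : ∀ i, Summable (b i))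
    (hle : ∀ i, ∑' j, b i j ≤ 2 * c i) (hac : Summable fun i => a i * c i) :
    Summable fun i : Σ i, κ i => a i.1 * b i.1 i.2 := by
  rw [summable_sigma_of_nonneg fun i => mul_nonneg (ha _) (hb _ _)]
  refine ⟨fun i => (hs i).mul_left (a i), ?_⟩
  refine (hac.mul_left 2).of_nonneg_of_le
    (fun i => tsum_nonneg fun j => mul_nonneg (ha _) (hb _ _)) fun i => ?_
  refine (tsum_mul_left (f := b i) (a := a i)).trans_le ?_
  nlinarith [hle i, ha i]

theorem hasSum_sigma_of_bilinear {X Y V W Z : Type*} [NormedAddCommGroup X] [NormedSpace ℂ X]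
    [NormedAddCommGroup Y] [NormedSpace ℂ Y] [NormedAddCommGroup V] [NormedSpace ℂ V]
    [NormedAddCommGroup W] [NormedSpace ℂ W] [NormedAddCommGroup Z] [NormedSpace ℂ Z]
    [CompleteSpace Z] (B : X →L[ℂ] W →L[ℂ] Z) (C : Y →L[ℂ] V →L[ℂ] W)
    (hBC : ∀ x y v, ‖B x (C y v)‖ ≤ ‖x‖ * (‖y‖ * ‖v‖)) {ι : Type*} {κ : ι → Type*} {T : ι → X}
    {w : ι → W} {x : ∀ i, κ i → Y} {μ : ∀ i, κ i → V} {z : Z}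
    (hsum : Summable fun i : Σ i, κ i => ‖T i.1‖ * (‖x i.1 i.2‖ * ‖μ i.1 i.2‖))
    (hz : HasSum (fun i => B (T i) (w i)) z)
    (hw : ∀ i, HasSum (fun j => C (x i j) (μ i j)) (w i)) :
    HasSum (fun i : Σ i, κ i => B (T i.1) (C (x i.1 i.2) (μ i.1 i.2))) z := by
  have hS : Summable fun i : Σ i, κ i => B (T i.1) (C (x i.1 i.2) (μ i.1 i.2)) :=
    hsum.of_norm_bounded fun i => hBC _ _ _
  have h3 := hS.hasSum.sigma fun i => (hw i).mapL (B (T i))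
  rw [hz.unique h3]
  exact hS.hasSum

variable {E : Type*} [NormedAddCommGroup E] [NormedSpace ℂ E]

/-- The trilinear map `(T, x, μ) ↦ T ⊗ x ⊗ μ`. -/
def tripleL : (E →L[ℂ] E) →L[ℂ] E →L[ℂ] StrongDual ℂ E →L[ℂ] TripleTensor E :=
  trilinearOfBilinear ProjTensor.tmulL ProjTensor.tmulL

theorem tripleL_apply (T : E →L[ℂ] E) (x : E) (μ : StrongDual ℂ E) :
    tripleL T x μ = triple T x μ := by
  rw [triple, ← ProjTensor.tmulL_apply, ← ProjTensor.tmulL_apply]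
  exact trilinearOfBilinear_apply _ _ _ _ _

theorem triple_smul (a b c : ℂ) (T : E →L[ℂ] E) (x : E) (μ : StrongDual ℂ E) :
    triple (a • T) (b • x) (c • μ) = (a * b * c) • triple T x μ := by
  rw [← tripleL_apply, ← tripleL_apply]
  exact trilinear_map_smul _ _ _ _ _ _ _

theorem norm_triple_le (T : E →L[ℂ] E) (x : E) (μ : StrongDual ℂ E) :
    ‖triple T x μ‖ ≤ ‖T‖ * (‖x‖ * ‖μ‖) :=
  (ProjTensor.norm_tmul_le _ _).trans
    (mul_le_mul_of_nonneg_left (ProjTensor.norm_tmul_le _ _) (norm_nonneg _))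

theorem triple_eq_tmulL (T : E →L[ℂ] E) (x : E) (μ : StrongDual ℂ E) :
    triple T x μ = ProjTensor.tmulL T (ProjTensor.tmulL x μ) := by
  rw [triple, ← ProjTensor.tmulL_apply, ← ProjTensor.tmulL_apply]

theorem ProjTensor.exists_hasSum_tmulL {X Y V : Type*} [NormedAddCommGroup X] [NormedSpace ℂ X]
    [NormedAddCommGroup Y] [NormedSpace ℂ Y] [NormedAddCommGroup V] [NormedSpace ℂ V]
    (z : ProjTensor X (ProjTensor Y V)) :
    ∃ (ι : Type) (T : ι → X) (x : ι → Y) (μ : ι → V),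
      Summable (fun i => ‖T i‖ * (‖x i‖ * ‖μ i‖)) ∧
      HasSum (fun i => ProjTensor.tmulL (T i) (ProjTensor.tmulL (x i) (μ i))) z := by
  obtain ⟨ι, T, w, h1, -, h2⟩ := ProjTensor.exists_hasSum z
  choose κ x μ k1 k2 k3 using fun i => ProjTensor.exists_hasSum (w i)
  have hsum : Summable fun i : Σ i, κ i => ‖T i.1‖ * (‖x i.1 i.2‖ * ‖μ i.1 i.2‖) :=
    summable_sigma_mul_of_le (b := fun i j => ‖x i j‖ * ‖μ i j‖) (fun i => norm_nonneg (T i))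
      (fun i j => mul_nonneg (norm_nonneg _) (norm_nonneg _)) k1 k2 h1
  have h2' : HasSum (fun i => ProjTensor.tmulL (T i) (w i)) z := by
    simpa only [ProjTensor.tmulL_apply] using h2
  have k3' : ∀ i, HasSum (fun j => ProjTensor.tmulL (x i j) (μ i j)) (w i) := fun i => by
    simpa only [ProjTensor.tmulL_apply] using k3 i
  have hB : ∀ (T : X) (x : Y) (μ : V), ‖ProjTensor.tmulL T (ProjTensor.tmulL x μ)‖ ≤
      ‖T‖ * (‖x‖ * ‖μ‖) := fun T x μ => by
    rw [ProjTensor.tmulL_apply, ProjTensor.tmulL_apply]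
    exact (ProjTensor.norm_tmul_le _ _).trans
      (mul_le_mul_of_nonneg_left (ProjTensor.norm_tmul_le _ _) (norm_nonneg _))
  exact ⟨Σ i, κ i, fun i => T i.1, fun i => x i.1 i.2, fun i => μ i.1 i.2, hsum,
    hasSum_sigma_of_bilinear _ _ hB hsum h2' k3'⟩

theorem exists_hasSum_triple (z : TripleTensor E) :
    ∃ (ι : Type) (T : ι → E →L[ℂ] E) (x : ι → E) (μ : ι → StrongDual ℂ E),
      Summable (fun i => ‖T i‖ * (‖x i‖ * ‖μ i‖)) ∧ HasSum (fun i => triple (T i) (x i) (μ i)) z := by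
  simp only [triple_eq_tmulL]
  exact ProjTensor.exists_hasSum_tmulL z

/-- A closed subspace containing all elementary tensors is everything. -/
theorem mem_of_triple_mem {S : Submodule ℂ (TripleTensor E)} (hS : IsClosed (S : Set (TripleTensor E)))
    (h : ∀ T x μ, triple T x μ ∈ S) (z : TripleTensor E) : z ∈ S := by
  obtain ⟨ι, T, x, μ, -, hz⟩ := exists_hasSum_triple z
  exact hS.mem_of_tendsto hz (Filter.Eventually.of_forall fun s =>
    Submodule.sum_mem _ fun i _ => h _ _ _)

theorem tripleTensor_ext {Y : Type*} [NormedAddCommGroup Y] [NormedSpace ℂ Y]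
    {f g : TripleTensor E →L[ℂ] Y} (h : ∀ T x μ, f (triple T x μ) = g (triple T x μ)) : f = g := by
  ext1 z
  have h1 := mem_of_triple_mem (f - g).isClosed_ker
    (fun T x μ => by rw [LinearMap.mem_ker]; exact sub_eq_zero.2 (h T x μ)) z
  rw [LinearMap.mem_ker] at h1
  exact sub_eq_zero.1 h1

/-- Scalars move freely between the three factors: the operator receives norm `e`, and what remains
is shared equally by the vector and the functional. If a factor is zero, the tensor is zero and
zeros serve. -/
theorem exists_rescale_triple (T : E →L[ℂ] E) (x : E) (μ : StrongDual ℂ E) {e : ℝ} (he : 0 < e) :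
    ∃ T' x' μ', triple T' x' μ' = triple T x μ ∧ ‖T'‖ ≤ e ∧
      ‖x'‖ ^ 2 ≤ ‖T‖ * (‖x‖ * ‖μ‖) / e ∧ ‖μ'‖ ^ 2 ≤ ‖T‖ * (‖x‖ * ‖μ‖) / e := by
  set c := ‖T‖ * (‖x‖ * ‖μ‖) with hc
  have hc0 : 0 ≤ c := by positivity
  rcases hc0.eq_or_lt with h0 | hpos
  · refine ⟨0, 0, 0, ?_, by simpa using he.le, by simp [← h0], by simp [← h0]⟩
    have h1 : triple T x μ = 0 := norm_le_zero_iff.1 ((norm_triple_le T x μ).trans_eq h0.symm)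
    have h2 := triple_smul 0 0 0 T x μ
    simp only [zero_smul, mul_zero] at h2
    rw [h1, h2]
  · have hT : ‖T‖ ≠ 0 := fun h => by simp [hc, h] at hpos
    have hx : ‖x‖ ≠ 0 := fun h => by simp [hc, h] at hpos
    have hμ : ‖μ‖ ≠ 0 := fun h => by simp [hc, h] at hpos
    have hd : 0 ≤ c / e := by positivity
    refine ⟨((e / ‖T‖ : ℝ) : ℂ) • T, ((√(c / e) / ‖x‖ : ℝ) : ℂ) • x,
      ((√(c / e) / ‖μ‖ : ℝ) : ℂ) • μ, ?_, ?_, ?_, ?_⟩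
    · have h2 : e / ‖T‖ * (√(c / e) / ‖x‖) * (√(c / e) / ‖μ‖) = 1 := by
        have h3 : √(c / e) * √(c / e) = c / e := Real.mul_self_sqrt hd
        have h4 : e / ‖T‖ * (√(c / e) / ‖x‖) * (√(c / e) / ‖μ‖) =
          √(c / e) * √(c / e) * e / (‖T‖ * (‖x‖ * ‖μ‖)) := by ring
        rw [h4, h3, div_mul_cancel₀ _ he.ne', ← hc, div_self hpos.ne']
      rw [triple_smul, ← Complex.ofReal_mul, ← Complex.ofReal_mul, h2, Complex.ofReal_one,
        one_smul]
    · rw [norm_smul, Complex.norm_real, Real.norm_of_nonneg (by positivity),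
        div_mul_cancel₀ _ hT]
    · rw [norm_smul, Complex.norm_real, Real.norm_of_nonneg (by positivity),
        div_mul_cancel₀ _ hx, Real.sq_sqrt hd]
    · rw [norm_smul, Complex.norm_real, Real.norm_of_nonneg (by positivity),
        div_mul_cancel₀ _ hμ, Real.sq_sqrt hd]

/-- A series representation of `z` in which the operators are small off a finite set, while the
vectors and the functionals are square summable with a uniform bound. -/
theorem exists_hasSum_triple_small (z : TripleTensor E) :
    ∃ C : ℝ, ∀ ε : ℝ, 0 < ε → ∃ (ι : Type) (s : Finset ι) (T : ι → E →L[ℂ] E) (x : ι → E)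
      (μ : ι → StrongDual ℂ E), HasSum (fun i => triple (T i) (x i) (μ i)) z ∧
        (∀ i ∉ s, ‖T i‖ ≤ ε) ∧ (∀ t : Finset ι, ∑ i ∈ t, ‖x i‖ ^ 2 ≤ C) ∧
        (∀ t : Finset ι, ∑ i ∈ t, ‖μ i‖ ^ 2 ≤ C) := by
  classical
  obtain ⟨ι, T, x, μ, hsum, hz⟩ := exists_hasSum_triple z
  set c : ι → ℝ := fun i => ‖T i‖ * (‖x i‖ * ‖μ i‖) with hc
  have hc0 : ∀ i, 0 ≤ c i := fun i => by positivity
  refine ⟨∑' i, c i + 1, fun ε hε => ?_⟩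
  obtain ⟨s, hs⟩ := summable_iff_vanishing_norm.1 hsum ε hε
  -- Off `s` the costs add up to less than ε, so dividing them by ε contributes at most 1. On `s`
  -- nothing is divided. The resulting bound Σ c + 1 is independent of ε.
  let e : ι → ℝ := fun i => if i ∈ s then 1 else ε
  have he : ∀ i, 0 < e i := fun i => by
    simp only [e]; split_ifs
    · exact one_pos
    · exact hε
  choose T' x' μ' h1 h2 h3 h4 using fun i => exists_rescale_triple (T i) (x i) (μ i) (he i)
  have hbound : ∀ t : Finset ι, ∑ i ∈ t, c i / e i ≤ ∑' i, c i + 1 := by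
    intro t
    rw [← Finset.sum_inter_add_sum_sdiff t s]
    refine add_le_add ?_ ?_
    · have h5 : ∑ i ∈ t ∩ s, c i / e i = ∑ i ∈ t ∩ s, c i :=
        Finset.sum_congr rfl fun i hi => by
          simp [e, (Finset.mem_inter.1 hi).2]
      rw [h5]
      exact hsum.sum_le_tsum _ fun i _ => hc0 i
    · have h5 : ∑ i ∈ t \ s, c i / e i = (∑ i ∈ t \ s, c i) / ε := by
        rw [Finset.sum_div]
        exact Finset.sum_congr rfl fun i hi => by
          simp [e, (Finset.mem_sdiff.1 hi).2]
      rw [h5, div_le_one hε]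
      exact (le_abs_self _).trans (hs (t \ s) Finset.sdiff_disjoint).le
  refine ⟨ι, s, T', x', μ', ?_, fun i hi => ?_, fun t => ?_, fun t => ?_⟩
  · simpa only [h1] using hz
  · have := h2 i
    simpa only [e, if_neg hi] using this
  · exact (Finset.sum_le_sum fun i _ => h3 i).trans (hbound t)
  · exact (Finset.sum_le_sum fun i _ => h4 i).trans (hbound t)

end TripleSeries

/-! ### The dual of a quotient and bimodule maps -/

section QuotientDual

variable {Z V : Type*} [NormedAddCommGroup Z] [NormedSpace ℂ Z]
  [NormedAddCommGroup V] [NormedSpace ℂ V]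

theorem Submodule.norm_liftQL_le (S : Submodule ℂ Z) (f : StrongDual ℂ Z) (h : S ≤ f.ker) :
    ‖S.liftQL f h‖ ≤ ‖f‖ := by
  refine ContinuousLinearMap.opNorm_le_bound _ (norm_nonneg f) fun z => ?_
  refine le_of_forall_pos_le_add fun ε hε => ?_
  have hd : 0 < ε / (‖f‖ + 1) := by positivity
  obtain ⟨m, rfl, hm⟩ := Submodule.Quotient.norm_mk_lt z hd
  have h1 : S.liftQL f h (Submodule.Quotient.mk m) = f m := by simp
  rw [h1]
  have h2 : ‖f‖ * (ε / (‖f‖ + 1)) ≤ ε := by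
    rw [mul_div_left_comm]
    exact mul_le_of_le_one_right hε.le
      ((div_le_one (by positivity)).2 (by linarith))
  calc ‖f m‖ ≤ ‖f‖ * ‖m‖ := f.le_opNorm m
    _ ≤ ‖f‖ * (‖(Submodule.Quotient.mk m : Z ⧸ S)‖ + ε / (‖f‖ + 1)) :=
      mul_le_mul_of_nonneg_left hm.le (norm_nonneg f)
    _ ≤ _ := by rw [mul_add]; linarith

/-- An isometric identification of functionals on `Z` vanishing on `S` with a space `B` gives an
isometric identification of `B` with the dual of `Z ⧸ S`. -/
theorem exists_linearIsometryEquiv_quotient_dual (S : Submodule ℂ Z) (B : Submodule ℂ V)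
    (t : V →L[ℂ] StrongDual ℂ Z) (ht : ∀ v, ‖t v‖ = ‖v‖) (hker : ∀ v ∈ B, S ≤ (t v).ker)
    (hsurj : ∀ G : StrongDual ℂ Z, S ≤ G.ker → ∃ v ∈ B, t v = G) :
    ∃ Λ : B ≃ₗᵢ[ℂ] StrongDual ℂ (Z ⧸ S), ∀ (v : B) z, Λ v (S.mkQL z) = t v z := by
  have hmk : ∀ f (h : S ≤ (f : StrongDual ℂ Z).ker) z, S.liftQL f h (S.mkQL z) = f z := by simp
  have hext : ∀ F G : StrongDual ℂ (Z ⧸ S), (∀ z, F (S.mkQL z) = G (S.mkQL z)) → F = G := by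
    intro F G h
    ext z
    obtain ⟨m, rfl⟩ := S.mkQ_surjective z
    exact h m
  let L : B →ₗ[ℂ] StrongDual ℂ (Z ⧸ S) :=
    { toFun := fun v => S.liftQL (t v) (hker v v.2)
      map_add' := fun v w => hext _ _ fun z => by
        rw [add_apply, hmk, hmk, hmk, Submodule.coe_add, map_add, add_apply]
      map_smul' := fun c v => hext _ _ fun z => by
        rw [smul_apply, hmk, hmk, Submodule.coe_smul, map_smul, smul_apply]
        rfl }
  have hL : ∀ (v : B) z, L v (S.mkQL z) = t v z := fun v z => hmk _ _ _
  have hn : ∀ v, ‖L v‖ = ‖v‖ := by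
    intro v
    refine le_antisymm ((Submodule.norm_liftQL_le S _ _).trans_eq (ht v)) ?_
    rw [Submodule.coe_norm, ← ht v]
    refine ContinuousLinearMap.opNorm_le_bound _ (norm_nonneg _) fun z => ?_
    rw [← hL v z]
    refine ((L v).le_opNorm _).trans (mul_le_mul_of_nonneg_left ?_ (norm_nonneg _))
    exact Submodule.Quotient.norm_mk_le S z
  refine ⟨LinearIsometryEquiv.ofSurjective ⟨L, hn⟩ fun G => ?_, hL⟩
  obtain ⟨v, hv, hG⟩ := hsurj (G ∘L S.mkQL) fun z hz => by
    have : S.mkQL z = 0 := by simpa using hz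
    exact LinearMap.mem_ker.2 ((congrArg G this).trans (map_zero G))
  refine ⟨⟨v, hv⟩, hext _ _ fun z => ?_⟩
  refine (hL _ z).trans ?_
  rw [hG]
  rfl

end QuotientDual

/-! ### Bimodule maps as functionals on the triple tensor product -/

section BimoduleMaps

variable {E : Type*} [NormedAddCommGroup E] [NormedSpace ℂ E]

theorem ProjTensor.norm_lift_le {X Y G : Type*} [NormedAddCommGroup X] [NormedSpace ℂ X]
    [NormedAddCommGroup Y] [NormedSpace ℂ Y] [NormedAddCommGroup G] [NormedSpace ℂ G]
    [CompleteSpace G] (B : X →L[ℂ] Y →L[ℂ] G) : ‖ProjTensor.lift B‖ ≤ ‖B‖ := by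
  have h : ‖(ProjTensor.lift : (X →L[ℂ] Y →L[ℂ] G) →L[ℂ] _)‖ ≤ 1 :=
    LinearMap.mkContinuous_norm_le _ zero_le_one _
  exact (ContinuousLinearMap.le_of_opNorm_le _ h B).trans_eq (one_mul _)

/-- The bilinear form on `X × (Y ⊗̂ Y')` induced by `D : X → B(Y, Y'')`, as a functional. -/
def bidualFunctional (X Y : Type*) [NormedAddCommGroup X] [NormedSpace ℂ X]
    [NormedAddCommGroup Y] [NormedSpace ℂ Y] :
    (X →L[ℂ] Y →L[ℂ] StrongDual ℂ (StrongDual ℂ Y)) →L[ℂ]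
      StrongDual ℂ (ProjTensor X (ProjTensor Y (StrongDual ℂ Y))) :=
  ProjTensor.lift ∘L ContinuousLinearMap.compL ℂ X _ _ ProjTensor.lift

theorem bidualFunctional_apply {X Y : Type*} [NormedAddCommGroup X] [NormedSpace ℂ X]
    [NormedAddCommGroup Y] [NormedSpace ℂ Y]
    (D : X →L[ℂ] Y →L[ℂ] StrongDual ℂ (StrongDual ℂ Y)) (x : X) (y : Y) (μ : StrongDual ℂ Y) :
    bidualFunctional X Y D (ProjTensor.tmul x (ProjTensor.tmul y μ)) = D x y μ := by
  have h : bidualFunctional X Y D = ProjTensor.lift (ProjTensor.lift ∘L D) := rfl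
  rw [h, ProjTensor.lift_tmul, ContinuousLinearMap.comp_apply, ProjTensor.lift_tmul]

theorem norm_bidualFunctional_le {X Y : Type*} [NormedAddCommGroup X] [NormedSpace ℂ X]
    [NormedAddCommGroup Y] [NormedSpace ℂ Y]
    (D : X →L[ℂ] Y →L[ℂ] StrongDual ℂ (StrongDual ℂ Y)) :
    ‖bidualFunctional X Y D‖ ≤ ‖D‖ := by
  have h : bidualFunctional X Y D = ProjTensor.lift (ProjTensor.lift ∘L D) := rfl
  rw [h]
  refine (ProjTensor.norm_lift_le _).trans ?_
  refine ContinuousLinearMap.opNorm_le_bound _ (norm_nonneg D) fun x => ?_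
  exact (ProjTensor.norm_lift_le _).trans (D.le_opNorm x)

/-- The functional on `B(E) ⊗̂ (E ⊗̂ E')` induced by a bounded map on `B(E)`. -/
def tripleFunctional : ((E →L[ℂ] E) →L[ℂ] (E →L[ℂ] E)) →L[ℂ] StrongDual ℂ (TripleTensor E) :=
  bidualFunctional (E →L[ℂ] E) E ∘L ContinuousLinearMap.compL ℂ (E →L[ℂ] E) (E →L[ℂ] E) _
    (ContinuousLinearMap.compL ℂ E E _ (NormedSpace.inclusionInDoubleDual ℂ E))

theorem tripleFunctional_triple (S : (E →L[ℂ] E) →L[ℂ] (E →L[ℂ] E)) (T : E →L[ℂ] E) (x : E)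
    (μ : StrongDual ℂ E) : tripleFunctional S (triple T x μ) = μ (S T x) :=
  bidualFunctional_apply _ _ _ _

theorem norm_tripleFunctional (S : (E →L[ℂ] E) →L[ℂ] (E →L[ℂ] E)) :
    ‖tripleFunctional S‖ = ‖S‖ := by
  refine le_antisymm ((norm_bidualFunctional_le _).trans ?_) ?_
  · refine ContinuousLinearMap.opNorm_le_bound _ (norm_nonneg S) fun T => ?_
    refine le_trans ?_ (S.le_opNorm T)
    refine ContinuousLinearMap.opNorm_le_bound _ (norm_nonneg _) fun x => ?_
    exact (NormedSpace.double_dual_bound ℂ E _).trans ((S T).le_opNorm x)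
  · refine ContinuousLinearMap.opNorm_le_bound _ (norm_nonneg _) fun T => ?_
    refine ContinuousLinearMap.opNorm_le_bound _ (by positivity) fun x => ?_
    refine NormedSpace.norm_le_dual_bound ℂ _ (by positivity) fun μ => ?_
    rw [← tripleFunctional_triple]
    refine ((tripleFunctional S).le_opNorm _).trans ?_
    rw [mul_assoc, mul_assoc]
    exact mul_le_mul_of_nonneg_left (norm_triple_le T x μ) (norm_nonneg _)

theorem relSpace_le_iff (C : Set (E →L[ℂ] E)) (G : StrongDual ℂ (TripleTensor E)) :
    relSpace C ≤ G.ker ↔ ∀ c ∈ C, ∀ T x μ,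
      G (triple (c ∘L T) x μ) = G (triple T x (μ ∘L c)) ∧
      G (triple (T ∘L c) x μ) = G (triple T (c x) μ) := by
  constructor
  · intro h c hc T x μ
    constructor
    · have h1 : triple (c ∘L T) x μ - triple T x (μ ∘L c) ∈ relSpace C :=
        Submodule.le_topologicalClosure _ (Submodule.subset_span (Or.inl ⟨c, hc, T, x, μ, rfl⟩))
      have h2 := LinearMap.mem_ker.1 (h h1)
      exact sub_eq_zero.1 ((map_sub G _ _).symm.trans h2)
    · have h1 : triple (T ∘L c) x μ - triple T (c x) μ ∈ relSpace C :=
        Submodule.le_topologicalClosure _ (Submodule.subset_span (Or.inr ⟨c, hc, T, x, μ, rfl⟩))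
      have h2 := LinearMap.mem_ker.1 (h h1)
      exact sub_eq_zero.1 ((map_sub G _ _).symm.trans h2)
  · intro h
    refine Submodule.topologicalClosure_minimal _ ?_ G.isClosed_ker
    rw [Submodule.span_le]
    rintro z (⟨c, hc, T, x, μ, rfl⟩ | ⟨c, hc, T, x, μ, rfl⟩)
    · exact LinearMap.mem_ker.2 ((map_sub G _ _).trans (sub_eq_zero.2 (h c hc T x μ).1))
    · exact LinearMap.mem_ker.2 ((map_sub G _ _).trans (sub_eq_zero.2 (h c hc T x μ).2))

/-- For fixed `T` and `x` what remains is a functional of `μ`, an element of the bidual of `E`.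
Reflexivity makes it a vector, which is taken as `S T x`. -/
theorem exists_eq_of_trilinear [CompleteSpace E] (hE : IsReflexiveSpace E)
    {X : Type*} [NormedAddCommGroup X] [NormedSpace ℂ X]
    {Z : Type*} [NormedAddCommGroup Z] [NormedSpace ℂ Z]
    (B : X →L[ℂ] E →L[ℂ] StrongDual ℂ E →L[ℂ] Z) (G : StrongDual ℂ Z) :
    ∃ S : X →L[ℂ] (E →L[ℂ] E), ∀ T x μ, μ (S T x) = G (B T x μ) := by
  let D : X →L[ℂ] E →L[ℂ] StrongDual ℂ (StrongDual ℂ E) :=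
    (ContinuousLinearMap.compL ℂ E _ _ (ContinuousLinearMap.compL ℂ (StrongDual ℂ E) _ _ G)) ∘L B
  let J : E ≃L[ℂ] StrongDual ℂ (StrongDual ℂ E) :=
    ContinuousLinearEquiv.ofBijective (NormedSpace.inclusionInDoubleDual ℂ E)
      (LinearMap.ker_eq_bot.2 (NormedSpace.inclusionInDoubleDualLi ℂ).injective)
      (LinearMap.range_eq_top.2 hE)
  refine ⟨ContinuousLinearMap.compL ℂ E _ _ (J.symm : _ →L[ℂ] E) ∘L D, fun T x μ => ?_⟩
  have h : J (J.symm (D T x)) = D T x := J.apply_symm_apply _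
  exact DFunLike.congr_fun h μ

/-- For reflexive `E`, the space of `C`-bimodule maps on `B(E)` is the dual of the quotient by
the relations. -/
theorem exists_bimoduleMaps_equiv [CompleteSpace E] (hE : IsReflexiveSpace E)
    (C : Set (E →L[ℂ] E)) :
    ∃ Λ : bimoduleMaps C ≃ₗᵢ[ℂ] StrongDual ℂ (TripleTensor E ⧸ relSpace C),
      ∀ (S : bimoduleMaps C) (T : E →L[ℂ] E) (x : E) (μ : StrongDual ℂ E),
        Λ S ((relSpace C).mkQL (triple T x μ)) =
          μ ((S : (E →L[ℂ] E) →L[ℂ] (E →L[ℂ] E)) T x) := by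
  have hext : ∀ y z : E, (∀ μ : StrongDual ℂ E, μ y = μ z) → y = z := fun y z h =>
    (NormedSpace.inclusionInDoubleDualLi ℂ).injective (ContinuousLinearMap.ext h)
  obtain ⟨Λ, hΛ⟩ := exists_linearIsometryEquiv_quotient_dual (relSpace C) (bimoduleMaps C)
    tripleFunctional norm_tripleFunctional
    (fun S hS => (relSpace_le_iff C _).2 fun c hc T x μ => by
      simp only [tripleFunctional_triple, (hS c hc T).1, (hS c hc T).2]
      exact ⟨rfl, rfl⟩)
    (fun G hG => by
      obtain ⟨S, hS⟩ := exists_eq_of_trilinear hE tripleL G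
      have hS' : ∀ T x μ, μ (S T x) = G (triple T x μ) := fun T x μ => by
        rw [hS, tripleL_apply]
      have hG' := (relSpace_le_iff C G).1 hG
      refine ⟨S, fun c hc T => ⟨?_, ?_⟩, tripleTensor_ext fun T x μ => ?_⟩
      · ext x
        refine hext _ _ fun μ => ?_
        rw [hS', (hG' c hc T x μ).1, ← hS']
        rfl
      · ext x
        refine hext _ _ fun μ => ?_
        rw [hS', (hG' c hc T x μ).2, ← hS']
        rfl
      · rw [tripleFunctional_triple, hS'])
  exact ⟨Λ, fun S T x μ => (hΛ S _).trans (tripleFunctional_triple _ _ _ _)⟩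

end BimoduleMaps

/-! ### Seminorms of the form `a ↦ ‖θ(a)‖` -/

section NormComp

variable {A P Y : Type*} [NormedAddCommGroup A] [NormedSpace ℂ A] [NormedAddCommGroup P]
  [NormedSpace ℂ P] [NormedAddCommGroup Y] [NormedSpace ℂ Y] [CompleteSpace Y]
  {Φ : A ≃ₗᵢ[ℂ] StrongDual ℂ P}

/-- The seminorm `a ↦ ‖θ(a)‖`. -/
def normComp (θ : A →L[ℂ] Y) : Seminorm ℂ A := (normSeminorm ℂ Y).comp θ.toLinearMap

@[simp]
theorem normComp_apply (θ : A →L[ℂ] Y) (a : A) : normComp θ a = ‖θ a‖ := rfl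

/-- The functional factors through the completion, which sits isometrically in `Y`, and Hahn–Banach
extends it. -/
theorem exists_dual_comp_eq_of_le_normComp (θ : A →L[ℂ] Y) (f : StrongDual ℂ A) {C : ℝ}
    (h : ∀ a, ‖f a‖ ≤ C * normComp θ a) : ∃ G : StrongDual ℂ Y, G ∘L θ = f := by
  obtain ⟨J, hJ⟩ := exists_lift_isometry (p := normComp θ) (f := θ.toLinearMap) fun a => rfl
  obtain ⟨G, hG⟩ := exists_extension_of_isometry J (SeminormCompletion.lift _ f.toLinearMap)
  refine ⟨G, ?_⟩
  ext a
  have h1 := DFunLike.congr_fun hG (toSeminormCompletion _ a)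
  rw [SeminormCompletion.lift_apply h] at h1
  exact (congrArg G (hJ a)).symm.trans h1

theorem isNormalSeminorm_normComp {θ : A →L[ℂ] Y}
    (h : ∀ G : StrongDual ℂ Y, G ∘L θ ∈ normalFunctionals Φ) :
    IsNormalSeminorm Φ (normComp θ) := by
  intro f C hf
  obtain ⟨G, rfl⟩ := exists_dual_comp_eq_of_le_normComp θ f hf
  exact h G

theorem isReflexiveSpace_normComp (hY : IsReflexiveSpace Y) (θ : A →L[ℂ] Y) :
    IsReflexiveSpace (SeminormCompletion (normComp θ)) := by
  obtain ⟨J, -⟩ := exists_lift_isometry (p := normComp θ) (f := θ.toLinearMap) fun a => rfl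
  exact hY.of_isometry J

end NormComp

/-! ### Interpolated module seminorms -/

section Interp

variable {A : Type u} {P : Type v} [NormedRing A] [NormedAlgebra ℂ A] [NormedAddCommGroup P]
  [NormedSpace ℂ P] [CompleteSpace P] {Φ : A ≃ₗᵢ[ℂ] StrongDual ℂ P} {s : Seminorm ℂ A}

theorem IsNormalSeminorm.isAdmissible_interp (hs : IsNormalSeminorm Φ s)
    (hs1 : ∀ a, s a ≤ ‖a‖) : IsAdmissible Φ (interpSeminorm s) where
  bound := ⟨1, fun a => by rw [one_mul]; exact interpSeminorm_le_norm a⟩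
  reflexive := isReflexiveSpace_interpSeminorm hs hs1
  normal := hs.interp

/-- The interpolated seminorm of a normal left-module seminorm. -/
def LeftSeminorm.interp (hs : IsNormalSeminorm Φ s) (hs1 : ∀ a, s a ≤ ‖a‖)
    (h : ∀ a b, s (a * b) ≤ ‖a‖ * s b) : LeftSeminorm Φ :=
  ⟨interpSeminorm s, hs.isAdmissible_interp hs1, fun a b =>
    interpSeminorm_map_le (L := LinearMap.mulLeft ℂ a) (norm_nonneg a) (fun x => h a x)
      (fun x => norm_mul_le a x) b⟩

/-- The interpolated seminorm of a normal right-module seminorm. -/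
def RightSeminorm.interp (hs : IsNormalSeminorm Φ s) (hs1 : ∀ a, s a ≤ ‖a‖)
    (h : ∀ a b, s (a * b) ≤ ‖b‖ * s a) : RightSeminorm Φ :=
  ⟨interpSeminorm s, hs.isAdmissible_interp hs1, fun a b =>
    interpSeminorm_map_le (L := LinearMap.mulRight ℂ b) (norm_nonneg b) (fun x => h x b)
      (fun x => (norm_mul_le x b).trans_eq (mul_comm _ _)) a⟩

end Interp

/-! ### The universal representation -/

section Universal

variable {A : Type u} {P : Type v} [NormedRing A] [NormedAlgebra ℂ A] [NormedAddCommGroup P]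
  [NormedSpace ℂ P] [CompleteSpace P] {Φ : A ≃ₗᵢ[ℂ] StrongDual ℂ P}

/-- `R` contains every cyclic and every cocyclic representation as a contractively complemented
submodule. -/
structure NormalRep.IsUniversal (R : NormalRep Φ) : Prop where
  left : ∀ p : LeftSeminorm Φ, ∃ (i : SeminormCompletion p.1 →L[ℂ] R.carrier)
    (r : R.carrier →L[ℂ] SeminormCompletion p.1), (∀ x, r (i x) = x) ∧ (∀ x, ‖i x‖ ≤ ‖x‖) ∧
      (∀ x, ‖r x‖ ≤ ‖x‖) ∧ (∀ a x, i (leftHom p a x) = R.rep a (i x)) ∧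
      (∀ a x, r (R.rep a x) = leftHom p a (r x))
  right : ∀ q : RightSeminorm Φ, ∃ (i : StrongDual ℂ (SeminormCompletion q.1) →L[ℂ] R.carrier)
    (r : R.carrier →L[ℂ] StrongDual ℂ (SeminormCompletion q.1)), (∀ x, r (i x) = x) ∧
      (∀ x, ‖i x‖ ≤ ‖x‖) ∧ (∀ x, ‖r x‖ ≤ ‖x‖) ∧ (∀ a x, i (rightHom q a x) = R.rep a (i x)) ∧
      (∀ a x, r (R.rep a x) = rightHom q a (r x))

/-- The seminorms on `A` form a type in the universe of `A`, so all admissible ones can be summed at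
once. -/
theorem exists_isUniversal (hΦ : IsDualBanachAlgebra Φ) : ∃ R : NormalRep Φ, R.IsUniversal := by
  refine ⟨NormalRep.directSum (ι := LeftSeminorm Φ ⊕ RightSeminorm Φ)
    (Sum.elim (leftRep hΦ) (rightRep hΦ)), ⟨fun p => ?_, fun q => ?_⟩⟩
  · exact NormalRep.exists_inclusion_projection (ι := LeftSeminorm Φ ⊕ RightSeminorm Φ)
      (Sum.elim (leftRep hΦ) (rightRep hΦ)) (Sum.inl p)
  · exact NormalRep.exists_inclusion_projection (ι := LeftSeminorm Φ ⊕ RightSeminorm Φ)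
      (Sum.elim (leftRep hΦ) (rightRep hΦ)) (Sum.inr q)

/-- The map `b ↦ (a ↦ g(ab))`. -/
def rightTranslates (g : StrongDual ℂ A) : A →L[ℂ] StrongDual ℂ A :=
  ContinuousLinearMap.compL ℂ A A ℂ g ∘L (ContinuousLinearMap.mul ℂ A).flip

@[simp]
theorem rightTranslates_apply (g : StrongDual ℂ A) (a b : A) : rightTranslates g b a = g (a * b) := rfl

/-- All translates of `g` lie in the predual, so a functional `G` on `A'` acts on them as an element
`m` of `A = P'`. Composed with the translates it is `b ↦ g (m * b)`, which is normal. -/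
theorem isNormalSeminorm_rightTranslates (hΦ : IsDualBanachAlgebra Φ) {g : StrongDual ℂ A}
    (hg : g ∈ normalFunctionals Φ) : IsNormalSeminorm Φ (normComp (rightTranslates g)) := by
  refine isNormalSeminorm_normComp fun G => ?_
  obtain ⟨m, hm⟩ := Φ.surjective (G ∘L (predualEmbedding Φ).toContinuousLinearMap)
  have h : G ∘L rightTranslates g = g ∘L ContinuousLinearMap.mul ℂ A m := by
    ext b
    obtain ⟨φ, hφ⟩ := normalFunctionals_comp_mul_right hΦ hg b
    have h1 : rightTranslates g b = predualEmbedding Φ φ := hφ.symm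
    have h2 : g (m * b) = Φ m φ := DFunLike.congr_fun h1 m
    rw [ContinuousLinearMap.comp_apply, h1, ContinuousLinearMap.comp_apply,
      ContinuousLinearMap.mul_apply', h2, hm]
    rfl
  rw [h]
  exact normalFunctionals_comp_mul_left hΦ hg m

theorem norm_rightTranslates_apply_le (g : StrongDual ℂ A) (b : A) : ‖rightTranslates g b‖ ≤ ‖g‖ * ‖b‖ := by
  refine ContinuousLinearMap.opNorm_le_bound _ (by positivity) fun a => ?_
  refine (g.le_opNorm _).trans ?_
  rw [mul_assoc]
  exact mul_le_mul_of_nonneg_left ((norm_mul_le a b).trans_eq (mul_comm _ _)) (norm_nonneg g)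

theorem norm_rightTranslates_mul_le (g : StrongDual ℂ A) (a b : A) :
    ‖rightTranslates g (a * b)‖ ≤ ‖a‖ * ‖rightTranslates g b‖ := by
  refine ContinuousLinearMap.opNorm_le_bound _ (by positivity) fun c => ?_
  rw [rightTranslates_apply, ← mul_assoc, ← rightTranslates_apply]
  refine ((rightTranslates g b).le_opNorm _).trans ?_
  rw [mul_comm ‖a‖, mul_assoc]
  exact mul_le_mul_of_nonneg_left ((norm_mul_le c a).trans_eq (mul_comm _ _)) (norm_nonneg _)

/-- Interpolating `b ↦ ‖g(· b)‖` gives a cyclic module in which the class of 1 has norm at most one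
and the class of `a` has norm at least `‖g a‖`. The contractive inclusion and projection carry this
over to `R`. -/
theorem NormalRep.IsUniversal.norm_apply_le [NormOneClass A] (hΦ : IsDualBanachAlgebra Φ)
    {R : NormalRep Φ} (hR : R.IsUniversal) {g : StrongDual ℂ A} (hg : g ∈ normalFunctionals Φ)
    (hg1 : ‖g‖ ≤ 1) (a : A) : ‖g a‖ ≤ ‖R.rep a‖ := by
  have hs1 : ∀ b, normComp (rightTranslates g) b ≤ ‖b‖ := fun b =>
    (norm_rightTranslates_apply_le g b).trans (mul_le_of_le_one_left (norm_nonneg b) hg1)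
  let p : LeftSeminorm Φ := LeftSeminorm.interp (isNormalSeminorm_rightTranslates hΦ hg) hs1
    (norm_rightTranslates_mul_le g)
  obtain ⟨i, r, hri, hi, hr, hia, hra⟩ := hR.left p
  have h1 : ‖g a‖ ≤ p.1 a := by
    refine le_trans ?_ (le_interpSeminorm hs1 a)
    have := (rightTranslates g a).le_opNorm 1
    rwa [rightTranslates_apply, one_mul, norm_one, mul_one] at this
  have h2 : p.1 1 ≤ 1 := (interpSeminorm_le_norm (1 : A)).trans_eq norm_one
  have h3 : toSeminormCompletion p.1 a = r (R.rep a (i (toSeminormCompletion p.1 1))) := by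
    rw [hra, hri, leftHom_apply, mul_one]
  refine h1.trans ?_
  rw [← norm_toSeminormCompletion, h3]
  refine (hr _).trans (((R.rep a).le_opNorm _).trans ?_)
  refine mul_le_of_le_one_right (norm_nonneg _) ((hi _).trans ?_)
  rwa [norm_toSeminormCompletion]

/-- Since `A` is the dual of `P`, the norm of `a` is already detected by normal functionals of norm
one. -/
theorem NormalRep.IsUniversal.isometry [NormOneClass A] (hΦ : IsDualBanachAlgebra Φ)
    {R : NormalRep Φ} (hR : R.IsUniversal) : Isometry R.rep := by
  refine AddMonoidHomClass.isometry_of_norm R.rep fun a => le_antisymm (R.norm_rep_le a) ?_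
  rw [← Φ.norm_map a]
  refine ContinuousLinearMap.opNorm_le_of_unit_norm (norm_nonneg _) fun φ hφ => ?_
  exact hR.norm_apply_le hΦ (g := predualEmbedding Φ φ) ⟨φ, rfl⟩
    ((predualEmbedding Φ).norm_map φ |>.trans hφ).le a

/-- The functionals `a ↦ ⟨π(a), w⟩` for `w ∈ E' ⊗̂ E`. -/
def opCoefficient {E : Type*} [NormedAddCommGroup E] [NormedSpace ℂ E] (π : A →A[ℂ] (E →L[ℂ] E)) :
    ProjTensor (StrongDual ℂ E) E →L[ℂ] StrongDual ℂ A :=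
  (opPairing E ∘L π.toContinuousLinearMap).flip

theorem opCoefficient_apply {E : Type*} [NormedAddCommGroup E] [NormedSpace ℂ E]
    (π : A →A[ℂ] (E →L[ℂ] E)) (w : ProjTensor (StrongDual ℂ E) E) (a : A) :
    opCoefficient π w a = opPairing E (π a) w := rfl

theorem NormalRep.opCoefficient_mem (R : NormalRep Φ)
    (w : ProjTensor (StrongDual ℂ R.carrier) R.carrier) :
    opCoefficient R.rep w ∈ normalFunctionals Φ := by
  obtain ⟨ι, μ, x, -, -, h⟩ := ProjTensor.exists_hasSum w
  refine (isClosed_normalFunctionals Φ).mem_of_tendsto (h.mapL (opCoefficient R.rep))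
    (Filter.Eventually.of_forall fun s => Submodule.sum_mem _ fun i _ => ?_)
  have h1 : opCoefficient R.rep (ProjTensor.tmul (μ i) (x i)) = coefficient R.rep (x i) (μ i) := by
    ext a
    rw [opCoefficient_apply, opPairing_tmul, coefficient_apply]
  rw [h1]
  exact R.normal _ _

theorem NormalRep.continuous_rep (R : NormalRep Φ) :
    Continuous[weakStarTopology Φ, weakStarTopology (opPairing R.carrier)] R.rep := by
  letI := weakStarTopology Φ
  refine continuous_induced_rng.2 (WeakDual.continuous_of_continuous_eval fun w => ?_)
  exact (mem_normalFunctionals_iff Φ _).1 (R.opCoefficient_mem w)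

end Universal

/-! ### The space `σWC` -/

section SigmaWC

variable {A P M : Type*} [NormedRing A] [NormedAlgebra ℂ A]
  [NormedAddCommGroup P] [NormedSpace ℂ P] [NormedAddCommGroup M] [NormedSpace ℂ M]
  {Φ : A ≃ₗᵢ[ℂ] StrongDual ℂ P}

theorem continuous_toWeakSpace_iff (θ : A →L[ℂ] M) :
    Continuous[weakStarTopology Φ, inferInstance] (fun a => toWeakSpace ℂ M (θ a)) ↔
      ∀ m : StrongDual ℂ M, m ∘L θ ∈ normalFunctionals Φ := by
  simp only [mem_normalFunctionals_iff]
  letI := weakStarTopology Φ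
  constructor
  · intro h m
    exact (WeakBilin.eval_continuous (topDualPairing ℂ M).flip m).comp h
  · intro h
    exact WeakBilin.continuous_of_continuous_eval (topDualPairing ℂ M).flip h

theorem mem_sigmaWC_iff (l r : A →L[ℂ] M →L[ℂ] M) (x : M) :
    x ∈ sigmaWC Φ l r ↔ (∀ m : StrongDual ℂ M, m ∘L l.flip x ∈ normalFunctionals Φ) ∧
      ∀ m : StrongDual ℂ M, m ∘L r.flip x ∈ normalFunctionals Φ :=
  and_congr (continuous_toWeakSpace_iff (l.flip x)) (continuous_toWeakSpace_iff (r.flip x))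

theorem isClosed_sigmaWC [CompleteSpace P] (l r : A →L[ℂ] M →L[ℂ] M) :
    IsClosed (sigmaWC Φ l r : Set M) := by
  have h : (sigmaWC Φ l r : Set M) =
      (⋂ m : StrongDual ℂ M, {x | m ∘L l.flip x ∈ normalFunctionals Φ}) ∩
      ⋂ m : StrongDual ℂ M, {x | m ∘L r.flip x ∈ normalFunctionals Φ} := by
    ext x
    simp only [SetLike.mem_coe, mem_sigmaWC_iff, Set.mem_inter_iff, Set.mem_iInter,
      Set.mem_ofPred_eq]
  rw [h]
  have h1 : ∀ (k : A →L[ℂ] M →L[ℂ] M) (m : StrongDual ℂ M),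
      IsClosed {x | m ∘L k.flip x ∈ normalFunctionals Φ} := fun k m =>
    (isClosed_normalFunctionals Φ).preimage
      (ContinuousLinearMap.continuous (ContinuousLinearMap.compL ℂ A M ℂ m ∘L k.flip))
  exact (isClosed_iInter (h1 l)).inter (isClosed_iInter (h1 r))

end SigmaWC

/-! ### The range of ψ lies in σWC -/

section PsiMem

variable {A : Type u} {P : Type v} [NormedRing A] [NormedAlgebra ℂ A] [NormedAddCommGroup P]
  [NormedSpace ℂ P] [CompleteSpace P] {Φ : A ≃ₗᵢ[ℂ] StrongDual ℂ P}

/-- The left action puts `π(a)` next to `x`, so composing with `m` gives a coefficient at the vector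
`x`. The right action puts it next to `μ`. There `m` becomes a functional on `E'`, which by
reflexivity is a vector, and again a coefficient results. -/
theorem NormalRep.psiForm_mem (R : NormalRep Φ) (T : R.carrier →L[ℂ] R.carrier) (x : R.carrier)
    (μ : StrongDual ℂ R.carrier) :
    psiForm R.rep.toContinuousLinearMap T x μ ∈ sigmaWCBil Φ := by
  rw [mem_sigmaWC_iff]
  constructor
  · intro m
    have h : m ∘L (leftAct A).flip (psiForm R.rep.toContinuousLinearMap T x μ) =
        coefficient R.rep x (m ∘L (psiForm R.rep.toContinuousLinearMap T).flip μ) := by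
      ext a
      refine congrArg m ?_
      ext b c
      change μ (R.rep c (T (R.rep (b * a) x))) = μ (R.rep c (T (R.rep b (R.rep a x))))
      rw [map_mul]
      rfl
    rw [h]
    exact R.normal _ _
  · intro m
    obtain ⟨y, hy⟩ := R.reflexive (m ∘L psiForm R.rep.toContinuousLinearMap T x)
    have h : m ∘L (rightAct A).flip (psiForm R.rep.toContinuousLinearMap T x μ) =
        coefficient R.rep y μ := by
      ext a
      have h1 := DFunLike.congr_fun hy (μ ∘L R.rep a)
      refine Eq.trans (congrArg m ?_) h1.symm
      ext b c
      change μ (R.rep (a * c) (T (R.rep b x))) = μ (R.rep a (R.rep c (T (R.rep b x))))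
      rw [map_mul]
      rfl
    rw [h]
    exact R.normal _ _

theorem NormalRep.psi_mem (R : NormalRep Φ) (z : BimodulePredual R.rep) :
    psi R.rep z ∈ sigmaWCBil Φ := by
  obtain ⟨w, rfl⟩ := (relSpace (commutant R.rep)).mkQ_surjective z
  have h : psi R.rep ((relSpace (commutant R.rep)).mkQ w) = psiPre R.rep w := by simp [psi]
  rw [h]
  have hcl : IsClosed (((sigmaWCBil Φ).comap (psiPre R.rep).toLinearMap :
      Submodule ℂ (TripleTensor R.carrier)) : Set (TripleTensor R.carrier)) :=
    (isClosed_sigmaWC (leftAct A) (rightAct A)).preimage (psiPre R.rep).continuous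
  refine mem_of_triple_mem hcl (fun T x μ => ?_) w
  have h1 : psiPre R.rep (triple T x μ) = psiForm R.rep.toContinuousLinearMap T x μ := by
    ext b a
    rw [psiPre_triple]
    rfl
  change psiPre R.rep (triple T x μ) ∈ sigmaWCBil Φ
  rw [h1]
  exact R.psiForm_mem T x μ

end PsiMem

/-! ### Bilinear forms on completions -/

section BilinearLift

variable {V W : Type*} [NormedAddCommGroup V] [NormedSpace ℂ V] [NormedAddCommGroup W]
  [NormedSpace ℂ W] {p : Seminorm ℂ V} {q : Seminorm ℂ W}

theorem exists_bilinear_lift (β : V →L[ℂ] W →L[ℂ] ℂ) {C : ℝ} (hC : 0 ≤ C)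
    (h : ∀ x y, ‖β x y‖ ≤ C * p x * q y) :
    ∃ B : SeminormCompletion p →L[ℂ] StrongDual ℂ (SeminormCompletion q), ‖B‖ ≤ C ∧
      ∀ x y, B (toSeminormCompletion p x) (toSeminormCompletion q y) = β x y := by
  have h1 : ∀ x y, SeminormCompletion.lift q (β x).toLinearMap (toSeminormCompletion q y) =
      β x y := fun x y => SeminormCompletion.lift_apply (C := C * p x) (h x) y
  let B₀ : V →ₗ[ℂ] StrongDual ℂ (SeminormCompletion q) :=
    { toFun := fun x => SeminormCompletion.lift q (β x).toLinearMap
      map_add' := fun x x' => SeminormCompletion.ext fun y => by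
        rw [add_apply, h1, h1, h1, map_add, add_apply]
      map_smul' := fun c x => SeminormCompletion.ext fun y => by
        rw [smul_apply, h1, h1, map_smul, smul_apply]
        rfl }
  have h2 : ∀ x, ‖B₀ x‖ ≤ C * p x := fun x =>
    SeminormCompletion.norm_lift_le (by positivity) (h x)
  refine ⟨SeminormCompletion.lift p B₀, SeminormCompletion.norm_lift_le hC h2, fun x y => ?_⟩
  rw [SeminormCompletion.lift_apply h2]
  exact h1 x y

end BilinearLift

/-! ### ℓ²-combinations of seminorms given by operators -/

section SquareSum

variable {A P Y : Type*} [NormedAddCommGroup A] [NormedSpace ℂ A] [NormedAddCommGroup P]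
  [NormedSpace ℂ P] [NormedAddCommGroup Y] [NormedSpace ℂ Y] [CompleteSpace Y]
  {Φ : A ≃ₗᵢ[ℂ] StrongDual ℂ P} {ι : Type*}

theorem summable_normComp_sq {θ : ι → A →L[ℂ] Y} {C : ℝ}
    (h : ∀ a (t : Finset ι), ∑ i ∈ t, ‖θ i a‖ ^ 2 ≤ C * ‖a‖ ^ 2) (a : A) :
    Summable fun i => normComp (θ i) a ^ 2 :=
  summable_of_sum_le (fun _ => sq_nonneg _) (h a)

theorem ellTwoSeminorm_normComp_le {θ : ι → A →L[ℂ] Y} {C : ℝ}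
    (h : ∀ a (t : Finset ι), ∑ i ∈ t, ‖θ i a‖ ^ 2 ≤ C * ‖a‖ ^ 2) (hC : 0 ≤ C) (a : A) :
    ellTwoSeminorm (fun i => normComp (θ i)) (summable_normComp_sq h) a ≤ √C * ‖a‖ := by
  refine (sq_le_sq₀ (apply_nonneg _ _) (by positivity)).1 ?_
  rw [ellTwoSeminorm_sq, mul_pow, Real.sq_sqrt hC]
  exact (summable_normComp_sq h a).tsum_le_of_sum_le (h a)

theorem sum_norm_sq_le_ellTwoSeminorm {θ : ι → A →L[ℂ] Y}
    (hk : ∀ a, Summable fun i => normComp (θ i) a ^ 2) (a : A) (t : Finset ι) :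
    ∑ i ∈ t, ‖θ i a‖ ^ 2 ≤ ellTwoSeminorm (fun i => normComp (θ i)) hk a ^ 2 := by
  rw [ellTwoSeminorm_sq]
  exact (hk a).sum_le_tsum t fun i _ => sq_nonneg _

end SquareSum

/-! ### Surjectivity of ψ -/

section Sandwich

variable {A : Type u} {P : Type v} [NormedRing A] [NormedAlgebra ℂ A] [NormedAddCommGroup P]
  [NormedSpace ℂ P] [CompleteSpace P] {Φ : A ≃ₗᵢ[ℂ] StrongDual ℂ P}

theorem isAdmissible_ellTwo {Y : Type*} [NormedAddCommGroup Y] [NormedSpace ℂ Y]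
    [CompleteSpace Y] (hY : IsReflexiveSpace Y) {ι : Type*} {θ : ι → A →L[ℂ] Y} {C : ℝ}
    (hC : 0 ≤ C) (h : ∀ a (t : Finset ι), ∑ i ∈ t, ‖θ i a‖ ^ 2 ≤ C * ‖a‖ ^ 2)
    (hn : ∀ i (G : StrongDual ℂ Y), G ∘L θ i ∈ normalFunctionals Φ) :
    IsAdmissible Φ (ellTwoSeminorm (fun i => normComp (θ i)) (summable_normComp_sq h)) where
  bound := ⟨√C, ellTwoSeminorm_normComp_le h hC⟩
  reflexive := isReflexiveSpace_ellTwoSeminorm fun i => isReflexiveSpace_normComp hY (θ i)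
  normal := IsNormalSeminorm.ellTwo (fun i => isNormalSeminorm_normComp (hn i))
    (ellTwoSeminorm_normComp_le h hC)

/-- Bounded maps `E_p → (E_q)'` can be realised on a universal representation, compatibly with
the relations. -/
theorem NormalRep.IsUniversal.exists_sandwich {R : NormalRep Φ} (hR : R.IsUniversal)
    (p : LeftSeminorm Φ) (q : RightSeminorm Φ) :
    ∃ (i : StrongDual ℂ (SeminormCompletion q.1) →L[ℂ] R.carrier)
      (r : R.carrier →L[ℂ] SeminormCompletion p.1) (x : R.carrier) (μ : StrongDual ℂ R.carrier),
      ‖i‖ ≤ 1 ∧ ‖r‖ ≤ 1 ∧ ‖x‖ ≤ p.1 1 ∧ ‖μ‖ ≤ q.1 1 ∧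
      (∀ a, r (R.rep a x) = toSeminormCompletion p.1 a) ∧
      (∀ a f, μ (R.rep a (i f)) = f (toSeminormCompletion q.1 a)) ∧
      (∀ a f, i (rightHom q a f) = R.rep a (i f)) ∧
      (∀ a y, r (R.rep a y) = leftHom p a (r y)) := by
  obtain ⟨ip, rp, h1, h2, h3, h4, h5⟩ := hR.left p
  obtain ⟨iq, rq, k1, k2, k3, k4, k5⟩ := hR.right q
  -- The vector is the embedded class of 1, and the functional is the projection followed by
  -- evaluation at the class of 1. Their orbits recover the canonical maps of `A` into both
  -- completions.
  let ev := NormedSpace.inclusionInDoubleDual ℂ _ (toSeminormCompletion q.1 1)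
  refine ⟨iq, rp, ip (toSeminormCompletion p.1 1), ev ∘L rq, ?_, ?_, ?_, ?_, ?_, ?_, k4, h5⟩
  · exact ContinuousLinearMap.opNorm_le_bound _ zero_le_one fun f => by
      rw [one_mul]; exact k2 f
  · exact ContinuousLinearMap.opNorm_le_bound _ zero_le_one fun f => by
      rw [one_mul]; exact h3 f
  · exact (h2 _).trans_eq (norm_toSeminormCompletion _ _)
  · refine ContinuousLinearMap.opNorm_le_bound _ (apply_nonneg _ _) fun y => ?_
    refine ((rq y).le_opNorm (toSeminormCompletion q.1 1)).trans ?_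
    rw [norm_toSeminormCompletion, mul_comm]
    exact mul_le_mul_of_nonneg_left (k3 y) (apply_nonneg _ _)
  · intro a
    rw [h5, h1, leftHom_apply, mul_one]
  · intro a f
    change rq (R.rep a (iq f)) (toSeminormCompletion q.1 1) = _
    rw [k5, k1, rightHom_apply, one_mul]

/-- Every element of `σWC` of norm at most one is a coefficient of a universal representation. -/
theorem NormalRep.IsUniversal.exists_psi_eq [NormOneClass A] {R : NormalRep Φ}
    (hR : R.IsUniversal) {T : A →L[ℂ] StrongDual ℂ A} (hT : T ∈ sigmaWCBil Φ) (hT1 : ‖T‖ ≤ 1) :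
    ∃ z, psi R.rep z = T := by
  obtain ⟨hl, hr⟩ := (mem_sigmaWC_iff _ _ _).1 hT
  have hsl : ∀ b a c, (leftAct A).flip T b a c = T (a * b) c := fun _ _ _ => rfl
  have hsr : ∀ b a c, (rightAct A).flip T b a c = T a (b * c) := fun _ _ _ => rfl
  have hs1 : ∀ b, normComp ((leftAct A).flip T) b ≤ ‖b‖ := by
    intro b
    rw [normComp_apply]
    refine ContinuousLinearMap.opNorm_le_bound _ (norm_nonneg b) fun a => ?_
    refine ContinuousLinearMap.opNorm_le_bound _ (by positivity) fun c => ?_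
    rw [hsl]
    refine (T.le_opNorm₂ _ _).trans ?_
    refine mul_le_mul_of_nonneg_right ?_ (norm_nonneg c)
    refine (mul_le_of_le_one_left (norm_nonneg _) hT1).trans ?_
    exact (norm_mul_le a b).trans_eq (mul_comm _ _)
  have hr1 : ∀ b, normComp ((rightAct A).flip T) b ≤ ‖b‖ := by
    intro b
    rw [normComp_apply]
    refine ContinuousLinearMap.opNorm_le_bound _ (norm_nonneg b) fun a => ?_
    refine ContinuousLinearMap.opNorm_le_bound _ (by positivity) fun c => ?_
    rw [hsr]
    refine (T.le_opNorm₂ _ _).trans ?_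
    refine (mul_le_mul (mul_le_of_le_one_left (norm_nonneg _) hT1) (norm_mul_le b c)
      (norm_nonneg _) (norm_nonneg _)).trans_eq (by ring)
  have hs2 : ∀ a b, normComp ((leftAct A).flip T) (a * b) ≤
      ‖a‖ * normComp ((leftAct A).flip T) b := by
    intro a b
    rw [normComp_apply, normComp_apply]
    refine ContinuousLinearMap.opNorm_le_bound _
      (mul_nonneg (norm_nonneg a) (norm_nonneg _)) fun c => ?_
    have h : (leftAct A).flip T (a * b) c = (leftAct A).flip T b (c * a) := by
      ext d
      rw [hsl, hsl, mul_assoc]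
    rw [h, mul_comm ‖a‖, mul_assoc]
    refine (((leftAct A).flip T b).le_opNorm _).trans ?_
    exact mul_le_mul_of_nonneg_left ((norm_mul_le c a).trans_eq (mul_comm _ _)) (norm_nonneg _)
  have hr2 : ∀ a b, normComp ((rightAct A).flip T) (a * b) ≤
      ‖b‖ * normComp ((rightAct A).flip T) a := by
    intro a b
    rw [normComp_apply, normComp_apply]
    refine ContinuousLinearMap.opNorm_le_bound _
      (mul_nonneg (norm_nonneg b) (norm_nonneg _)) fun c => ?_
    refine ContinuousLinearMap.opNorm_le_bound _
      (mul_nonneg (mul_nonneg (norm_nonneg b) (norm_nonneg _)) (norm_nonneg _)) fun d => ?_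
    have h : (rightAct A).flip T (a * b) c d = (rightAct A).flip T a c (b * d) := by
      rw [hsr, hsr, mul_assoc]
    rw [h]
    refine (((rightAct A).flip T a).le_opNorm₂ _ _).trans ?_
    refine (mul_le_mul_of_nonneg_left (norm_mul_le b d) (by positivity)).trans_eq (by ring)
  let p : LeftSeminorm Φ := LeftSeminorm.interp (isNormalSeminorm_normComp hl) hs1 hs2
  let q : RightSeminorm Φ := RightSeminorm.interp (isNormalSeminorm_normComp hr) hr1 hr2
  -- Because `T b a = (b·T)(1)(a) = (T·a)(b)(1)`, the form is bounded by `‖b·T‖ ‖a‖` and by `‖b‖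
  -- ‖T·a‖`. These are the two endpoint estimates for interpolation.
  have h48 : ∀ b a, ‖T b a‖ ≤ 48 * p.1 b * q.1 a := by
    refine norm_le_interpSeminorm_mul T hs1 hr1 (fun b a => ?_) fun b a => ?_
    · have := ((leftAct A).flip T b).le_opNorm₂ 1 a
      rwa [hsl, one_mul, norm_one, mul_one] at this
    · have := ((rightAct A).flip T a).le_opNorm₂ b 1
      rwa [hsr, mul_one, norm_one, mul_one, mul_comm] at this
  obtain ⟨B, -, hB⟩ := exists_bilinear_lift T (by norm_num) h48
  obtain ⟨i, r, x, μ, -, -, -, -, hx, hμ, -, -⟩ := hR.exists_sandwich p q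
  refine ⟨(relSpace (commutant R.rep)).mkQL (triple (i ∘L B ∘L r) x μ), ?_⟩
  ext b a
  rw [psi_mk_triple, ContinuousLinearMap.comp_apply, ContinuousLinearMap.comp_apply, hx, hμ, hB]

theorem NormalRep.IsUniversal.surjective [NormOneClass A] {R : NormalRep Φ}
    (hR : R.IsUniversal) {T : A →L[ℂ] StrongDual ℂ A} (hT : T ∈ sigmaWCBil Φ) :
    ∃ z, psi R.rep z = T := by
  have hn : (0 : ℝ) < ‖T‖ + 1 := by positivity
  have hc : ((‖T‖ + 1 : ℝ) : ℂ) ≠ 0 := Complex.ofReal_ne_zero.2 hn.ne'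
  obtain ⟨z, hz⟩ := hR.exists_psi_eq ((sigmaWCBil Φ).smul_mem (((‖T‖ + 1 : ℝ) : ℂ)⁻¹) hT) (by
    rw [norm_smul, norm_inv, Complex.norm_real, Real.norm_of_nonneg hn.le,
      inv_mul_le_iff₀ hn]
    linarith)
  exact ⟨((‖T‖ + 1 : ℝ) : ℂ) • z, by rw [map_smul, hz, smul_inv_smul₀ hc]⟩

end Sandwich

/-! ### Injectivity -/

section Estimates

variable {V W : Type*} [AddCommGroup V] [Module ℂ V] [AddCommGroup W] [Module ℂ W]
  {p : Seminorm ℂ V} {q : Seminorm ℂ W}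

theorem SeminormCompletion.norm_le_of_bilinear_bound
    (B : SeminormCompletion p →L[ℂ] StrongDual ℂ (SeminormCompletion q)) {C : ℝ} (hC : 0 ≤ C)
    (h : ∀ x y, ‖B (toSeminormCompletion p x) (toSeminormCompletion q y)‖ ≤ C * p x * q y) :
    ‖B‖ ≤ C := by
  have h1 : ∀ x, ‖B (toSeminormCompletion p x)‖ ≤ C * ‖toSeminormCompletion p x‖ := fun x => by
    refine ContinuousLinearMap.opNorm_le_bound _ (by positivity) fun z => ?_
    refine (denseRange_toSeminormCompletion q).induction_on (p := fun z =>
      ‖B (toSeminormCompletion p x) z‖ ≤ C * ‖toSeminormCompletion p x‖ * ‖z‖) z ?_ fun y => ?_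
    · exact isClosed_le (B (toSeminormCompletion p x)).continuous.norm
        (continuous_const.mul continuous_norm)
    · rw [norm_toSeminormCompletion, norm_toSeminormCompletion]
      exact h x y
  refine ContinuousLinearMap.opNorm_le_bound _ hC fun z => ?_
  refine (denseRange_toSeminormCompletion p).induction_on (p := fun z =>
    ‖B z‖ ≤ C * ‖z‖) z ?_ h1
  exact isClosed_le B.continuous.norm (continuous_const.mul continuous_norm)

/-- The smallness comes from the operators alone. Cauchy–Schwarz absorbs vectors and functionals
into their ℓ²-norms. -/
theorem norm_sum_apply_le {E ι : Type*} [NormedAddCommGroup E] [NormedSpace ℂ E]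
    (T : ι → E →L[ℂ] E) (x : ι → E) (μ : ι → StrongDual ℂ E) {u : Finset ι} {ε c d : ℝ}
    (hε : 0 ≤ ε) (hT : ∀ i ∈ u, ‖T i‖ ≤ ε) (hc : 0 ≤ c) (hd : 0 ≤ d)
    (hx : ∑ i ∈ u, ‖x i‖ ^ 2 ≤ c ^ 2) (hμ : ∑ i ∈ u, ‖μ i‖ ^ 2 ≤ d ^ 2) :
    ‖∑ i ∈ u, μ i (T i (x i))‖ ≤ ε * c * d := by
  calc ‖∑ i ∈ u, μ i (T i (x i))‖ ≤ ∑ i ∈ u, ε * (‖x i‖ * ‖μ i‖) := by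
        refine norm_sum_le_of_le u fun i hi => ?_
        refine ((μ i).le_opNorm _).trans ?_
        rw [← mul_assoc, mul_comm]
        exact mul_le_mul_of_nonneg_right ((T i).le_of_opNorm_le (hT i hi) _) (norm_nonneg _)
    _ = ε * ∑ i ∈ u, ‖x i‖ * ‖μ i‖ := by rw [Finset.mul_sum]
    _ ≤ ε * (c * d) := by
        refine mul_le_mul_of_nonneg_left ?_ hε
        refine (Real.sum_mul_le_sqrt_mul_sqrt u _ _).trans ?_
        exact mul_le_mul ((Real.sqrt_le_left hc).2 hx) ((Real.sqrt_le_left hd).2 hμ)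
          (Real.sqrt_nonneg _) hc
    _ = ε * c * d := by ring

/-- As the total is zero, the sum over `t` is minus the sum over the rest, which avoids `s`. -/
theorem norm_sum_le_of_hasSum_zero {ι : Type*} {f : ι → ℂ} (hf : HasSum f 0) {s t : Finset ι}
    (hst : s ⊆ t) {K : ℝ} (h : ∀ u : Finset ι, (∀ i ∈ u, i ∉ s) → ‖∑ i ∈ u, f i‖ ≤ K) :
    ‖∑ i ∈ t, f i‖ ≤ K := by
  classical
  have h1 : Filter.Tendsto (fun u : Finset ι => ‖∑ i ∈ u, f i‖ + K) Filter.atTop (𝓝 (0 + K)) := by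
    refine Filter.Tendsto.add_const K ?_
    have := hf.norm
    rwa [norm_zero] at this
  rw [zero_add] at h1
  refine ge_of_tendsto h1 ((Filter.eventually_ge_atTop t).mono fun u hu => ?_)
  have h2 : ∑ i ∈ t, f i = ∑ i ∈ u, f i - ∑ i ∈ u \ t, f i := by
    rw [← Finset.sum_sdiff hu, add_sub_cancel_left]
  rw [h2]
  refine (norm_sub_le _ _).trans (add_le_add_right (h _ fun i hi his => ?_) _)
  exact (Finset.mem_sdiff.1 hi).2 (hst his)

/-- With the outer data `i`, `r`, `ξ`, `η` fixed, `G` becomes a functional of the middle operator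
alone, so that a sum of many terms is controlled by the operator norm of one sum. -/
theorem exists_sandwich_functional {X Y E Z : Type*} [NormedAddCommGroup X] [NormedSpace ℂ X]
    [NormedAddCommGroup Y] [NormedSpace ℂ Y] [NormedAddCommGroup E] [NormedSpace ℂ E]
    [NormedAddCommGroup Z] [NormedSpace ℂ Z]
    (B : (E →L[ℂ] E) →L[ℂ] E →L[ℂ] StrongDual ℂ E →L[ℂ] Z) (G : StrongDual ℂ Z)
    (hB : ∀ T x μ, ‖B T x μ‖ ≤ ‖T‖ * (‖x‖ * ‖μ‖))
    {i : Y →L[ℂ] E} {r : E →L[ℂ] X} {ξ : E} {η : StrongDual ℂ E} {c : ℝ}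
    (hi : ‖i‖ ≤ 1) (hr : ‖r‖ ≤ 1) (hξ : ‖ξ‖ ≤ c) (hη : ‖η‖ ≤ c) :
    ∃ g : StrongDual ℂ (X →L[ℂ] Y), (∀ D, g D = G (B (i ∘L (D ∘L r)) ξ η)) ∧
      ∀ D, ‖g D‖ ≤ ‖G‖ * (c * c) * ‖D‖ := by
  refine ⟨G ∘L (B.flip ξ).flip η ∘L ContinuousLinearMap.compL ℂ E Y E i ∘L
    (ContinuousLinearMap.compL ℂ E X Y).flip r, fun D => rfl, fun D => ?_⟩
  change ‖G (B (i ∘L (D ∘L r)) ξ η)‖ ≤ _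
  have h0 : ‖i ∘L (D ∘L r)‖ ≤ ‖D‖ := by
    refine (ContinuousLinearMap.opNorm_comp_le _ _).trans
      ((mul_le_of_le_one_left (norm_nonneg _) hi).trans ?_)
    exact (ContinuousLinearMap.opNorm_comp_le _ _).trans
      (mul_le_of_le_one_right (norm_nonneg _) hr)
  have hc : 0 ≤ c := (norm_nonneg ξ).trans hξ
  calc ‖G (B (i ∘L (D ∘L r)) ξ η)‖ ≤ ‖G‖ * ‖B (i ∘L (D ∘L r)) ξ η‖ := G.le_opNorm _
    _ ≤ ‖G‖ * (‖D‖ * (c * c)) := by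
        refine mul_le_mul_of_nonneg_left ((hB _ _ _).trans ?_) (norm_nonneg G)
        exact mul_le_mul h0 (mul_le_mul hξ hη (norm_nonneg _) hc) (by positivity)
          (norm_nonneg D)
    _ = ‖G‖ * (c * c) * ‖D‖ := by ring

end Estimates

/-! ### Orbit maps and the module seminorms of square-summable families -/

section OrbitMaps

variable {A : Type u} {P : Type v} [NormedRing A] [NormedAlgebra ℂ A] [NormedAddCommGroup P]
  [NormedSpace ℂ P] [CompleteSpace P] {Φ : A ≃ₗᵢ[ℂ] StrongDual ℂ P}

/-- The orbit map `a ↦ π(a) x`. -/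
def NormalRep.orbit (R : NormalRep Φ) (x : R.carrier) : A →L[ℂ] R.carrier :=
  R.rep.toContinuousLinearMap.flip x

theorem NormalRep.orbit_apply (R : NormalRep Φ) (x : R.carrier) (a : A) :
    R.orbit x a = R.rep a x := rfl

/-- The dual orbit map `a ↦ μ ∘ π(a)`. -/
def NormalRep.coorbit (R : NormalRep Φ) (μ : StrongDual ℂ R.carrier) :
    A →L[ℂ] StrongDual ℂ R.carrier :=
  ContinuousLinearMap.compL ℂ R.carrier R.carrier ℂ μ ∘L R.rep.toContinuousLinearMap

theorem NormalRep.coorbit_apply (R : NormalRep Φ) (μ : StrongDual ℂ R.carrier) (a : A)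
    (y : R.carrier) : R.coorbit μ a y = μ (R.rep a y) := rfl

theorem NormalRep.norm_orbit_le (R : NormalRep Φ) (x : R.carrier) (a : A) :
    ‖R.orbit x a‖ ≤ ‖a‖ * ‖x‖ :=
  (R.rep a).le_of_opNorm_le (R.norm_rep_le a) x

theorem NormalRep.norm_coorbit_le (R : NormalRep Φ) (μ : StrongDual ℂ R.carrier) (a : A) :
    ‖R.coorbit μ a‖ ≤ ‖a‖ * ‖μ‖ := by
  refine (ContinuousLinearMap.opNorm_comp_le μ (R.rep a)).trans ?_
  rw [mul_comm]
  exact mul_le_mul_of_nonneg_right (R.norm_rep_le a) (norm_nonneg μ)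

theorem NormalRep.orbit_mul (R : NormalRep Φ) (x : R.carrier) (a b : A) :
    R.orbit x (a * b) = R.rep a (R.orbit x b) := by
  rw [orbit_apply, map_mul]
  rfl

theorem NormalRep.coorbit_mul (R : NormalRep Φ) (μ : StrongDual ℂ R.carrier) (a b : A) :
    R.coorbit μ (a * b) = R.coorbit μ a ∘L R.rep b := by
  ext y
  rw [coorbit_apply, map_mul]
  rfl

theorem sum_sq_le_of_le_mul {ι : Type*} {f g : ι → ℝ} {c C : ℝ} (hf : ∀ i, 0 ≤ f i)
    (h : ∀ i, f i ≤ c * g i) (t : Finset ι) (hg : ∑ i ∈ t, g i ^ 2 ≤ C) :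
    ∑ i ∈ t, f i ^ 2 ≤ C * c ^ 2 := by
  calc ∑ i ∈ t, f i ^ 2 ≤ ∑ i ∈ t, g i ^ 2 * c ^ 2 := Finset.sum_le_sum fun i _ => by
        rw [← mul_pow, mul_comm]
        exact pow_le_pow_left₀ (hf i) (h i) 2
    _ = (∑ i ∈ t, g i ^ 2) * c ^ 2 := by rw [Finset.sum_mul]
    _ ≤ C * c ^ 2 := mul_le_mul_of_nonneg_right hg (sq_nonneg c)

variable [NormOneClass A] {ι : Type*}

/-- The seminorm is p(a)² = Σ‖π(a)xᵢ‖². It is admissible because each orbit map takes values in the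
reflexive space `R.carrier`, and it lets a single cyclic module carry the orbits of all `x i`. -/
theorem NormalRep.exists_leftSeminorm (R : NormalRep Φ) {x : ι → R.carrier} {C : ℝ}
    (hx : ∀ t : Finset ι, ∑ i ∈ t, ‖x i‖ ^ 2 ≤ C) :
    ∃ p : LeftSeminorm Φ, p.1 1 ≤ √C ∧
      (∀ a (t : Finset ι), ∑ i ∈ t, ‖R.orbit (x i) a‖ ^ 2 ≤ p.1 a ^ 2) ∧
      ∀ i, ∃ J : SeminormCompletion p.1 →L[ℂ] R.carrier,
        ∀ a, J (toSeminormCompletion p.1 a) = R.orbit (x i) a := by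
  have hC : 0 ≤ C := by simpa using hx ∅
  have h : ∀ a (t : Finset ι), ∑ i ∈ t, ‖R.orbit (x i) a‖ ^ 2 ≤ C * ‖a‖ ^ 2 := fun a t =>
    sum_sq_le_of_le_mul (fun i => norm_nonneg _) (fun i => R.norm_orbit_le (x i) a) t (hx t)
  let p : LeftSeminorm Φ :=
    ⟨ellTwoSeminorm (fun i => normComp (R.orbit (x i))) (summable_normComp_sq h),
      isAdmissible_ellTwo R.reflexive hC h fun i G => R.normal (x i) G, fun a b =>
        ellTwoSeminorm_map_le (L := LinearMap.mulLeft ℂ a) (norm_nonneg a) (fun i c => by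
          rw [normComp_apply, normComp_apply, LinearMap.mulLeft_apply, R.orbit_mul]
          exact (R.rep a).le_of_opNorm_le (R.norm_rep_le a) _) b⟩
  refine ⟨p, ?_, fun a t => sum_norm_sq_le_ellTwoSeminorm _ a t, fun i => ?_⟩
  · have h1 := ellTwoSeminorm_normComp_le h hC (1 : A)
    rwa [norm_one, mul_one] at h1
  · refine ⟨SeminormCompletion.lift p.1 (R.orbit (x i)).toLinearMap,
      SeminormCompletion.lift_apply (C := 1) fun a => ?_⟩
    rw [one_mul]
    exact le_ellTwoSeminorm (hk := summable_normComp_sq h) i a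

/-- The mirror image, with q(a)² = Σ‖μᵢπ(a)‖². Normality uses reflexivity once more, to turn
functionals on the dual into vectors. -/
theorem NormalRep.exists_rightSeminorm (R : NormalRep Φ) {μ : ι → StrongDual ℂ R.carrier} {C : ℝ}
    (hμ : ∀ t : Finset ι, ∑ i ∈ t, ‖μ i‖ ^ 2 ≤ C) :
    ∃ q : RightSeminorm Φ, q.1 1 ≤ √C ∧
      (∀ a (t : Finset ι), ∑ i ∈ t, ‖R.coorbit (μ i) a‖ ^ 2 ≤ q.1 a ^ 2) ∧
      ∀ i, ∃ H : SeminormCompletion q.1 →L[ℂ] StrongDual ℂ R.carrier,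
        ∀ a, H (toSeminormCompletion q.1 a) = R.coorbit (μ i) a := by
  have hC : 0 ≤ C := by simpa using hμ ∅
  have h : ∀ a (t : Finset ι), ∑ i ∈ t, ‖R.coorbit (μ i) a‖ ^ 2 ≤ C * ‖a‖ ^ 2 := fun a t =>
    sum_sq_le_of_le_mul (fun i => norm_nonneg _) (fun i => R.norm_coorbit_le (μ i) a) t (hμ t)
  let q : RightSeminorm Φ :=
    ⟨ellTwoSeminorm (fun i => normComp (R.coorbit (μ i))) (summable_normComp_sq h),
      isAdmissible_ellTwo R.reflexive.dual hC h (fun i G => by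
        obtain ⟨y, rfl⟩ := R.reflexive G
        exact R.normal y (μ i)), fun a b =>
        ellTwoSeminorm_map_le (L := LinearMap.mulRight ℂ b) (norm_nonneg b) (fun i c => by
          rw [normComp_apply, normComp_apply, LinearMap.mulRight_apply, R.coorbit_mul]
          refine (ContinuousLinearMap.opNorm_comp_le _ _).trans ?_
          rw [mul_comm]
          exact mul_le_mul_of_nonneg_right (R.norm_rep_le b) (norm_nonneg _)) a⟩
  refine ⟨q, ?_, fun a t => sum_norm_sq_le_ellTwoSeminorm _ a t, fun i => ?_⟩
  · have h1 := ellTwoSeminorm_normComp_le h hC (1 : A)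
    rwa [norm_one, mul_one] at h1
  · refine ⟨SeminormCompletion.lift q.1 (R.coorbit (μ i)).toLinearMap,
      SeminormCompletion.lift_apply (C := 1) fun a => ?_⟩
    rw [one_mul]
    exact le_ellTwoSeminorm (hk := summable_normComp_sq h) i a

end OrbitMaps

/-! ### The kernel of ψ -/

section Injective

variable {A : Type u} {P : Type v} [NormedRing A] [NormedAlgebra ℂ A] [NormOneClass A]
  [NormedAddCommGroup P] [NormedSpace ℂ P] [CompleteSpace P] {Φ : A ≃ₗᵢ[ℂ] StrongDual ℂ P}

/-- All terms are carried to one pair of completions, where `G` sees only the operator norm of `∑ D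
n`. Since `w` is killed by ψ, this norm is governed by the tail, where the operators are small. -/
theorem NormalRep.IsUniversal.norm_apply_le_of_psiPre_eq_zero {R : NormalRep Φ}
    (hR : R.IsUniversal) {w : TripleTensor R.carrier} (hw : psiPre R.rep w = 0)
    {G : StrongDual ℂ (TripleTensor R.carrier)} (hG : relSpace (commutant R.rep) ≤ G.ker)
    {ι : Type*} {s : Finset ι} {T : ι → R.carrier →L[ℂ] R.carrier} {x : ι → R.carrier}
    {μ : ι → StrongDual ℂ R.carrier} (hz : HasSum (fun i => triple (T i) (x i) (μ i)) w)
    {ε C : ℝ} (hε : 0 ≤ ε) (hT : ∀ i ∉ s, ‖T i‖ ≤ ε)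
    (hx : ∀ t : Finset ι, ∑ i ∈ t, ‖x i‖ ^ 2 ≤ C)
    (hμ : ∀ t : Finset ι, ∑ i ∈ t, ‖μ i‖ ^ 2 ≤ C) :
    ‖G w‖ ≤ ‖G‖ * (√C * √C) * ε := by
  obtain ⟨p, hp1, hp, hJ⟩ := R.exists_leftSeminorm hx
  obtain ⟨q, hq1, hq, hH⟩ := R.exists_rightSeminorm hμ
  choose J hJ using hJ
  choose H hH using hH
  obtain ⟨i, r, ξ, η, hi, hr, hξ, hη, hrξ, hηi, hia, hra⟩ := hR.exists_sandwich p q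
  obtain ⟨g, hg, hgn⟩ := exists_sandwich_functional tripleL G
    (fun T x μ => by rw [tripleL_apply]; exact norm_triple_le T x μ) hi hr (hξ.trans hp1)
    (hη.trans hq1)
  have hG' := (relSpace_le_iff _ G).1 hG
  let D : ι → SeminormCompletion p.1 →L[ℂ] StrongDual ℂ (SeminormCompletion q.1) :=
    fun n => (H n).flip ∘L (T n ∘L J n)
  have hD : ∀ n b a, D n (toSeminormCompletion p.1 b) (toSeminormCompletion q.1 a) =
      R.coorbit (μ n) a (T n (R.orbit (x n) b)) := fun n b a => by
    rw [← hJ, ← hH]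
    rfl
  -- The operator `i ∘ D n ∘ r` is `T n` between `i ∘ (H n).flip` and `J n ∘ r`, both in the
  -- commutant. The relations move these onto `η` and `ξ`, where they produce `μ n` and `x n`.
  have hgD : ∀ n, g (D n) = G (triple (T n) (x n) (μ n)) := by
    intro n
    have hc1 : i ∘L (H n).flip ∈ commutant R.rep := fun a => by
      ext1 y
      change i ((H n).flip (R.rep a y)) = R.rep a (i ((H n).flip y))
      rw [← hia]
      refine congrArg i (SeminormCompletion.ext fun c => ?_)
      rw [rightHom_apply, ContinuousLinearMap.flip_apply, ContinuousLinearMap.flip_apply, hH, hH,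
        R.coorbit_mul]
      rfl
    have hc2 : J n ∘L r ∈ commutant R.rep := fun a => by
      ext1 y
      change J n (r (R.rep a y)) = R.rep a (J n (r y))
      rw [hra]
      refine DFunLike.congr_fun (f := J n ∘L leftHom p a) (g := R.rep a ∘L J n)
        (SeminormCompletion.ext fun c => ?_) (r y)
      rw [ContinuousLinearMap.comp_apply, ContinuousLinearMap.comp_apply, leftHom_apply, hJ, hJ,
        R.orbit_mul]
    have h1 : i ∘L (D n ∘L r) = (i ∘L (H n).flip) ∘L (T n ∘L (J n ∘L r)) := by
      simp only [D, ContinuousLinearMap.comp_assoc]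
    have h2 : (J n ∘L r) ξ = x n := by
      have h3 := hrξ 1
      rw [map_one, one_apply_eq_self] at h3
      rw [ContinuousLinearMap.comp_apply, h3, hJ, R.orbit_apply, map_one, one_apply_eq_self]
    have h4 : η ∘L (i ∘L (H n).flip) = μ n := by
      ext y
      have h5 := hηi 1 ((H n).flip y)
      rw [map_one, one_apply_eq_self, ContinuousLinearMap.flip_apply, hH, R.coorbit_apply,
        map_one, one_apply_eq_self] at h5
      exact h5
    rw [hg, tripleL_apply, h1, (hG' _ hc1 _ _ _).1, (hG' _ hc2 _ _ _).2, h2, h4]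
  have hzero : ∀ b a, HasSum (fun n => R.coorbit (μ n) a (T n (R.orbit (x n) b))) 0 := by
    intro b a
    have h1 := ((hz.mapL (psiPre R.rep)).mapL (ContinuousLinearMap.apply ℂ (StrongDual ℂ A) b)).mapL
      (ContinuousLinearMap.apply ℂ ℂ a)
    simp only [hw, ContinuousLinearMap.apply_apply, zero_apply, psiPre_triple] at h1
    exact h1
  -- The forms `D n` sum to zero pointwise, so a partial sum containing `s` is estimated by finite
  -- sums off `s`, where every operator has norm at most ε. The square sums of orbits and coorbits
  -- are exactly what `p` and `q` control.
  have hbound : ∀ t : Finset ι, s ⊆ t → ‖∑ n ∈ t, D n‖ ≤ ε := by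
    intro t hst
    refine SeminormCompletion.norm_le_of_bilinear_bound _ hε fun b a => ?_
    simp only [sum_apply, hD]
    refine norm_sum_le_of_hasSum_zero (hzero b a) hst fun u hu => ?_
    exact norm_sum_apply_le T (fun n => R.orbit (x n) b) (fun n => R.coorbit (μ n) a) hε
      (fun n hn => hT n (hu n hn)) (apply_nonneg _ _) (apply_nonneg _ _) (hp b u) (hq a u)
  have hlim := (hz.mapL G).norm
  refine le_of_tendsto hlim ((Filter.eventually_ge_atTop s).mono fun t hst => ?_)
  have h1 : ∑ n ∈ t, G (triple (T n) (x n) (μ n)) = g (∑ n ∈ t, D n) := by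
    rw [map_sum]
    exact Finset.sum_congr rfl fun n _ => (hgD n).symm
  rw [h1]
  exact (hgn _).trans (mul_le_mul_of_nonneg_left (hbound t hst) (by positivity))

theorem isClosed_relSpace {E : Type*} [NormedAddCommGroup E] [NormedSpace ℂ E]
    (C : Set (E →L[ℂ] E)) : IsClosed (relSpace C : Set (TripleTensor E)) :=
  Submodule.isClosed_topologicalClosure _

/-- Otherwise some `G` vanishes on the relations but not at `w`. The constant `C` is chosen before
ε, so `‖G w‖` is at most a fixed multiple of every positive ε. -/
theorem NormalRep.IsUniversal.mem_relSpace {R : NormalRep Φ} (hR : R.IsUniversal)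
    {w : TripleTensor R.carrier} (hw : psiPre R.rep w = 0) : w ∈ relSpace (commutant R.rep) := by
  by_contra hn
  obtain ⟨G, hG, hGw⟩ := exists_dual_eq_zero_of_notMem (isClosed_relSpace _) hn
  obtain ⟨C, hC⟩ := exists_hasSum_triple_small w
  have hle : ∀ ε : ℝ, 0 < ε → ‖G w‖ ≤ ‖G‖ * (√C * √C) * ε := fun ε hε => by
    obtain ⟨ι, s, T, x, μ, hz, hT, hx, hμ⟩ := hC ε hε
    exact hR.norm_apply_le_of_psiPre_eq_zero hw (fun y hy => hG y hy) hz hε.le hT hx hμ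
  have hpos : 0 < ‖G w‖ := norm_pos_iff.2 hGw
  have hK : 0 ≤ ‖G‖ * (√C * √C) := by positivity
  have h1 := hle (‖G w‖ / (‖G‖ * (√C * √C) + 1)) (by positivity)
  rw [← mul_div_assoc, le_div_iff₀ (by positivity)] at h1
  nlinarith

theorem NormalRep.IsUniversal.injective {R : NormalRep Φ} (hR : R.IsUniversal) :
    Function.Injective (psi R.rep) := by
  refine (injective_iff_map_eq_zero (psi R.rep)).2 fun z hz => ?_
  obtain ⟨w, rfl⟩ := (relSpace (commutant R.rep)).mkQ_surjective z
  have h : psi R.rep ((relSpace (commutant R.rep)).mkQ w) = psiPre R.rep w := by simp [psi]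
  rw [h] at hz
  exact (Submodule.Quotient.mk_eq_zero _).2 (hR.mem_relSpace hz)

end Injective

/-! ### Duals of quotients under bijections -/

/-- Composition with a bijective bounded map between Banach spaces is bijective on duals. -/
theorem bijective_dual_comp {X Y : Type*} [NormedAddCommGroup X] [NormedSpace ℂ X]
    [CompleteSpace X] [NormedAddCommGroup Y] [NormedSpace ℂ Y] [CompleteSpace Y]
    (f : X →L[ℂ] Y) (hf : Function.Bijective f) :
    Function.Bijective (fun M : StrongDual ℂ Y => M ∘L f) := by
  let e : X ≃L[ℂ] Y := ContinuousLinearEquiv.ofBijective f (LinearMap.ker_eq_bot.2 hf.1)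
    (LinearMap.range_eq_top.2 hf.2)
  constructor
  · intro M N h
    ext y
    obtain ⟨x, rfl⟩ := hf.2 y
    exact DFunLike.congr_fun h x
  · intro N
    refine ⟨N ∘L (e.symm : Y →L[ℂ] X), ?_⟩
    ext x
    exact congrArg N (e.symm_apply_apply x)

theorem bijective_quotient_dual_comp {Z Y : Type*} [NormedAddCommGroup Z] [NormedSpace ℂ Z]
    [CompleteSpace Z] {S : Submodule ℂ Z} (hS : IsClosed (S : Set Z)) [NormedAddCommGroup Y]
    [NormedSpace ℂ Y] [CompleteSpace Y] (f : Z ⧸ S →L[ℂ] Y) (hf : Function.Bijective f) :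
    Function.Bijective (fun M : StrongDual ℂ Y => M ∘L f) := by
  haveI : IsClosed (S : Set Z) := hS
  exact bijective_dual_comp f hf

end

/-! ### The main theorem -/

theorem mainTheorem10 {A : Type u} {P : Type v}
    [NormedRing A] [NormedAlgebra ℂ A] [CompleteSpace A] [NormOneClass A]
    [NormedAddCommGroup P] [NormedSpace ℂ P] [CompleteSpace P]
    (Φ : A ≃ₗᵢ[ℂ] StrongDual ℂ P) (hΦ : IsDualBanachAlgebra Φ) :
    ∃ (E : Type u) (_ : NormedAddCommGroup E) (_ : NormedSpace ℂ E) (_ : CompleteSpace E)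
      (π : A →A[ℂ] (E →L[ℂ] E)),
      IsReflexiveSpace E ∧
      Isometry π ∧
      Continuous[weakStarTopology Φ, weakStarTopology (opPairing E)] π ∧
      ∃ hψ : ∀ z, psi π z ∈ sigmaWCBil Φ,
        Function.Bijective ((psi π).codRestrict (sigmaWCBil Φ) hψ) ∧
        ∃ Λ : bimoduleMaps (commutant π) ≃ₗᵢ[ℂ] StrongDual ℂ (BimodulePredual π),
          (∀ (S : bimoduleMaps (commutant π)) (T : E →L[ℂ] E) (x : E) (μ : StrongDual ℂ E),
            Λ S ((relSpace (commutant π)).mkQL (triple T x μ)) =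
              μ ((S : (E →L[ℂ] E) →L[ℂ] (E →L[ℂ] E)) T x)) ∧
          Function.Bijective (fun M : StrongDual ℂ (sigmaWCBil Φ) =>
            Λ.symm (M ∘L (psi π).codRestrict (sigmaWCBil Φ) hψ)) := by
  obtain ⟨R, hR⟩ := exists_isUniversal hΦ
  obtain ⟨Λ, hΛ⟩ := exists_bimoduleMaps_equiv R.reflexive (commutant R.rep)
  have hbij : Function.Bijective ((psi R.rep).codRestrict (sigmaWCBil Φ) R.psi_mem) := by
    refine ⟨fun z z' h => hR.injective (congrArg Subtype.val h), fun T => ?_⟩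
    obtain ⟨z, hz⟩ := hR.surjective T.2
    exact ⟨z, Subtype.ext hz⟩
  -- Closedness of σWC makes it a Banach space, as the open mapping theorem behind the bijectivity
  -- of the adjoint requires.
  haveI : CompleteSpace (sigmaWCBil Φ) :=
    (isClosed_sigmaWC (leftAct A) (rightAct A)).completeSpace_coe
  exact ⟨R.carrier, R.normedAddCommGroup, R.normedSpace, R.completeSpace, R.rep, R.reflexive,
    hR.isometry hΦ, R.continuous_rep, R.psi_mem, hbij, Λ, hΛ,
    Λ.symm.bijective.comp (bijective_quotient_dual_comp (isClosed_relSpace _) _ hbij)⟩
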